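/- **Theorem (NSE of the $\ell_2$-LASSO in $\mathcal R_{\mathrm{ON}}$).** *Setup.* For $f:\mathbb R^n\to\mathbb R$ convex and continuous and $x_0\in\mathbb R^n$, let $\partial f(x_0)$ be the subdifferential of $f$ at $x_0$, and for $\lambda\ge 0$ and $h\sim\mathcal N(0,I_n)$ put $$D_f(x_0,\lambda)=\mathbb E\big[\operatorname{dist}^2(h,\lambda\,\partial f(x_0))\big],\qquad C_f(x_0,\lambda)=\mathbb E\big[\big\langle h-\operatorname{Proj}(h,\lambda\,\partial f(x_0)),\ \operatorname{Proj}(h,\lambda\,\partial f(x_0))\big\rangle\big],$$ where $\operatorname{dist}$ and $\operatorname{Proj}$ denote Euclidean distance to, and Euclidean projection onto, a closed convex set. Let $A\in\mathbb R^{m\times n}$ have independent standard normal entries, let $v\sim\mathcal N(0,I_m)$ be independent of $A$, let $\sigma>0$ and $y=Ax_0+\sigma v$. The $\ell_2$-LASSO estimates $x^*_{\ell_2}$ are the minimizers over $x\in\mathbb R^n$ of $\|y-Ax\|_2+\lambda f(x)$. *Statement.* For every $\epsilon_L>0$ and every $\epsilon>0$ there exist a constant $C=C(\epsilon,\epsilon_L)>0$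 and an integer $m_0=m_0(\epsilon,\epsilon_L)$ such that the following holds for all $m\ge m_0$, all $n$, all convex continuous $f:\mathbb R^n\to\mathbb R$, all $x_0\in\mathbb R^n$ with $0\notin\partial f(x_0)$, and all $\lambda\ge 0$. If $$(1-\epsilon_L)m\ \ge\ \max\{D_f(x_0,\lambda),\ D_f(x_0,\lambda)+C_f(x_0,\lambda)\}\qquad\text{and}\qquad D_f(x_0,\lambda)\ \ge\ \epsilon_L m,$$ then there is a deterministic number $\sigma_0>0$ (not depending on $A$ and $v$) such that, for every $0<\sigma\le\sigma_0$, with probability at least $1-\exp\!\big(-C\min\{m,\tfrac{m^2}{n}\}\big)$ over $(A,v)$, the $\ell_2$-LASSO problem has a minimizer and every minimizer $x^*_{\ell_2}$ satisfies $$\left|\frac{\|x^*_{\ell_2}-x_0\|_2^2}{\sigma^2}\cdot\frac{m-D_f(x_0,\lambda)}{D_f(x_0,\lambda)}-1\right|<\epsilon .$$ -/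

import Mathlib

open MeasureTheory ProbabilityTheory
open scoped Pointwise

namespace EllTwoLasso

noncomputable section

/-- `n`-dimensional Euclidean space. -/
abbrev Vec (n : ℕ) : Type := EuclideanSpace ℝ (Fin n)

/-- The subdifferential `∂f(x₀)` of `f : ℝⁿ → ℝ` at `x₀`. -/
def subdifferential {n : ℕ} (f : Vec n → ℝ) (x₀ : Vec n) : Set (Vec n) :=
  {s | ∀ x, f x₀ + inner ℝ s (x - x₀) ≤ f x}

/-- `Proj(x, K)`, a point of `K` nearest to `x`; for `K` nonempty, closed and convex it exists and
is unique (see `proj_mem`, `norm_sub_proj_le`, `eq_proj`). -/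
def proj {n : ℕ} (x : Vec n) (K : Set (Vec n)) : Vec n :=
  Classical.epsilon fun p => p ∈ K ∧ ∀ q ∈ K, ‖x - p‖ ≤ ‖x - q‖

theorem proj_spec {n : ℕ} (x : Vec n) {K : Set (Vec n)} (hne : K.Nonempty) (hK : IsClosed K) :
    proj x K ∈ K ∧ ∀ q ∈ K, ‖x - proj x K‖ ≤ ‖x - q‖ := by
  obtain ⟨p, hp, hpd⟩ := hK.exists_infDist_eq_dist hne x
  have h : ∃ p, p ∈ K ∧ ∀ q ∈ K, ‖x - p‖ ≤ ‖x - q‖ := by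
    refine ⟨p, hp, fun q hq => ?_⟩
    rw [← dist_eq_norm, ← dist_eq_norm, ← hpd]
    exact Metric.infDist_le_dist_of_mem hq
  exact Classical.epsilon_spec h

theorem proj_mem {n : ℕ} (x : Vec n) {K : Set (Vec n)} (hne : K.Nonempty) (hK : IsClosed K) :
    proj x K ∈ K := (proj_spec x hne hK).1

theorem norm_sub_proj_le {n : ℕ} (x : Vec n) {K : Set (Vec n)} (hne : K.Nonempty)
    (hK : IsClosed K) {q : Vec n} (hq : q ∈ K) : ‖x - proj x K‖ ≤ ‖x - q‖ :=
  (proj_spec x hne hK).2 q hq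

theorem eq_proj {n : ℕ} {x p : Vec n} {K : Set (Vec n)} (hK : IsClosed K) (hc : Convex ℝ K)
    (hp : p ∈ K) (h : ∀ q ∈ K, ‖x - p‖ ≤ ‖x - q‖) : p = proj x K := by
  have hne : K.Nonempty := ⟨p, hp⟩
  have key : ∀ u ∈ K, (∀ q ∈ K, ‖x - u‖ ≤ ‖x - q‖) → ∀ w ∈ K, inner ℝ (x - u) (w - u) ≤ 0 := by
    intro u hu hmin
    have : Nonempty K := ⟨⟨u, hu⟩⟩
    rw [← norm_eq_iInf_iff_real_inner_le_zero hc hu]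
    refine le_antisymm (le_ciInf fun w => hmin w w.2) ?_
    exact ciInf_le (f := fun w : K => ‖x - w‖) ⟨0, by rintro _ ⟨w, rfl⟩; positivity⟩ ⟨u, hu⟩
  obtain ⟨hq, hqmin⟩ := proj_spec x hne hK
  have h1 := key p hp h _ hq
  have h2 := key _ hq hqmin p hp
  have h3 : inner ℝ (p - proj x K) (p - proj x K) ≤ 0 := by
    have e : inner ℝ (p - proj x K) (p - proj x K)
        = inner ℝ (x - p) (proj x K - p) + inner ℝ (x - proj x K) (p - proj x K) := by
      rw [← neg_sub p (proj x K), inner_neg_right, neg_add_eq_sub, ← inner_sub_left]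
      congr 1
      abel
    rw [e]
    linarith
  rw [real_inner_self_eq_norm_sq] at h3
  exact sub_eq_zero.1 (norm_eq_zero.1 (by nlinarith [norm_nonneg (p - proj x K)]))

/-- `D_f(x₀, lam) = E dist²(h, lam ∂f(x₀))` for `h ∼ N(0, I_n)`. -/
def gaussDist {n : ℕ} (f : Vec n → ℝ) (x₀ : Vec n) (lam : ℝ) : ℝ :=
  ∫ h, Metric.infDist h (lam • subdifferential f x₀) ^ 2 ∂(stdGaussian (Vec n))

/-- `C_f(x₀, lam) = E ⟨h - Proj(h, lam ∂f(x₀)), Proj(h, lam ∂f(x₀))⟩` for `h ∼ N(0, I_n)`. -/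
def gaussCorr {n : ℕ} (f : Vec n → ℝ) (x₀ : Vec n) (lam : ℝ) : ℝ :=
  ∫ h, inner ℝ (h - proj h (lam • subdifferential f x₀)) (proj h (lam • subdifferential f x₀))
    ∂(stdGaussian (Vec n))

/-- The noisy observation `y = A x₀ + σ v`. -/
def observation {m n : ℕ} (A : Matrix (Fin m) (Fin n) ℝ) (v : Vec m) (x₀ : Vec n) (σ : ℝ) :
    Vec m :=
  A.toEuclideanLin x₀ + σ • v

/-- `x` is a solution of the `ℓ₂`-LASSO `min_x ‖y - A x‖₂ + lam f(x)`. -/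
def IsSolution {m n : ℕ} (f : Vec n → ℝ) (lam : ℝ) (A : Matrix (Fin m) (Fin n) ℝ) (y : Vec m)
    (x : Vec n) : Prop :=
  ∀ x', ‖y - A.toEuclideanLin x‖ + lam * f x ≤ ‖y - A.toEuclideanLin x'‖ + lam * f x'

/-- The joint law of `(A, v)`: `A` is an `m × n` array with independent standard normal entries,
`v ∼ N(0, I_m)`, and `A`, `v` are independent. -/
def modelLaw (m n : ℕ) : Measure ((Fin m → Fin n → ℝ) × Vec m) :=
  (Measure.pi fun _ => Measure.pi fun _ => gaussianReal 0 1).prod (stdGaussian (Vec m))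

end

end EllTwoLasso

/-!
Write `x = x₀ + σ w`. After division by `σ` the `ℓ₂`-LASSO objective is convex in `w`, and as
`σ → 0` it tends to the first-order objective `‖v - A w‖ + sup {⟪s, w⟫ | s ∈ K}` with
`K = λ ∂f(x₀)`: it is never smaller, and on bounded sets the excess is small uniformly in `A` and
`v` (`le_scaledObjective`, `exists_scaledObjective_le`). By convexity
(`exists_minimizer_and_norm_mem`) it suffices to show that the first-order objective dips below a
level `c₁` somewhere in the ball of radius `α = √(D / (m - D))`, while it stays above a larger level
`c₂` on a slightly smaller ball and on a slightly larger sphere.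

Both facts follow from Gordon's comparison inequality (`measure_exists_forall_le`) applied to the
matrix `A` with `v` held fixed. It replaces `⟪u, A w⟫` by `‖w‖ ⟪u, g⟫ + ‖u‖ ⟪w, h⟫` with independent
Gaussian vectors `g`, `h`, after which only norms and distances to `K` matter.

* From below, the objective at norm `r` becomes `‖v - r g‖ - r dist(h, K)`, which is close to
  `√m √(1 + r²) - r √D`. This function of `r` has the strict minimum `√m / √(1 + α²)` at `r = α`
  (`measure_exists_objective_lt_le`, `sqrt_one_add_sq_sub_ge`).
* From above, Sion's minimax theorem reduces the minimum over the ball of radius `α` to a dual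
  problem, to which the comparison applies with the roles exchanged; it leaves
  `β ‖v + α g‖ - α dist(β h, K)` for `0 ≤ β ≤ 1` (`measure_forall_le_objective_le`). This function
  is concave in `β`, and the hypothesis `D + C < m` says that its mean is nondecreasing near
  `β = 1`, so concavity at the scales `1`, `1 - η`, `1 - 2η` bounds it for all `β` by approximately
  its value `√m / √(1 + α²)` at `β = 1`
  (`concaveOn_le_of_three_points`, `meanSqDist_one_sub_ge`).

Norms and distances are Lipschitz functions of Gaussian vectors, so they concentrate at a
dimension-free scale (`hasSubgaussianMGF_of_lipschitz`, proved by rotating two independent copies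
into one another), and all the exceptional events have probability at most `exp(-c m)`. Since
`min(m, m² / n) ≤ m`, this is enough.
-/

namespace EllTwoLasso

noncomputable section

/-! ### Gaussian concentration -/

section QuarterCircle

variable {E : Type*} [NormedAddCommGroup E] [InnerProductSpace ℝ E]

/-- The pointwise step of the Maurey–Pisier argument: along the quarter circle from `x` to `y`,
Jensen's inequality moves the exponential inside the integral of the derivative. -/
lemma exp_mul_sub_le_lintegral {F : E → ℝ} (hF : ContDiff ℝ 1 F) (t : ℝ) (p : E × E) :
    ENNReal.ofReal (Real.exp (t * (F p.2 - F p.1)))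
      ≤ ∫⁻ s in Set.Ioc (0 : ℝ) 1, ENNReal.ofReal (Real.exp ((t * (Real.pi / 2)) *
          fderiv ℝ F (ContinuousLinearMap.rotation (s * (Real.pi / 2)) p).1
            (ContinuousLinearMap.rotation (s * (Real.pi / 2)) p).2)) := by
  obtain ⟨x, y⟩ := p
  set ν : Measure ℝ := volume.restrict (Set.Ioc (0 : ℝ) 1) with hν
  have : IsProbabilityMeasure ν := ⟨by simp [hν]⟩
  simp only [ContinuousLinearMap.rotation_apply]
  set γ : ℝ → E := fun s => Real.cos (s * (Real.pi / 2)) • x + Real.sin (s * (Real.pi / 2)) • y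
  set γ' : ℝ → E := fun s => -Real.sin (s * (Real.pi / 2)) • x + Real.cos (s * (Real.pi / 2)) • y
  have hγc : Continuous γ := by fun_prop
  have hγ'c : Continuous γ' := by fun_prop
  have hγ : ∀ s, HasDerivAt γ ((Real.pi / 2) • γ' s) s := by
    intro s
    have hl : HasDerivAt (fun s : ℝ => s * (Real.pi / 2)) (Real.pi / 2) s := by
      simpa using (hasDerivAt_id s).mul_const (Real.pi / 2)
    have h := (hl.cos.smul_const x).add (hl.sin.smul_const y)
    refine h.congr_deriv ?_
    simp only [γ', smul_add, smul_smul]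
    congr 2 <;> ring
  have hfd : Continuous (fderiv ℝ F) := hF.continuous_fderiv (by norm_num)
  set k : ℝ → ℝ := fun s => (Real.pi / 2) * fderiv ℝ F (γ s) (γ' s)
  have hkc : Continuous k := by
    have : Continuous fun s => fderiv ℝ F (γ s) (γ' s) := (hfd.comp hγc).clm_apply hγ'c
    exact continuous_const.mul this
  have hFd : ∀ s, HasDerivAt (fun s => F (γ s)) (k s) s := by
    intro s
    have h := ((hF.differentiable (by norm_num)) (γ s)).hasFDerivAt.comp_hasDerivAt s (hγ s)
    rw [map_smul, smul_eq_mul] at h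
    exact h
  have hint : F y - F x = ∫ s, k s ∂ν := by
    have h := intervalIntegral.integral_eq_sub_of_hasDerivAt (a := 0) (b := 1)
      (fun s _ => hFd s) (hkc.intervalIntegrable _ _)
    rw [intervalIntegral.integral_of_le zero_le_one] at h
    rw [hν, h]
    simp [γ]
  have hki : Integrable (fun s => t * k s) ν := by
    have := (continuous_const.mul hkc : Continuous fun s => t * k s).intervalIntegrable
      (μ := volume) 0 1
    rwa [intervalIntegrable_iff_integrableOn_Ioc_of_le zero_le_one] at this
  have hei : Integrable (fun s => Real.exp (t * k s)) ν := by
    have := (Real.continuous_exp.comp (continuous_const.mul hkc) :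
      Continuous fun s => Real.exp (t * k s)).intervalIntegrable (μ := volume) 0 1
    rwa [intervalIntegrable_iff_integrableOn_Ioc_of_le zero_le_one] at this
  have hJ : Real.exp (∫ s, t * k s ∂ν) ≤ ∫ s, Real.exp (t * k s) ∂ν :=
    convexOn_exp.map_integral_le Real.continuous_exp.continuousOn isClosed_univ
      (ae_of_all _ fun _ => Set.mem_univ _) hki hei
  rw [hint, ← integral_const_mul]
  refine (ENNReal.ofReal_le_ofReal hJ).trans ?_
  rw [ofReal_integral_eq_lintegral_ofReal hei (ae_of_all _ fun _ => (Real.exp_pos _).le)]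
  refine le_of_eq (lintegral_congr fun s => ?_)
  simp only [k, γ, γ']
  congr 2
  ring

end QuarterCircle

section Concentration

variable {E : Type*} [NormedAddCommGroup E] [InnerProductSpace ℝ E] [FiniteDimensional ℝ E]
  [MeasurableSpace E] [BorelSpace E]

lemma lintegral_exp_strongDual_stdGaussian (L : StrongDual ℝ E) :
    ∫⁻ y, ENNReal.ofReal (Real.exp (L y)) ∂(stdGaussian E)
      = ENNReal.ofReal (Real.exp (‖L‖ ^ 2 / 2)) := by
  have hmap := IsGaussian.map_eq_gaussianReal (μ := stdGaussian E) L
  rw [integral_strongDual_stdGaussian, variance_dual_stdGaussian] at hmap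
  have h1 : ∫⁻ y, ENNReal.ofReal (Real.exp (L y)) ∂(stdGaussian E)
      = ∫⁻ r, ENNReal.ofReal (Real.exp r) ∂(gaussianReal 0 (‖L‖ ^ 2).toNNReal) := by
    rw [← hmap, lintegral_map (by fun_prop) (by fun_prop)]
  have hint : Integrable (fun r => Real.exp (1 * r)) (gaussianReal 0 (‖L‖ ^ 2).toNNReal) :=
    integrable_exp_mul_gaussianReal 1
  have h2 := congrFun (mgf_id_gaussianReal (μ := 0) (v := (‖L‖ ^ 2).toNNReal)) 1
  simp only [mgf, id_eq, one_mul] at h2 hint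
  rw [h1, ← ofReal_integral_eq_lintegral_ofReal hint (ae_of_all _ fun _ => (Real.exp_pos _).le), h2]
  rw [Real.coe_toNNReal _ (by positivity)]
  congr 2
  ring

/-- The law of two independent standard Gaussian vectors is invariant under rotation of the pair. -/
lemma lintegral_comp_rotation {G : E × E → ENNReal} (hG : Measurable G) (θ : ℝ) :
    ∫⁻ p, G (ContinuousLinearMap.rotation θ p) ∂((stdGaussian E).prod (stdGaussian E))
      = ∫⁻ p, G p ∂((stdGaussian E).prod (stdGaussian E)) := by
  conv_rhs => rw [← IsGaussian.map_rotation_eq_self (μ := stdGaussian E)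
    (by simp) θ]
  rw [lintegral_map hG (by fun_prop)]

/-- The Maurey–Pisier bound: for independent Gaussian `x` and `y`, rotation along the quarter circle
reduces the exponential moment of `F y - F x` to that of the derivative of `F` at `x` applied to
`y`, which is Gaussian given `x`. -/
lemma lintegral_exp_mul_sub_le {F : E → ℝ} (hF : ContDiff ℝ 1 F) (hL : LipschitzWith 1 F) (t : ℝ) :
    ∫⁻ p : E × E, ENNReal.ofReal (Real.exp (t * (F p.2 - F p.1)))
        ∂((stdGaussian E).prod (stdGaussian E))
      ≤ ENNReal.ofReal (Real.exp (Real.pi ^ 2 / 4 * t ^ 2 / 2)) := by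
  have hfd : Continuous (fderiv ℝ F) := hF.continuous_fderiv (by norm_num)
  set G : E × E → ENNReal := fun p =>
    ENNReal.ofReal (Real.exp ((t * (Real.pi / 2)) * fderiv ℝ F p.1 p.2)) with hG
  have hGc : Continuous G := by
    have h1 : Continuous fun p : E × E => fderiv ℝ F p.1 p.2 :=
      (hfd.comp continuous_fst).clm_apply continuous_snd
    exact ENNReal.continuous_ofReal.comp (Real.continuous_exp.comp (continuous_const.mul h1))
  have hG1 : ∫⁻ p, G p ∂((stdGaussian E).prod (stdGaussian E))
      ≤ ENNReal.ofReal (Real.exp (Real.pi ^ 2 / 4 * t ^ 2 / 2)) := by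
    rw [lintegral_prod _ hGc.measurable.aemeasurable]
    have : ∀ x : E, ∫⁻ y, G (x, y) ∂(stdGaussian E)
        ≤ ENNReal.ofReal (Real.exp (Real.pi ^ 2 / 4 * t ^ 2 / 2)) := by
      intro x
      have h := lintegral_exp_strongDual_stdGaussian ((t * (Real.pi / 2)) • fderiv ℝ F x)
      simp only [smul_apply, smul_eq_mul] at h
      simp only [hG]
      rw [h]
      refine ENNReal.ofReal_le_ofReal (Real.exp_le_exp.2 ?_)
      have hn : ‖fderiv ℝ F x‖ ≤ 1 := by simpa using norm_fderiv_le_of_lipschitz ℝ hL (x₀ := x)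
      rw [norm_smul, mul_pow, Real.norm_eq_abs, sq_abs]
      have h2 : ‖fderiv ℝ F x‖ ^ 2 ≤ 1 := pow_le_one₀ (norm_nonneg _) hn
      nlinarith [sq_nonneg (t * (Real.pi / 2))]
    calc _ ≤ ∫⁻ _ : E, ENNReal.ofReal (Real.exp (Real.pi ^ 2 / 4 * t ^ 2 / 2)) ∂(stdGaussian E) :=
          lintegral_mono this
      _ = _ := by simp
  have hjm : Measurable (Function.uncurry fun (p : E × E) (s : ℝ) =>
      G (ContinuousLinearMap.rotation (s * (Real.pi / 2)) p)) := by
    refine (hGc.comp ?_).measurable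
    simp only [ContinuousLinearMap.rotation_apply]
    fun_prop
  calc _ ≤ ∫⁻ p : E × E, (∫⁻ s in Set.Ioc (0 : ℝ) 1,
          G (ContinuousLinearMap.rotation (s * (Real.pi / 2)) p))
        ∂((stdGaussian E).prod (stdGaussian E)) :=
        lintegral_mono fun p => exp_mul_sub_le_lintegral hF t p
    _ = ∫⁻ s in Set.Ioc (0 : ℝ) 1, ∫⁻ p : E × E,
          G (ContinuousLinearMap.rotation (s * (Real.pi / 2)) p)
        ∂((stdGaussian E).prod (stdGaussian E)) := lintegral_lintegral_swap hjm.aemeasurable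
    _ = ∫⁻ s in Set.Ioc (0 : ℝ) 1, ∫⁻ p : E × E, G p ∂((stdGaussian E).prod (stdGaussian E)) := by
        simp_rw [lintegral_comp_rotation hGc.measurable]
    _ = ∫⁻ p : E × E, G p ∂((stdGaussian E).prod (stdGaussian E)) := by simp
    _ ≤ _ := hG1

/-- Gaussian concentration: a `C¹` function with Lipschitz constant `1` is sub-Gaussian around its
mean, in every dimension. -/
theorem hasSubgaussianMGF_of_lipschitz {F : E → ℝ} (hF : ContDiff ℝ 1 F) (hL : LipschitzWith 1 F) :
    Integrable F (stdGaussian E) ∧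
    HasSubgaussianMGF (fun x => F x - ∫ y, F y ∂(stdGaussian E)) (Real.pi ^ 2 / 4).toNNReal
      (stdGaussian E) := by
  have hFc : Continuous F := hF.continuous
  have hprod : ∀ t : ℝ, (∫⁻ x, ENNReal.ofReal (Real.exp (-t * F x)) ∂(stdGaussian E)) *
      (∫⁻ y, ENNReal.ofReal (Real.exp (t * F y)) ∂(stdGaussian E))
      ≤ ENNReal.ofReal (Real.exp (Real.pi ^ 2 / 4 * t ^ 2 / 2)) := by
    intro t
    refine le_trans (le_of_eq ?_) (lintegral_exp_mul_sub_le hF hL t)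
    rw [← lintegral_prod_mul (by fun_prop) (by fun_prop)]
    refine lintegral_congr fun p => ?_
    rw [← ENNReal.ofReal_mul (Real.exp_pos _).le, ← Real.exp_add]
    congr 2; ring
  have hne : ∀ t : ℝ, (∫⁻ x, ENNReal.ofReal (Real.exp (t * F x)) ∂(stdGaussian E)) ≠ 0 := by
    intro t h
    rw [lintegral_eq_zero_iff (by fun_prop)] at h
    have : (∀ᵐ x ∂(stdGaussian E), False) := by
      filter_upwards [h] with x hx
      simp at hx
      exact absurd hx (not_le.2 (Real.exp_pos _))
    rw [Filter.eventually_false_iff_eq_bot, ae_eq_bot] at this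
    exact IsProbabilityMeasure.ne_zero (stdGaussian E) this
  have hexp : ∀ t : ℝ, Integrable (fun x => Real.exp (t * F x)) (stdGaussian E) := by
    intro t
    refine ⟨by fun_prop, ?_⟩
    rw [hasFiniteIntegral_iff_ofReal (ae_of_all _ fun _ => (Real.exp_pos _).le)]
    by_contra h
    rw [not_lt, top_le_iff] at h
    have h2 := hprod t
    rw [h, ENNReal.mul_top (hne (-t))] at h2
    exact absurd h2 (by simp)
  have hFi : Integrable F (stdGaussian E) := by
    refine ((hexp 1).add (hexp (-1))).mono' (by fun_prop) (ae_of_all _ fun x => ?_)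
    rw [Real.norm_eq_abs]
    simp only [Pi.add_apply, one_mul, neg_mul]
    have h1 := Real.add_one_le_exp (F x)
    have h2 := Real.add_one_le_exp (-F x)
    have h3 := Real.exp_pos (F x)
    have h4 := Real.exp_pos (-F x)
    rcases abs_cases (F x) with h | h <;> linarith
  refine ⟨hFi, ?_, ?_⟩
  · intro t
    have := (hexp t).const_mul (Real.exp (-t * ∫ y, F y ∂(stdGaussian E)))
    refine this.congr (ae_of_all _ fun x => ?_)
    simp only [← Real.exp_add]
    congr 1; ring
  · intro t
    rw [mgf, Real.coe_toNNReal _ (by positivity)]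
    have e : ∀ x, Real.exp (t * (F x - ∫ y, F y ∂(stdGaussian E)))
        = Real.exp (-t * ∫ y, F y ∂(stdGaussian E)) * Real.exp (t * F x) := by
      intro x; rw [← Real.exp_add]; congr 1; ring
    simp_rw [e]
    rw [integral_const_mul]
    have hJ : Real.exp (∫ y, -t * F y ∂(stdGaussian E))
        ≤ ∫ y, Real.exp (-t * F y) ∂(stdGaussian E) :=
      convexOn_exp.map_integral_le Real.continuous_exp.continuousOn isClosed_univ
        (ae_of_all _ fun _ => Set.mem_univ _) (hFi.const_mul _) (hexp _)
    rw [integral_const_mul] at hJ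
    refine (mul_le_mul_of_nonneg_right hJ (integral_nonneg fun _ => (Real.exp_pos _).le)).trans ?_
    have h := hprod t
    rw [← ofReal_integral_eq_lintegral_ofReal (hexp _) (ae_of_all _ fun _ => (Real.exp_pos _).le),
      ← ofReal_integral_eq_lintegral_ofReal (hexp _) (ae_of_all _ fun _ => (Real.exp_pos _).le),
      ← ENNReal.ofReal_mul (integral_nonneg fun _ => (Real.exp_pos _).le)] at h
    exact (ENNReal.ofReal_le_ofReal_iff (Real.exp_pos _).le).1 h

end Concentration

/-! ### Gordon's comparison for a smoothed indicator -/

lemma one_sub_prod_mem {J : Type*} {ρ : ℝ → ℝ} (h0 : ∀ x, 0 ≤ ρ x) (h1 : ∀ x, ρ x ≤ 1)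
    (y : J → ℝ) (s : Finset J) :
    0 ≤ 1 - ∏ j ∈ s, ρ (y j) ∧ 1 - ∏ j ∈ s, ρ (y j) ≤ 1 := by
  have a := Finset.prod_le_one (s := s) (fun j _ => h0 (y j)) (fun j _ => h1 (y j))
  have b := Finset.prod_nonneg (s := s) (fun j _ => h0 (y j))
  constructor <;> linarith

section SmoothStep

variable {I J : Type*} [Fintype I] [Fintype J]

/-- A smoothed indicator of the event `∀ i, ∃ j, z i j ≤ 0`: each `ρ (z i j)` is a smoothed
indicator of `0 < z i j`. -/
def softAllExists (ρ : ℝ → ℝ) (z : I → J → ℝ) : ℝ := ∏ i, (1 - ∏ j, ρ (z i j))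

/-- The partial derivative of `softAllExists ρ` in the coordinate `(i, j)`. -/
def softAllExistsPartial [DecidableEq I] [DecidableEq J] (ρ : ℝ → ℝ)
    (z : I → J → ℝ) (i : I) (j : J) : ℝ :=
  -((∏ k ∈ Finset.univ.erase i, (1 - ∏ l, ρ (z k l))) *
    ((∏ l ∈ Finset.univ.erase j, ρ (z i l)) * deriv ρ (z i j)))

variable {ρ : ℝ → ℝ}

lemma hasDerivAt_softAllExists [DecidableEq I] [DecidableEq J] (hρ : Differentiable ℝ ρ)
    {z : ℝ → I → J → ℝ} {z' : I → J → ℝ} {θ : ℝ}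
    (hz : ∀ i j, HasDerivAt (fun θ => z θ i j) (z' i j) θ) :
    HasDerivAt (fun θ => softAllExists ρ (z θ))
      (∑ i, ∑ j, softAllExistsPartial ρ (z θ) i j * z' i j) θ := by
  have h1 : ∀ i j, HasDerivAt (fun θ => ρ (z θ i j)) (deriv ρ (z θ i j) * z' i j) θ :=
    fun i j => (hρ _).hasDerivAt.comp θ (hz i j)
  have h2 : ∀ i, HasDerivAt (fun θ => 1 - ∏ j, ρ (z θ i j))
      (-∑ j, (∏ l ∈ Finset.univ.erase j, ρ (z θ i l)) • (deriv ρ (z θ i j) * z' i j)) θ :=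
    fun i => (HasDerivAt.fun_finsetProd fun j _ => h1 i j).const_sub 1
  refine (HasDerivAt.fun_finsetProd (u := Finset.univ) fun i _ => h2 i).congr_deriv ?_
  refine Finset.sum_congr rfl fun i _ => ?_
  rw [smul_eq_mul, mul_neg, Finset.mul_sum, ← Finset.sum_neg_distrib]
  refine Finset.sum_congr rfl fun j _ => ?_
  simp only [softAllExistsPartial, smul_eq_mul]
  ring

lemma softAllExists_mem (h0 : ∀ x, 0 ≤ ρ x) (h1 : ∀ x, ρ x ≤ 1) (z : I → J → ℝ) :
    0 ≤ softAllExists ρ z ∧ softAllExists ρ z ≤ 1 :=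
  ⟨Finset.prod_nonneg fun i _ => (one_sub_prod_mem h0 h1 (z i) _).1,
    Finset.prod_le_one (fun i _ => (one_sub_prod_mem h0 h1 (z i) _).1)
      fun i _ => (one_sub_prod_mem h0 h1 (z i) _).2⟩

lemma abs_softAllExistsPartial_le [DecidableEq I] [DecidableEq J]
    (h0 : ∀ x, 0 ≤ ρ x) (h1 : ∀ x, ρ x ≤ 1) {B : ℝ}
    (hB : ∀ x, |deriv ρ x| ≤ B) (z : I → J → ℝ) (i : I) (j : J) :
    |softAllExistsPartial ρ z i j| ≤ B := by
  rw [softAllExistsPartial, abs_neg, abs_mul, abs_mul]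
  have a1 : |∏ k ∈ Finset.univ.erase i, (1 - ∏ l, ρ (z k l))| ≤ 1 := by
    rw [abs_of_nonneg (Finset.prod_nonneg fun i _ => (one_sub_prod_mem h0 h1 (z i) _).1)]
    exact Finset.prod_le_one (fun i _ => (one_sub_prod_mem h0 h1 (z i) _).1)
      fun i _ => (one_sub_prod_mem h0 h1 (z i) _).2
  have a2 : |∏ l ∈ Finset.univ.erase j, ρ (z i l)| ≤ 1 := by
    rw [abs_of_nonneg (Finset.prod_nonneg fun l _ => h0 _)]
    exact Finset.prod_le_one (fun l _ => h0 _) fun l _ => h1 _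
  have hB0 : 0 ≤ B := (abs_nonneg _).trans (hB 0)
  calc _ ≤ 1 * (1 * B) := by
        gcongr
        exact hB _
    _ = B := by ring

/-- The partial derivative in a coordinate of row `i` is nondecreasing in the other rows. -/
lemma softAllExistsPartial_mono [DecidableEq I] [DecidableEq J]
    (h0 : ∀ x, 0 ≤ ρ x) (h1 : ∀ x, ρ x ≤ 1) (hm : Monotone ρ)
    {z y : I → J → ℝ} {i : I} (j : J) (hrow : ∀ l, z i l = y i l)
    (hle : ∀ k, k ≠ i → ∀ l, z k l ≤ y k l) :
    softAllExistsPartial ρ z i j ≤ softAllExistsPartial ρ y i j := by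
  simp only [softAllExistsPartial, hrow]
  refine neg_le_neg (mul_le_mul_of_nonneg_right ?_ ?_)
  · refine Finset.prod_le_prod (fun k _ => (one_sub_prod_mem h0 h1 (y k) _).1) fun k hk => ?_
    refine sub_le_sub_left (Finset.prod_le_prod (fun _ _ => h0 _) fun l _ => hm ?_) 1
    exact hle k (Finset.ne_of_mem_erase hk) l
  · exact mul_nonneg (Finset.prod_nonneg fun _ _ => h0 _) hm.deriv_nonneg

end SmoothStep

section Gordon

variable {E : Type*} [NormedAddCommGroup E] [InnerProductSpace ℝ E] [FiniteDimensional ℝ E]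
  [MeasurableSpace E] [BorelSpace E]
variable {I J : Type*} [Fintype I] [Fintype J] [DecidableEq I] [DecidableEq J]
variable {ρ : ℝ → ℝ}

lemma integral_comp_isometry_stdGaussian (T : E ≃ₗᵢ[ℝ] E) (f : E → ℝ) :
    ∫ ξ, f (T ξ) ∂(stdGaussian E) = ∫ ξ, f ξ ∂(stdGaussian E) := by
  have h : MeasurePreserving T (stdGaussian E) (stdGaussian E) :=
    ⟨T.continuous.measurable, stdGaussian_map T⟩
  exact h.integral_comp T.toHomeomorph.measurableEmbedding f

/-- The sign of one term of the derivative along the interpolation. Reflecting in the hyperplane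
orthogonal to `w` flips the sign of `⟪w, ξ⟫` and moves the arguments of the partial derivative
monotonically, so the sum of the integrand and of its reflection is pointwise nonpositive. -/
lemma integral_inner_mul_softAllExistsPartial_nonpos (hρ : ContDiff ℝ 1 ρ) (hm : Monotone ρ)
    (h0 : ∀ x, 0 ≤ ρ x) (h1 : ∀ x, ρ x ≤ 1) {B : ℝ} (hB : ∀ x, |deriv ρ x| ≤ B)
    (z : I → J → E) (c : I → J → ℝ) (w : E) (i : I) (j : J)
    (hrow : ∀ l, inner ℝ (z i l) w = 0) (hle : ∀ k, k ≠ i → ∀ l, inner ℝ (z k l) w ≤ 0) :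
    ∫ ξ, softAllExistsPartial ρ (fun k l => inner ℝ (z k l) ξ - c k l) i j * inner ℝ w ξ
      ∂(stdGaussian E) ≤ 0 := by
  set G : E → ℝ := fun ξ => softAllExistsPartial ρ (fun k l => inner ℝ (z k l) ξ - c k l) i j
  have hGc : Continuous G := by
    have hd : Continuous (deriv ρ) := hρ.continuous_deriv (by norm_num)
    have hc : Continuous ρ := hρ.continuous
    simp only [G, softAllExistsPartial]
    fun_prop
  have hGb : ∀ ξ, |G ξ| ≤ B := fun ξ => abs_softAllExistsPartial_le h0 h1 hB _ i j
  have hwi : Integrable (fun ξ => inner ℝ w ξ) (stdGaussian E) :=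
    IsGaussian.integrable_dual (stdGaussian E) (innerSL ℝ w)
  set T : E ≃ₗᵢ[ℝ] E := (ℝ ∙ w)ᗮ.reflection
  have hT : ∀ ξ, T ξ = ξ - (2 * (inner ℝ w ξ / ‖w‖ ^ 2)) • w := by
    intro ξ
    simp only [T, Submodule.reflection_orthogonal_apply, Submodule.reflection_singleton_apply]
    simp [mul_smul, two_smul]
  have hTw : ∀ ξ, inner ℝ w (T ξ) = - inner ℝ w ξ := by
    intro ξ
    rcases eq_or_ne w 0 with rfl | hw
    · simp
    · have : ‖w‖ ^ 2 ≠ 0 := by simpa using hw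
      rw [hT, inner_sub_right, inner_smul_right, real_inner_self_eq_norm_sq]
      field_simp; ring
  have hint1 : Integrable (fun ξ => G ξ * inner ℝ w ξ) (stdGaussian E) :=
    hwi.bdd_mul hGc.aestronglyMeasurable (ae_of_all _ hGb)
  have hint2 : Integrable (fun ξ => G (T ξ) * inner ℝ w ξ) (stdGaussian E) :=
    hwi.bdd_mul (hGc.comp T.continuous).aestronglyMeasurable (ae_of_all _ fun ξ => hGb _)
  have e1 : ∫ ξ, G ξ * inner ℝ w ξ ∂(stdGaussian E)
      = - ∫ ξ, G (T ξ) * inner ℝ w ξ ∂(stdGaussian E) := by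
    rw [← integral_comp_isometry_stdGaussian T (fun ξ => G ξ * inner ℝ w ξ), ← integral_neg]
    refine integral_congr_ae (ae_of_all _ fun ξ => ?_)
    simp only [hTw, mul_neg]
  have e2 : ∫ ξ, (G ξ * inner ℝ w ξ - G (T ξ) * inner ℝ w ξ) ∂(stdGaussian E) ≤ 0 := by
    refine integral_nonpos fun ξ => ?_
    have hrow' : ∀ l, inner ℝ (z i l) (T ξ) = inner ℝ (z i l) ξ := by
      intro l; rw [hT, inner_sub_right, inner_smul_right, hrow, mul_zero, sub_zero]
    have hz : ∀ k l, inner ℝ (z k l) (T ξ) =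
        inner ℝ (z k l) ξ - (2 * (inner ℝ w ξ / ‖w‖ ^ 2)) * inner ℝ (z k l) w := by
      intro k l; rw [hT, inner_sub_right, inner_smul_right]
    simp only [Pi.zero_apply, ← sub_mul]
    rcases le_total 0 (inner ℝ w ξ) with hp | hp
    · refine mul_nonpos_of_nonpos_of_nonneg (sub_nonpos.2 ?_) hp
      refine softAllExistsPartial_mono h0 h1 hm j (fun l => by rw [hrow']) fun k hk l => ?_
      have : 2 * (inner ℝ w ξ / ‖w‖ ^ 2) * inner ℝ (z k l) w ≤ 0 :=
        mul_nonpos_of_nonneg_of_nonpos (by positivity) (hle k hk l)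
      linarith [hz k l]
    · refine mul_nonpos_of_nonneg_of_nonpos (sub_nonneg.2 ?_) hp
      refine softAllExistsPartial_mono h0 h1 hm j (fun l => by rw [hrow']) fun k hk l => ?_
      have h3 : inner ℝ w ξ / ‖w‖ ^ 2 ≤ 0 := div_nonpos_of_nonpos_of_nonneg hp (by positivity)
      have : 0 ≤ 2 * (inner ℝ w ξ / ‖w‖ ^ 2) * inner ℝ (z k l) w :=
        mul_nonneg_of_nonpos_of_nonpos (by linarith) (hle k hk l)
      linarith [hz k l]
  rw [integral_sub hint1 hint2] at e2
  linarith

/-- Gordon's comparison for the smoothed indicator, by interpolation along a quarter circle. -/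
lemma integral_softAllExists_le (hρ : ContDiff ℝ 1 ρ) (hm : Monotone ρ)
    (h0 : ∀ x, 0 ≤ ρ x) (h1 : ∀ x, ρ x ≤ 1) {B : ℝ} (hB : ∀ x, |deriv ρ x| ≤ B)
    (x y : I → J → E) (c : I → J → ℝ)
    (hxy : ∀ i j k l, inner ℝ (x i j) (y k l) = 0)
    (hrow : ∀ i j l, inner ℝ (x i j) (x i l) = inner ℝ (y i j) (y i l))
    (hle : ∀ i j k l, inner ℝ (y i j) (y k l) ≤ inner ℝ (x i j) (x k l)) :
    ∫ ξ, softAllExists ρ (fun i j => inner ℝ (y i j) ξ - c i j) ∂(stdGaussian E)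
      ≤ ∫ ξ, softAllExists ρ (fun i j => inner ℝ (x i j) ξ - c i j) ∂(stdGaussian E) := by
  set z : ℝ → I → J → E := fun θ i j => Real.cos θ • x i j + Real.sin θ • y i j
  set z' : ℝ → I → J → E := fun θ i j => -Real.sin θ • x i j + Real.cos θ • y i j
  have hzz : ∀ θ i j k l, inner ℝ (z θ k l) (z' θ i j) = Real.sin θ * Real.cos θ *
      (inner ℝ (y i j) (y k l) - inner ℝ (x i j) (x k l)) := by
    intro θ i j k l
    simp only [z, z', inner_add_left, inner_add_right, inner_smul_left, inner_smul_right, hxy,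
      real_inner_comm (x i j) (y k l), real_inner_comm (x k l) (x i j),
      real_inner_comm (y k l) (y i j)]
    simp
    ring
  have hρd : Differentiable ℝ ρ := hρ.differentiable (by norm_num)
  have hρc : Continuous ρ := hρ.continuous
  have hdc : Continuous (deriv ρ) := hρ.continuous_deriv (by norm_num)
  have hB0 : 0 ≤ B := (abs_nonneg _).trans (hB 0)
  set Φ : ℝ → E → ℝ := fun θ ξ => softAllExists ρ (fun i j => inner ℝ (z θ i j) ξ - c i j)
  set Φ' : ℝ → E → ℝ := fun θ ξ => ∑ i, ∑ j,
    softAllExistsPartial ρ (fun i j => inner ℝ (z θ i j) ξ - c i j) i j * inner ℝ (z' θ i j) ξ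
  have hΦc : ∀ θ, Continuous (Φ θ) := by
    intro θ; simp only [Φ, softAllExists]; fun_prop
  have hGc : ∀ θ i j, Continuous fun ξ : E =>
      softAllExistsPartial ρ (fun i j => inner ℝ (z θ i j) ξ - c i j) i j := by
    intro θ i j; simp only [softAllExistsPartial]; fun_prop
  have hΦ'c : ∀ θ, Continuous (Φ' θ) := by
    intro θ
    exact continuous_finsetSum _ fun i _ => continuous_finsetSum _ fun j _ =>
      (hGc θ i j).mul (by fun_prop)
  have hwi : ∀ w : E, Integrable (fun ξ => inner ℝ w ξ) (stdGaussian E) :=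
    fun w => IsGaussian.integrable_dual (stdGaussian E) (innerSL ℝ w)
  have hderiv : ∀ θ ξ, HasDerivAt (fun θ => Φ θ ξ) (Φ' θ ξ) θ := by
    intro θ ξ
    refine hasDerivAt_softAllExists hρd (z := fun θ i j => inner ℝ (z θ i j) ξ - c i j)
      fun i j => ?_
    have := (((Real.hasDerivAt_cos θ).mul_const (inner ℝ (x i j) ξ)).add
      ((Real.hasDerivAt_sin θ).mul_const (inner ℝ (y i j) ξ))).sub_const (c i j)
    simp only [z, z', inner_add_left, inner_smul_left]
    simpa using this
  have hbound : ∀ θ ξ, ‖Φ' θ ξ‖ ≤ ∑ i, ∑ j, B * (|inner ℝ (x i j) ξ| + |inner ℝ (y i j) ξ|) := by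
    intro θ ξ
    refine (norm_sum_le _ _).trans (Finset.sum_le_sum fun i _ => ?_)
    refine (norm_sum_le _ _).trans (Finset.sum_le_sum fun j _ => ?_)
    rw [norm_mul, Real.norm_eq_abs, Real.norm_eq_abs]
    refine mul_le_mul (abs_softAllExistsPartial_le h0 h1 hB _ i j) ?_ (abs_nonneg _) hB0
    simp only [z', inner_add_left, inner_smul_left]
    refine (abs_add_le _ _).trans (add_le_add ?_ ?_)
    · rw [abs_mul]
      refine mul_le_of_le_one_left (abs_nonneg _) ?_
      simpa using Real.abs_sin_le_one θ
    · rw [abs_mul]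
      refine mul_le_of_le_one_left (abs_nonneg _) ?_
      simpa using Real.abs_cos_le_one θ
  have hbi : Integrable (fun ξ => ∑ i, ∑ j, B * (|inner ℝ (x i j) ξ| + |inner ℝ (y i j) ξ|))
      (stdGaussian E) := by
    refine integrable_finsetSum _ fun i _ => integrable_finsetSum _ fun j _ => ?_
    exact ((hwi _).abs.add (hwi _).abs).const_mul B
  have hφ : ∀ θ, HasDerivAt (fun θ => ∫ ξ, Φ θ ξ ∂(stdGaussian E))
      (∫ ξ, Φ' θ ξ ∂(stdGaussian E)) θ := by
    intro θ
    refine (hasDerivAt_integral_of_dominated_loc_of_deriv_le (F := Φ) (F' := Φ')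
      (s := Set.univ) (Filter.univ_mem) ?_ ?_ ?_ (ae_of_all _ fun ξ θ _ => hbound θ ξ) hbi
      (ae_of_all _ fun ξ θ _ => hderiv θ ξ)).2
    · exact Filter.Eventually.of_forall fun θ => (hΦc θ).aestronglyMeasurable
    · refine Integrable.of_bound (hΦc θ).aestronglyMeasurable 1 (ae_of_all _ fun ξ => ?_)
      have := softAllExists_mem h0 h1 (fun i j => inner ℝ (z θ i j) ξ - c i j)
      rw [Real.norm_eq_abs, abs_of_nonneg this.1]
      exact this.2
    · exact (hΦ'c θ).aestronglyMeasurable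
  have hneg : ∀ θ ∈ Set.Icc (0 : ℝ) (Real.pi / 2), ∫ ξ, Φ' θ ξ ∂(stdGaussian E) ≤ 0 := by
    intro θ hθ
    have hs : 0 ≤ Real.sin θ * Real.cos θ :=
      mul_nonneg (Real.sin_nonneg_of_nonneg_of_le_pi hθ.1 (by linarith [hθ.2, Real.pi_pos]))
        (Real.cos_nonneg_of_neg_pi_div_two_le_of_le (by linarith [hθ.1, Real.pi_pos]) hθ.2)
    have hi : ∀ i j, Integrable (fun ξ =>
        softAllExistsPartial ρ (fun i j => inner ℝ (z θ i j) ξ - c i j) i j *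
          inner ℝ (z' θ i j) ξ) (stdGaussian E) := fun i j =>
      (hwi _).bdd_mul (hGc θ i j).aestronglyMeasurable
        (ae_of_all _ fun ξ => abs_softAllExistsPartial_le h0 h1 hB _ i j)
    simp only [Φ']
    rw [integral_finsetSum _ fun i _ => integrable_finsetSum _ fun j _ => hi i j]
    refine Finset.sum_nonpos fun i _ => ?_
    rw [integral_finsetSum _ fun j _ => hi i j]
    refine Finset.sum_nonpos fun j _ => ?_
    refine integral_inner_mul_softAllExistsPartial_nonpos hρ hm h0 h1 hB (z θ) c _ i j ?_ ?_
    · intro l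
      rw [hzz, hrow, sub_self, mul_zero]
    · intro k _ l
      rw [hzz]
      exact mul_nonpos_of_nonneg_of_nonpos hs (sub_nonpos.2 (hle _ _ _ _))
  have hanti : AntitoneOn (fun θ => ∫ ξ, Φ θ ξ ∂(stdGaussian E)) (Set.Icc 0 (Real.pi / 2)) := by
    refine antitoneOn_of_deriv_nonpos (convex_Icc _ _)
      (fun θ _ => (hφ θ).continuousAt.continuousWithinAt)
      (fun θ _ => (hφ θ).differentiableAt.differentiableWithinAt) fun θ hθ => ?_
    rw [(hφ θ).deriv]
    exact hneg θ (interior_subset hθ)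
  have hp : (0 : ℝ) ≤ Real.pi / 2 := by positivity
  have := hanti (Set.left_mem_Icc.2 hp) (Set.right_mem_Icc.2 hp) hp
  simpa [Φ, z] using this

end Gordon

/-! ### Gordon's comparison in probability form -/

section GordonProb

variable {E : Type*} [NormedAddCommGroup E] [InnerProductSpace ℝ E] [FiniteDimensional ℝ E]
  [MeasurableSpace E] [BorelSpace E]

/-- A continuously differentiable nondecreasing step from `0` on `(-∞, 0]` to `1` on `[δ, ∞)`. -/
lemma exists_smooth_step {δ : ℝ} (hδ : 0 < δ) : ∃ ρ : ℝ → ℝ, ContDiff ℝ 1 ρ ∧ Monotone ρ ∧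
    (∀ x, 0 ≤ ρ x) ∧ (∀ x, ρ x ≤ 1) ∧ (∃ B, ∀ x, |deriv ρ x| ≤ B) ∧
    (∀ x ≤ 0, ρ x = 0) ∧ ∀ x, δ ≤ x → ρ x = 1 := by
  set ρ : ℝ → ℝ := fun x => Real.smoothTransition (x / δ)
  have hc : ContDiff ℝ 1 ρ := Real.smoothTransition.contDiff.comp (contDiff_id.div_const δ)
  have hz : ∀ x ≤ 0, ρ x = 0 := fun x hx =>
    Real.smoothTransition.zero_of_nonpos (div_nonpos_of_nonpos_of_nonneg hx hδ.le)
  have ho : ∀ x, δ ≤ x → ρ x = 1 := fun x hx =>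
    Real.smoothTransition.one_of_one_le ((one_le_div hδ).2 hx)
  refine ⟨ρ, hc, fun x y h => Real.smoothTransition.monotone (by gcongr),
    fun x => Real.smoothTransition.nonneg _, fun x => Real.smoothTransition.le_one _, ?_, hz, ho⟩
  have hd : Continuous (deriv ρ) := hc.continuous_deriv (by norm_num)
  obtain ⟨B, hB⟩ := isCompact_Icc.exists_bound_of_continuousOn (s := Set.Icc 0 δ) hd.continuousOn
  refine ⟨max B 0, fun x => ?_⟩
  by_cases hx : x ∈ Set.Icc 0 δ
  · exact (hB x hx).trans (le_max_left _ _)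
  · have : deriv ρ x = 0 := by
      rw [Set.mem_Icc, not_and_or, not_le, not_le] at hx
      rcases hx with hx | hx
      · have : ρ =ᶠ[nhds x] fun _ => 0 := by
          filter_upwards [Iio_mem_nhds hx] with y hy using hz y hy.le
        rw [this.deriv_eq, deriv_const]
      · have : ρ =ᶠ[nhds x] fun _ => 1 := by
          filter_upwards [Ioi_mem_nhds hx] with y hy using ho y hy.le
        rw [this.deriv_eq, deriv_const]
    rw [this, abs_zero]
    exact le_max_right _ _

/-- For finite index types, the smoothed comparison lies between the probabilities of the two
events, at the price of the shift `δ`. -/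
lemma measure_exists_forall_le_finite {I J : Type*} [Fintype I] [Fintype J]
    (x y : I → J → E) (c : I → J → ℝ) {δ : ℝ} (hδ : 0 < δ)
    (hxy : ∀ i j k l, inner ℝ (x i j) (y k l) = 0)
    (hrow : ∀ i j l, inner ℝ (x i j) (x i l) = inner ℝ (y i j) (y i l))
    (hle : ∀ i j k l, inner ℝ (y i j) (y k l) ≤ inner ℝ (x i j) (x k l)) :
    stdGaussian E {ξ | ∃ i, ∀ j, c i j + δ ≤ inner ℝ (x i j) ξ}
      ≤ stdGaussian E {ξ | ∃ i, ∀ j, c i j ≤ inner ℝ (y i j) ξ} := by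
  classical
  obtain ⟨ρ, hρ, hm, h0, h1, ⟨B, hB⟩, hz, ho⟩ := exists_smooth_step hδ
  have key := integral_softAllExists_le hρ hm h0 h1 hB x y c hxy hrow hle
  set S : Set E := {ξ | ∃ i, ∀ j, c i j + δ ≤ inner ℝ (x i j) ξ} with hS
  set R : Set E := {ξ | ∃ i, ∀ j, c i j ≤ inner ℝ (y i j) ξ} with hR
  have hSm : MeasurableSet S := by
    have : S = ⋃ i, ⋂ j, {ξ | c i j + δ ≤ inner ℝ (x i j) ξ} := by ext; simp [hS]
    rw [this]
    exact MeasurableSet.iUnion fun i => MeasurableSet.iInter fun j =>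
      (isClosed_le (by fun_prop) (by fun_prop)).measurableSet
  have hRm : MeasurableSet R := by
    have : R = ⋃ i, ⋂ j, {ξ | c i j ≤ inner ℝ (y i j) ξ} := by ext; simp [hR]
    rw [this]
    exact MeasurableSet.iUnion fun i => MeasurableSet.iInter fun j =>
      (isClosed_le (by fun_prop) (by fun_prop)).measurableSet
  have hρc := hρ.continuous
  have hint : ∀ v : I → J → E, Integrable
      (fun ξ => softAllExists ρ (fun i j => inner ℝ (v i j) ξ - c i j)) (stdGaussian E) := by
    intro v
    have hcont : Continuous fun ξ : E =>
        softAllExists ρ (fun i j => inner ℝ (v i j) ξ - c i j) := by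
      simp only [softAllExists]; fun_prop
    refine Integrable.of_bound hcont.aestronglyMeasurable 1 (ae_of_all _ fun ξ => ?_)
    have := softAllExists_mem h0 h1 (fun i j => inner ℝ (v i j) ξ - c i j)
    rw [Real.norm_eq_abs, abs_of_nonneg this.1]
    exact this.2
  have hX : ∫ ξ, softAllExists ρ (fun i j => inner ℝ (x i j) ξ - c i j) ∂(stdGaussian E)
      ≤ (stdGaussian E).real Sᶜ := by
    rw [← integral_indicator_one hSm.compl]
    refine integral_mono (hint x) ((integrable_const 1).indicator hSm.compl) fun ξ => ?_
    by_cases hξ : ξ ∈ S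
    · obtain ⟨i, hi⟩ := hξ
      have : softAllExists ρ (fun i j => inner ℝ (x i j) ξ - c i j) = 0 := by
        refine Finset.prod_eq_zero (Finset.mem_univ i) ?_
        rw [Finset.prod_eq_one fun j _ => ho _ (by linarith [hi j]), sub_self]
      simp only [this]
      exact Set.indicator_nonneg (fun _ _ => zero_le_one) _
    · rw [Set.indicator_of_mem (show ξ ∈ Sᶜ from hξ)]
      exact (softAllExists_mem h0 h1 _).2
  have hY : (stdGaussian E).real Rᶜ
      ≤ ∫ ξ, softAllExists ρ (fun i j => inner ℝ (y i j) ξ - c i j) ∂(stdGaussian E) := by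
    rw [← integral_indicator_one hRm.compl]
    refine integral_mono ((integrable_const 1).indicator hRm.compl) (hint y) fun ξ => ?_
    by_cases hξ : ξ ∈ R
    · rw [Set.indicator_of_notMem (by simpa using hξ)]
      exact (softAllExists_mem h0 h1 _).1
    · rw [Set.indicator_of_mem (show ξ ∈ Rᶜ from hξ)]
      have : softAllExists ρ (fun i j => inner ℝ (y i j) ξ - c i j) = 1 := by
        refine Finset.prod_eq_one fun i _ => ?_
        have : ∃ j, inner ℝ (y i j) ξ < c i j := by
          by_contra h
          push Not at h
          exact hξ ⟨i, h⟩
        obtain ⟨j, hj⟩ := this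
        rw [Finset.prod_eq_zero (Finset.mem_univ j) (hz _ (by linarith)), sub_zero]
      simp only [this]
      rfl
  have := (hY.trans key).trans hX
  rw [probReal_compl_eq_one_sub hSm, probReal_compl_eq_one_sub hRm] at this
  rw [← ENNReal.toReal_le_toReal (measure_ne_top _ _) (measure_ne_top _ _)]
  simp only [Measure.real] at this
  linarith

/-- Gordon's comparison inequality in probability form, for two doubly indexed sequences of
centred Gaussian variables `⟪x i j, ·⟫` and `⟪y i j, ·⟫`. -/
theorem measure_exists_forall_le (x y : ℕ → ℕ → E) (c : ℕ → ℕ → ℝ) {δ : ℝ} (hδ : 0 < δ)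
    (hxy : ∀ i j k l, inner ℝ (x i j) (y k l) = 0)
    (hrow : ∀ i j l, inner ℝ (x i j) (x i l) = inner ℝ (y i j) (y i l))
    (hle : ∀ i j k l, inner ℝ (y i j) (y k l) ≤ inner ℝ (x i j) (x k l)) :
    stdGaussian E {ξ | ∃ i, ∀ j, c i j + δ ≤ inner ℝ (x i j) ξ}
      ≤ stdGaussian E {ξ | ∃ i, ∀ j, c i j ≤ inner ℝ (y i j) ξ} := by
  set R : Set E := {ξ | ∃ i, ∀ j, c i j ≤ inner ℝ (y i j) ξ} with hR
  have hfin : ∀ N M : ℕ, stdGaussian E {ξ | ∃ i < N, ∀ j, c i j + δ ≤ inner ℝ (x i j) ξ}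
      ≤ stdGaussian E {ξ | ∃ i < N, ∀ j < M, c i j ≤ inner ℝ (y i j) ξ} := by
    intro N M
    have h := measure_exists_forall_le_finite (I := Fin N) (J := Fin M)
      (fun i j => x i j) (fun i j => y i j) (fun i j => c i j) hδ
      (fun _ _ _ _ => hxy _ _ _ _) (fun _ _ _ => hrow _ _ _) (fun _ _ _ _ => hle _ _ _ _)
    refine (measure_mono ?_).trans (h.trans (measure_mono ?_))
    · rintro ξ ⟨i, hi, h⟩
      exact ⟨⟨i, hi⟩, fun j => h j⟩
    · rintro ξ ⟨i, h⟩
      exact ⟨i, i.2, fun j hj => h ⟨j, hj⟩⟩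
  have hN : ∀ N : ℕ, stdGaussian E {ξ | ∃ i < N, ∀ j, c i j + δ ≤ inner ℝ (x i j) ξ}
      ≤ stdGaussian E R := by
    intro N
    set T : ℕ → Set E := fun M => {ξ | ∃ i < N, ∀ j < M, c i j ≤ inner ℝ (y i j) ξ} with hT
    have hTm : ∀ M, MeasurableSet (T M) := by
      intro M
      have : T M = ⋃ i, ⋃ (_ : i < N), ⋂ j, ⋂ (_ : j < M), {ξ | c i j ≤ inner ℝ (y i j) ξ} := by
        ext; simp [hT]
      rw [this]
      exact MeasurableSet.iUnion fun i => MeasurableSet.iUnion fun _ => MeasurableSet.iInter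
        fun j => MeasurableSet.iInter fun _ =>
          (isClosed_le (by fun_prop) (by fun_prop)).measurableSet
    have hTa : Antitone T := by
      rintro M M' h ξ ⟨i, hi, hj⟩
      exact ⟨i, hi, fun j hjM => hj j (hjM.trans_le h)⟩
    have hsub : ⋂ M, T M ⊆ R := by
      intro ξ hξ
      by_contra hcon
      have : ∀ i, ∃ j, inner ℝ (y i j) ξ < c i j := by
        intro i
        by_contra h
        push Not at h
        exact hcon ⟨i, h⟩
      choose j hj using this
      -- a finite number of rows is refuted by a finite number of columns
      obtain ⟨i, hi, h⟩ := Set.mem_iInter.1 hξ ((Finset.range N).sup j + 1)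
      have := h (j i) (Nat.lt_succ_of_le (Finset.le_sup (Finset.mem_range.2 hi)))
      exact absurd (hj i) (not_lt.2 this)
    have hlim := tendsto_measure_iInter_atTop (μ := stdGaussian E)
      (fun M => (hTm M).nullMeasurableSet) hTa ⟨0, measure_ne_top _ _⟩
    exact (ge_of_tendsto' hlim fun M => hfin N M).trans (measure_mono hsub)
  have hU : {ξ : E | ∃ i, ∀ j, c i j + δ ≤ inner ℝ (x i j) ξ}
      = ⋃ N : ℕ, {ξ | ∃ i < N, ∀ j, c i j + δ ≤ inner ℝ (x i j) ξ} := by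
    ext ξ
    simp only [Set.mem_ofPred_eq, Set.mem_iUnion]
    constructor
    · rintro ⟨i, hi⟩; exact ⟨i + 1, i, Nat.lt_succ_self i, hi⟩
    · rintro ⟨N, i, -, hi⟩; exact ⟨i, hi⟩
  have hmono : Monotone fun N : ℕ => {ξ : E | ∃ i < N, ∀ j, c i j + δ ≤ inner ℝ (x i j) ξ} := by
    rintro N N' h ξ ⟨i, hi, hj⟩
    exact ⟨i, hi.trans_le h, hj⟩
  rw [hU, hmono.measure_iUnion]
  exact iSup_le hN

end GordonProb

/-! ### The bilinear Gaussian process and its decoupled counterpart -/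

section Coordinates

/-- Distinct coordinates of a standard Gaussian vector form a standard Gaussian vector. -/
lemma map_comp_stdGaussian {ι κ : Type*} [Fintype ι] [Fintype κ] {e : κ → ι}
    (he : Function.Injective e) :
    (stdGaussian (EuclideanSpace ℝ ι)).map (fun ξ => WithLp.toLp 2 fun k => ξ (e k))
      = stdGaussian (EuclideanSpace ℝ κ) := by
  have hm : Measurable fun ξ : EuclideanSpace ℝ ι =>
      (WithLp.toLp 2 fun k => ξ (e k) : EuclideanSpace ℝ κ) := by fun_prop
  have : IsProbabilityMeasure ((stdGaussian (EuclideanSpace ℝ ι)).map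
    (fun ξ => (WithLp.toLp 2 fun k => ξ (e k) : EuclideanSpace ℝ κ))) :=
    Measure.isProbabilityMeasure_map hm.aemeasurable
  classical
  refine Measure.ext_of_charFun (funext fun t => ?_)
  have hv := (EuclideanSpace.basisFun ι ℝ).orthonormal.comp e he
  set S : EuclideanSpace ℝ ι := ∑ k, t k • EuclideanSpace.basisFun ι ℝ (e k) with hS
  have h1 : ∀ ξ : EuclideanSpace ℝ ι,
      inner ℝ (WithLp.toLp 2 fun k => ξ (e k) : EuclideanSpace ℝ κ) t = inner ℝ ξ S := by
    intro ξ
    rw [hS, inner_sum]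
    simp [PiLp.inner_apply, inner_smul_right]
  have h2 : ‖S‖ ^ 2 = ‖t‖ ^ 2 := by
    have := hv.inner_sum (fun k => t k) (fun k => t k) Finset.univ
    simp only [Function.comp] at this
    rw [← real_inner_self_eq_norm_sq, hS, this, EuclideanSpace.real_norm_sq_eq]
    simp [sq]
  rw [charFun_apply, integral_map hm.aemeasurable (by fun_prop), charFun_stdGaussian,
    ← Complex.ofReal_pow, ← h2, Complex.ofReal_pow, ← charFun_stdGaussian, charFun_apply]
  simp_rw [h1]

end Coordinates

section GordonSpace

variable {m n : ℕ}

/-- The probability space of the comparison, under its standard Gaussian measure: the coordinates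
are the entries of an `m × n` matrix, of a vector in `ℝᵐ` and of a vector in `ℝⁿ`, and one extra
scalar. -/
abbrev GordonSpace (m n : ℕ) : Type :=
  EuclideanSpace ℝ ((Fin m × Fin n) ⊕ (Fin m ⊕ (Fin n ⊕ Unit)))

/-- The matrix block of a point of `GordonSpace`. -/
def matrixPart (ξ : GordonSpace m n) : Fin m → Fin n → ℝ := fun i j => ξ (Sum.inl (i, j))

/-- The `ℝᵐ`-block of a point of `GordonSpace`. -/
def leftPart (ξ : GordonSpace m n) : Vec m := WithLp.toLp 2 fun i => ξ (Sum.inr (Sum.inl i))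

/-- The `ℝⁿ`-block of a point of `GordonSpace`. -/
def rightPart (ξ : GordonSpace m n) : Vec n :=
  WithLp.toLp 2 fun j => ξ (Sum.inr (Sum.inr (Sum.inl j)))

/-- The scalar coordinate of a point of `GordonSpace`. -/
def scalarPart (ξ : GordonSpace m n) : ℝ := ξ (Sum.inr (Sum.inr (Sum.inr ())))

/-- The vector representing the Gaussian variable `⟪u, A w⟫ + ‖u‖ ‖w‖ γ`. -/
def bilinVec (u : Vec m) (w : Vec n) : GordonSpace m n :=
  WithLp.toLp 2 (Sum.elim (fun p => u p.1 * w p.2)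
    (Sum.elim 0 (Sum.elim 0 fun _ => ‖u‖ * ‖w‖)))

/-- The vector representing the decoupled Gaussian variable `‖w‖ ⟪u, g⟫ + ‖u‖ ⟪w, h⟫`. -/
def decoupledVec (u : Vec m) (w : Vec n) : GordonSpace m n :=
  WithLp.toLp 2 (Sum.elim 0 (Sum.elim (fun i => ‖w‖ * u i) (Sum.elim (fun j => ‖u‖ * w j) 0)))

lemma inner_bilinVec_decoupledVec (u u' : Vec m) (w w' : Vec n) :
    inner ℝ (bilinVec u w) (decoupledVec u' w') = 0 := by
  simp [bilinVec, decoupledVec, PiLp.inner_apply, Fintype.sum_sum_type]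

lemma inner_bilinVec_bilinVec (u u' : Vec m) (w w' : Vec n) :
    inner ℝ (bilinVec u w) (bilinVec u' w')
      = inner ℝ u u' * inner ℝ w w' + ‖u‖ * ‖u'‖ * (‖w‖ * ‖w'‖) := by
  simp only [bilinVec, PiLp.inner_apply, Fintype.sum_sum_type, Fintype.sum_prod_type,
    Finset.sum_mul_sum]
  simp
  congr 1
  · exact Finset.sum_congr rfl fun i _ => Finset.sum_congr rfl fun j _ => by ring
  · ring

lemma inner_decoupledVec_decoupledVec (u u' : Vec m) (w w' : Vec n) :
    inner ℝ (decoupledVec u w) (decoupledVec u' w')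
      = ‖w‖ * ‖w'‖ * inner ℝ u u' + ‖u‖ * ‖u'‖ * inner ℝ w w' := by
  simp only [decoupledVec, PiLp.inner_apply, Fintype.sum_sum_type, Finset.mul_sum]
  simp
  congr 1
  · exact Finset.sum_congr rfl fun i _ => by ring
  · exact Finset.sum_congr rfl fun i _ => by ring

/-- The covariance inequality of the comparison; the two covariances agree when the `u`-arguments or
the `w`-arguments coincide. -/
lemma inner_decoupledVec_le (u u' : Vec m) (w w' : Vec n) :
    inner ℝ (decoupledVec u w) (decoupledVec u' w') ≤ inner ℝ (bilinVec u w) (bilinVec u' w') := by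
  rw [inner_bilinVec_bilinVec, inner_decoupledVec_decoupledVec]
  have h1 := real_inner_le_norm u u'
  have h2 := real_inner_le_norm w w'
  nlinarith [mul_nonneg (sub_nonneg.2 h1) (sub_nonneg.2 h2)]

lemma inner_bilinVec_left (u : Vec m) (w w' : Vec n) :
    inner ℝ (bilinVec u w) (bilinVec u w') = inner ℝ (decoupledVec u w) (decoupledVec u w') := by
  rw [inner_bilinVec_bilinVec, inner_decoupledVec_decoupledVec, real_inner_self_eq_norm_sq]
  ring

lemma inner_bilinVec_right (u u' : Vec m) (w : Vec n) :
    inner ℝ (bilinVec u w) (bilinVec u' w) = inner ℝ (decoupledVec u w) (decoupledVec u' w) := by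
  rw [inner_bilinVec_bilinVec, inner_decoupledVec_decoupledVec, real_inner_self_eq_norm_sq]
  ring

lemma inner_bilinVec_apply (u : Vec m) (w : Vec n) (ξ : GordonSpace m n) :
    inner ℝ (bilinVec u w) ξ
      = inner ℝ u ((Matrix.of (matrixPart ξ)).toEuclideanLin w) + ‖u‖ * ‖w‖ * scalarPart ξ := by
  simp only [bilinVec, PiLp.inner_apply, Fintype.sum_sum_type, Fintype.sum_prod_type, scalarPart]
  simp [Matrix.toLpLin_apply, Matrix.mulVec, dotProduct, matrixPart]
  congr 1
  · exact Finset.sum_congr rfl fun i _ => by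
      rw [Finset.sum_mul]
      exact Finset.sum_congr rfl fun j _ => by ring
  · ring

lemma inner_decoupledVec_apply (u : Vec m) (w : Vec n) (ξ : GordonSpace m n) :
    inner ℝ (decoupledVec u w) ξ
      = ‖w‖ * inner ℝ u (leftPart ξ) + ‖u‖ * inner ℝ w (rightPart ξ) := by
  simp only [decoupledVec, PiLp.inner_apply, Fintype.sum_sum_type, leftPart, rightPart,
    Finset.mul_sum]
  simp
  congr 1
  · exact Finset.sum_congr rfl fun i _ => by ring
  · exact Finset.sum_congr rfl fun i _ => by ring

lemma map_leftPart : (stdGaussian (GordonSpace m n)).map leftPart = stdGaussian (Vec m) :=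
  map_comp_stdGaussian (e := fun i : Fin m => Sum.inr (Sum.inl i))
    fun _ _ h => Sum.inl_injective (Sum.inr_injective h)

lemma map_rightPart : (stdGaussian (GordonSpace m n)).map rightPart = stdGaussian (Vec n) :=
  map_comp_stdGaussian (e := fun j : Fin n => Sum.inr (Sum.inr (Sum.inl j)))
    fun _ _ h => Sum.inl_injective (Sum.inr_injective (Sum.inr_injective h))

lemma measurable_leftPart : Measurable (leftPart : GordonSpace m n → Vec m) := by
  unfold leftPart; fun_prop

lemma measurable_rightPart : Measurable (rightPart : GordonSpace m n → Vec n) := by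
  unfold rightPart; fun_prop

lemma measurable_matrixPart : Measurable (matrixPart : GordonSpace m n → Fin m → Fin n → ℝ) := by
  unfold matrixPart; fun_prop

lemma map_matrixPart : (stdGaussian (GordonSpace m n)).map matrixPart
    = Measure.pi fun _ => Measure.pi fun _ => gaussianReal 0 1 := by
  have h1 := map_comp_stdGaussian (e := fun p : Fin m × Fin n =>
    (Sum.inl p : (Fin m × Fin n) ⊕ (Fin m ⊕ (Fin n ⊕ Unit)))) Sum.inl_injective
  have h2 : (stdGaussian (EuclideanSpace ℝ (Fin m × Fin n))).map WithLp.ofLp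
      = Measure.pi fun _ => gaussianReal 0 1 := by
    rw [← map_pi_eq_stdGaussian, Measure.map_map (by fun_prop) (by fun_prop)]
    exact Measure.map_id
  have h3 := Measure.infinitePi_map_curry (ι := Fin m) (κ := Fin n) (X := ℝ)
    (fun _ _ => gaussianReal 0 1)
  rw [Measure.infinitePi_eq_pi] at h3
  simp only [Measure.infinitePi_eq_pi] at h3
  rw [← h3, ← h2, ← h1, Measure.map_map (by fun_prop) (by fun_prop),
    Measure.map_map (by fun_prop) (by fun_prop)]
  rfl

end GordonSpace

/-! ### Concentration of the distance to a convex set -/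

section Tail

variable {E : Type*} [NormedAddCommGroup E] [InnerProductSpace ℝ E] [FiniteDimensional ℝ E]
  [MeasurableSpace E] [BorelSpace E]

/-- Two-sided Gaussian concentration around the mean. -/
lemma measureReal_abs_sub_mean_ge_le {F : E → ℝ} (hF : ContDiff ℝ 1 F) (hL : LipschitzWith 1 F)
    {s : ℝ} (hs : 0 ≤ s) :
    (stdGaussian E).real {x | s ≤ |F x - ∫ y, F y ∂(stdGaussian E)|}
      ≤ 2 * Real.exp (-s ^ 2 / 5) := by
  obtain ⟨-, h⟩ := hasSubgaussianMGF_of_lipschitz hF hL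
  -- the sub-Gaussian exponent `π² / 2` is at most `5`
  have hexp : Real.exp (-s ^ 2 / (2 * ((Real.pi ^ 2 / 4).toNNReal : ℝ)))
      ≤ Real.exp (-s ^ 2 / 5) := by
    rw [Real.coe_toNNReal _ (by positivity), Real.exp_le_exp, neg_div, neg_div, neg_le_neg_iff]
    have hpi : Real.pi ^ 2 ≤ 10 := by nlinarith [Real.pi_lt_d2, Real.pi_pos]
    gcongr
    linarith
  have h1 := (h.measure_ge_le hs).trans hexp
  have h2 := (h.neg.measure_ge_le hs).trans hexp
  calc _ ≤ (stdGaussian E).real ({x | s ≤ F x - ∫ y, F y ∂(stdGaussian E)} ∪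
        {x | s ≤ (-fun x => F x - ∫ y, F y ∂(stdGaussian E)) x}) := by
        refine measureReal_mono fun x hx => ?_
        rcases le_abs.1 (show s ≤ |_| from hx) with h | h
        · exact Or.inl h
        · exact Or.inr h
    _ ≤ _ := measureReal_union_le _ _
    _ ≤ _ := by linarith

lemma sq_le_exp_add_exp_neg (x : ℝ) :
    x ^ 2 ≤ 2 * (Real.exp (1 * x) + Real.exp (-1 * x)) := by
  simp only [one_mul, neg_mul]
  rcases le_total 0 x with h | h
  · nlinarith [Real.quadratic_le_exp_of_nonneg h, Real.exp_pos (-x)]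
  · nlinarith [Real.quadratic_le_exp_of_nonneg (neg_nonneg.2 h), Real.exp_pos x]

/-- A dimension-free bound on the variance of a Lipschitz function of a Gaussian vector. -/
lemma integral_sq_le_of_lipschitz {F : E → ℝ} (hF : ContDiff ℝ 1 F) (hL : LipschitzWith 1 F)
    (h2 : Integrable (fun x => F x ^ 2) (stdGaussian E)) :
    (∫ x, F x ∂(stdGaussian E)) ^ 2 ≤ ∫ x, F x ^ 2 ∂(stdGaussian E) ∧
    ∫ x, F x ^ 2 ∂(stdGaussian E)
      ≤ (∫ x, F x ∂(stdGaussian E)) ^ 2 + 4 * Real.exp (Real.pi ^ 2 / 8) := by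
  obtain ⟨hFi, h⟩ := hasSubgaussianMGF_of_lipschitz hF hL
  set a := ∫ x, F x ∂(stdGaussian E)
  have hvar : ∫ x, (F x - a) ^ 2 ∂(stdGaussian E) = ∫ x, F x ^ 2 ∂(stdGaussian E) - a ^ 2 := by
    have e : ∀ x, (F x - a) ^ 2 = F x ^ 2 - 2 * a * F x + a ^ 2 := fun x => by ring
    have hi : Integrable (fun x => 2 * a * F x) (stdGaussian E) := hFi.const_mul _
    have hi2 : Integrable (fun x => F x ^ 2 - 2 * a * F x) (stdGaussian E) := h2.sub hi
    simp_rw [e]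
    rw [integral_add hi2 (integrable_const _), integral_sub h2 hi, integral_const_mul]
    simp only [integral_const, probReal_univ, one_smul]
    ring
  have hnn : 0 ≤ ∫ x, (F x - a) ^ 2 ∂(stdGaussian E) := integral_nonneg fun _ => sq_nonneg _
  have hsq : Integrable (fun x => (F x - a) ^ 2) (stdGaussian E) := by
    have e : ∀ x, (F x - a) ^ 2 = F x ^ 2 - 2 * a * F x + a ^ 2 := fun x => by ring
    simp_rw [e]
    exact (h2.sub (hFi.const_mul _)).add (integrable_const _)
  have hle : ∫ x, (F x - a) ^ 2 ∂(stdGaussian E)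
      ≤ ∫ x, 2 * (Real.exp (1 * (F x - a)) + Real.exp (-1 * (F x - a))) ∂(stdGaussian E) :=
    integral_mono hsq (((h.integrable_exp_mul 1).add (h.integrable_exp_mul (-1))).const_mul 2)
      fun x => sq_le_exp_add_exp_neg _
  rw [integral_const_mul, integral_add (h.integrable_exp_mul 1) (h.integrable_exp_mul (-1))] at hle
  have m1 := h.mgf_le 1
  have m2 := h.mgf_le (-1)
  rw [Real.coe_toNNReal _ (by positivity)] at m1 m2
  simp only [mgf] at m1 m2
  have e1 : Real.pi ^ 2 / 4 * 1 ^ 2 / 2 = Real.pi ^ 2 / 8 := by ring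
  have e2 : Real.pi ^ 2 / 4 * (-1) ^ 2 / 2 = Real.pi ^ 2 / 8 := by ring
  rw [e1] at m1
  rw [e2] at m2
  constructor <;> linarith

end Tail

section Distance

variable {n : ℕ} {K : Set (Vec n)}

lemma infDist_eq_norm_sub_proj (hne : K.Nonempty) (hK : IsClosed K) (x : Vec n) :
    Metric.infDist x K = ‖x - proj x K‖ := by
  refine le_antisymm ?_ ?_
  · rw [← dist_eq_norm]
    exact Metric.infDist_le_dist_of_mem (proj_mem x hne hK)
  · refine (Metric.le_infDist hne).2 fun q hq => ?_
    rw [dist_eq_norm]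
    exact norm_sub_proj_le x hne hK hq

lemma inner_sub_proj_le_zero (hne : K.Nonempty) (hK : IsClosed K) (hc : Convex ℝ K) (x : Vec n)
    {q : Vec n} (hq : q ∈ K) : inner ℝ (x - proj x K) (q - proj x K) ≤ 0 := by
  have : Nonempty K := hne.to_subtype
  refine (norm_eq_iInf_iff_real_inner_le_zero hc (proj_mem x hne hK)).1 ?_ q hq
  refine le_antisymm (le_ciInf fun w => norm_sub_proj_le x hne hK w.2) ?_
  exact ciInf_le (f := fun w : K => ‖x - w‖) ⟨0, by rintro _ ⟨w, rfl⟩; positivity⟩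
    ⟨_, proj_mem x hne hK⟩

/-- The squared distance is differentiable with gradient `2 (x - proj x K)`; this is the lower half
of the first-order expansion, `infDist_sq_add_le` the upper half. -/
lemma infDist_sq_add_ge (hne : K.Nonempty) (hK : IsClosed K) (hc : Convex ℝ K) (x y : Vec n) :
    Metric.infDist x K ^ 2 + 2 * inner ℝ (x - proj x K) y ≤ Metric.infDist (x + y) K ^ 2 := by
  rw [infDist_eq_norm_sub_proj hne hK, infDist_eq_norm_sub_proj hne hK]
  have h := inner_sub_proj_le_zero hne hK hc x (proj_mem (x + y) hne hK)
  have e : x + y - proj (x + y) K = (x - proj x K) + (y - (proj (x + y) K - proj x K)) := by abel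
  rw [e, norm_add_sq_real, inner_sub_right]
  nlinarith [sq_nonneg ‖y - (proj (x + y) K - proj x K)‖]

lemma infDist_sq_add_le (hne : K.Nonempty) (hK : IsClosed K) (x y : Vec n) :
    Metric.infDist (x + y) K ^ 2
      ≤ Metric.infDist x K ^ 2 + 2 * inner ℝ (x - proj x K) y + ‖y‖ ^ 2 := by
  have h : Metric.infDist (x + y) K ≤ ‖(x - proj x K) + y‖ := by
    have := Metric.infDist_le_dist_of_mem (x := x + y) (proj_mem x hne hK)
    rwa [dist_eq_norm, show x + y - proj x K = (x - proj x K) + y by abel] at this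
  have h2 := pow_le_pow_left₀ Metric.infDist_nonneg h 2
  rw [norm_add_sq_real] at h2
  rwa [infDist_eq_norm_sub_proj hne hK x]

lemma norm_proj_sub_proj_le (hne : K.Nonempty) (hK : IsClosed K) (hc : Convex ℝ K) (x y : Vec n) :
    ‖proj x K - proj y K‖ ≤ ‖x - y‖ := by
  have h1 := inner_sub_proj_le_zero hne hK hc x (proj_mem y hne hK)
  have h2 := inner_sub_proj_le_zero hne hK hc y (proj_mem x hne hK)
  set p := proj x K
  set q := proj y K
  have h3 : ‖p - q‖ ^ 2 ≤ inner ℝ (x - y) (p - q) := by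
    rw [← real_inner_self_eq_norm_sq]
    have e : inner ℝ (x - y) (p - q) = inner ℝ (p - q) (p - q)
        - inner ℝ (x - p) (q - p) - inner ℝ (y - q) (p - q) := by
      simp only [inner_sub_left, inner_sub_right]; ring
    linarith
  have h4 := real_inner_le_norm (x - y) (p - q)
  by_contra hcon
  push Not at hcon
  nlinarith [norm_nonneg (x - y), norm_nonneg (p - q)]

lemma continuous_proj (hne : K.Nonempty) (hK : IsClosed K) (hc : Convex ℝ K) :
    Continuous fun x => proj x K := by
  refine (LipschitzWith.of_dist_le_mul (K := 1) fun x y => ?_).continuous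
  simpa [dist_eq_norm] using norm_proj_sub_proj_le hne hK hc x y

lemma hasFDerivAt_infDist_sq (hne : K.Nonempty) (hK : IsClosed K) (hc : Convex ℝ K) (x : Vec n) :
    HasFDerivAt (fun x => Metric.infDist x K ^ 2) ((2 : ℝ) • innerSL ℝ (x - proj x K)) x := by
  rw [hasFDerivAt_iff_isLittleO_nhds_zero]
  have h : (fun y : Vec n => Metric.infDist (x + y) K ^ 2 - Metric.infDist x K ^ 2
      - ((2 : ℝ) • innerSL ℝ (x - proj x K)) y) =O[nhds 0] fun y => ‖y‖ ^ 2 := by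
    refine Asymptotics.IsBigO.of_bound 1 (Filter.Eventually.of_forall fun y => ?_)
    have h1 := infDist_sq_add_ge hne hK hc x y
    have h2 := infDist_sq_add_le hne hK x y
    simp only [smul_apply, innerSL_apply_apply, smul_eq_mul, Real.norm_eq_abs, one_mul,
      abs_of_nonneg (sq_nonneg ‖y‖)]
    rw [abs_le]
    constructor <;> nlinarith [sq_nonneg ‖y‖]
  refine h.trans_isLittleO ?_
  have := Asymptotics.isLittleO_norm_pow_id (E' := Vec n) one_lt_two
  exact this

lemma contDiff_infDist_sq (hne : K.Nonempty) (hK : IsClosed K) (hc : Convex ℝ K) :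
    ContDiff ℝ 1 fun x : Vec n => Metric.infDist x K ^ 2 := by
  rw [contDiff_one_iff_fderiv]
  refine ⟨fun x => (hasFDerivAt_infDist_sq hne hK hc x).differentiableAt, ?_⟩
  have : (fderiv ℝ fun x : Vec n => Metric.infDist x K ^ 2)
      = fun x => (2 : ℝ) • innerSL ℝ (x - proj x K) :=
    funext fun x => (hasFDerivAt_infDist_sq hne hK hc x).fderiv
  rw [this]
  have hp := continuous_proj hne hK hc
  fun_prop

/-- A differentiable substitute for `x ↦ dist (b x, K)`, within distance `1` of it. -/
def smoothDist (K : Set (Vec n)) (b : ℝ) (x : Vec n) : ℝ :=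
  Real.sqrt (1 + Metric.infDist (b • x) K ^ 2)

lemma contDiff_smoothDist (hne : K.Nonempty) (hK : IsClosed K) (hc : Convex ℝ K) (b : ℝ) :
    ContDiff ℝ 1 (smoothDist K b) := by
  have h := (contDiff_infDist_sq hne hK hc).comp (contDiff_const_smul b (n := 1) (F := Vec n))
  exact (contDiff_const.add h).sqrt fun x => by
    simp only [Function.comp]
    positivity

lemma abs_sqrt_one_add_sq_sub_le (s t : ℝ) : |√(1 + s ^ 2) - √(1 + t ^ 2)| ≤ |s - t| := by
  have hs : 0 < √(1 + s ^ 2) := by positivity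
  have ht : 0 < √(1 + t ^ 2) := by positivity
  have hs2 := Real.sq_sqrt (show 0 ≤ 1 + s ^ 2 by positivity)
  have ht2 := Real.sq_sqrt (show 0 ≤ 1 + t ^ 2 by positivity)
  have hsa : |s| ≤ √(1 + s ^ 2) := Real.abs_le_sqrt (by linarith)
  have hta : |t| ≤ √(1 + t ^ 2) := Real.abs_le_sqrt (by linarith)
  have e : (√(1 + s ^ 2) - √(1 + t ^ 2)) * (√(1 + s ^ 2) + √(1 + t ^ 2)) = (s - t) * (s + t) := by
    nlinarith
  have e2 : |√(1 + s ^ 2) - √(1 + t ^ 2)| * (√(1 + s ^ 2) + √(1 + t ^ 2)) = |s - t| * |s + t| := by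
    rw [← abs_of_pos (add_pos hs ht), ← abs_mul, e, abs_mul]
  have h3 : |s + t| ≤ √(1 + s ^ 2) + √(1 + t ^ 2) := (abs_add_le _ _).trans (add_le_add hsa hta)
  have h4 : |s - t| * |s + t| ≤ |s - t| * (√(1 + s ^ 2) + √(1 + t ^ 2)) :=
    mul_le_mul_of_nonneg_left h3 (abs_nonneg _)
  rw [← e2] at h4
  exact le_of_mul_le_mul_right h4 (add_pos hs ht)

lemma abs_infDist_smul_sub_le {b : ℝ} (hb : |b| ≤ 1) (x y : Vec n) :
    |Metric.infDist (b • x) K - Metric.infDist (b • y) K| ≤ ‖x - y‖ := by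
  have h := (Metric.lipschitz_infDist_pt K).dist_le_mul (b • x) (b • y)
  rw [Real.dist_eq, dist_eq_norm, ← smul_sub, norm_smul, Real.norm_eq_abs] at h
  refine h.trans ?_
  rw [NNReal.coe_one, one_mul]
  exact mul_le_of_le_one_left (norm_nonneg _) hb

lemma lipschitzWith_smoothDist {b : ℝ} (hb : |b| ≤ 1) : LipschitzWith 1 (smoothDist K b) := by
  refine LipschitzWith.of_dist_le_mul fun x y => ?_
  rw [NNReal.coe_one, one_mul, Real.dist_eq, dist_eq_norm]
  exact (abs_sqrt_one_add_sq_sub_le _ _).trans (abs_infDist_smul_sub_le hb x y)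

/-- The mean squared distance from `b h` to `K`, for a standard Gaussian vector `h`. -/
def meanSqDist (K : Set (Vec n)) (b : ℝ) : ℝ :=
  ∫ h, Metric.infDist (b • h) K ^ 2 ∂(stdGaussian (Vec n))

lemma meanSqDist_nonneg (K : Set (Vec n)) (b : ℝ) : 0 ≤ meanSqDist K b :=
  integral_nonneg fun _ => sq_nonneg _

lemma integrable_norm_sq : Integrable (fun h : Vec n => ‖h‖ ^ 2) (stdGaussian (Vec n)) :=
  (IsGaussian.memLp_two_id (μ := stdGaussian (Vec n))).integrable_norm_pow (by norm_num)

lemma integrable_infDist_sq (hne : K.Nonempty) (b : ℝ) :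
    Integrable (fun h => Metric.infDist (b • h) K ^ 2) (stdGaussian (Vec n)) := by
  obtain ⟨s, hs⟩ := hne
  have hcont : Continuous fun h : Vec n => Metric.infDist (b • h) K ^ 2 :=
    ((Metric.continuous_infDist_pt K).comp (continuous_const_smul b)).pow 2
  have hdom : Integrable (fun h : Vec n => 2 * b ^ 2 * ‖h‖ ^ 2 + 2 * ‖s‖ ^ 2)
      (stdGaussian (Vec n)) :=
    (integrable_norm_sq.const_mul _).add (integrable_const _)
  refine hdom.mono' hcont.aestronglyMeasurable (ae_of_all _ fun h => ?_)
  rw [Real.norm_eq_abs, abs_of_nonneg (sq_nonneg _)]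
  have h1 : Metric.infDist (b • h) K ≤ |b| * ‖h‖ + ‖s‖ := by
    refine (Metric.infDist_le_dist_of_mem hs).trans ?_
    rw [dist_eq_norm]
    refine (norm_sub_le _ _).trans ?_
    rw [norm_smul, Real.norm_eq_abs]
  have h2 := pow_le_pow_left₀ Metric.infDist_nonneg h1 2
  nlinarith [sq_nonneg (|b| * ‖h‖ - ‖s‖), sq_abs b]

/-- A dimension-free constant bounding the gap between the root mean square and the mean of the
distance to a convex set. -/
def concentrationOffset : ℝ := 2 + √(4 * Real.exp (Real.pi ^ 2 / 8))

/-- The distance of a Gaussian vector to a convex set concentrates, at a dimension-free scale, at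
its root mean square. -/
lemma measureReal_infDist_sub_ge_le (hne : K.Nonempty) (hK : IsClosed K) (hc : Convex ℝ K)
    {b : ℝ} (hb : |b| ≤ 1) {s : ℝ} (hs : 0 ≤ s) :
    (stdGaussian (Vec n)).real
        {h | s + concentrationOffset ≤ |Metric.infDist (b • h) K - √(meanSqDist K b)|}
      ≤ 2 * Real.exp (-s ^ 2 / 5) := by
  set F := smoothDist K b
  have hF := contDiff_smoothDist hne hK hc b
  have hL := lipschitzWith_smoothDist (K := K) hb
  have hFsq : ∀ x, F x ^ 2 = 1 + Metric.infDist (b • x) K ^ 2 := fun x =>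
    Real.sq_sqrt (by positivity)
  have h2 : Integrable (fun x => F x ^ 2) (stdGaussian (Vec n)) := by
    simp_rw [hFsq]
    exact (integrable_const _).add (integrable_infDist_sq hne b)
  have hint : ∫ x, F x ^ 2 ∂(stdGaussian (Vec n)) = 1 + meanSqDist K b := by
    simp_rw [hFsq]
    rw [integral_add (integrable_const _) (integrable_infDist_sq hne b)]
    simp [meanSqDist]
  obtain ⟨hv1, hv2⟩ := integral_sq_le_of_lipschitz hF hL h2
  refine (measureReal_mono fun x hx => ?_).trans (measureReal_abs_sub_mean_ge_le hF hL hs)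
  set a := ∫ x, smoothDist K b x ∂(stdGaussian (Vec n))
  simp only [Set.mem_ofPred_eq] at hx ⊢
  change s ≤ |F x - a|
  have ha : 0 ≤ a := integral_nonneg fun _ => Real.sqrt_nonneg _
  rw [hint] at hv1 hv2
  set D := meanSqDist K b
  have hD : 0 ≤ D := meanSqDist_nonneg K b
  set V := 4 * Real.exp (Real.pi ^ 2 / 8) with hV
  have hV0 : 0 ≤ V := by positivity
  have hDs := Real.sq_sqrt hD
  have hVs := Real.sq_sqrt hV0
  have hD0 := Real.sqrt_nonneg D
  have hVn := Real.sqrt_nonneg V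
  have b1 : a ≤ 1 + √D := by
    by_contra h; push Not at h; nlinarith
  have b2 : √D ≤ a + √V := by
    by_contra h; push Not at h; nlinarith
  have hd0 : 0 ≤ Metric.infDist (b • x) K := Metric.infDist_nonneg
  set d := Metric.infDist (b • x) K
  have hF0 : 0 ≤ F x := Real.sqrt_nonneg _
  have b3 : F x ≤ 1 + d := by
    have := hFsq x
    by_contra h; push Not at h; nlinarith
  have b4 : d ≤ F x := by
    have := hFsq x
    by_contra h; push Not at h; nlinarith
  have hoff : concentrationOffset = 2 + √V := rfl
  rw [hoff] at hx
  rcases abs_cases (d - √D) with h | h <;> rcases abs_cases (F x - a) with h' | h' <;> linarith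

end Distance

/-! ### The mean squared distance as a function of the scale -/

section Means

variable {n : ℕ} {K : Set (Vec n)}

lemma infDist_convex_comb_le (hne : K.Nonempty) (hK : IsClosed K) (hc : Convex ℝ K) {p q : ℝ}
    (hp : 0 ≤ p) (hq : 0 ≤ q) (hpq : p + q = 1) (x y : Vec n) :
    Metric.infDist (p • x + q • y) K ≤ p * Metric.infDist x K + q * Metric.infDist y K := by
  rw [infDist_eq_norm_sub_proj hne hK x, infDist_eq_norm_sub_proj hne hK y]
  have hmem := hc (proj_mem x hne hK) (proj_mem y hne hK) hp hq hpq
  refine (Metric.infDist_le_dist_of_mem hmem).trans ?_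
  have e : p • x + q • y - (p • proj x K + q • proj y K)
      = p • (x - proj x K) + q • (y - proj y K) := by
    simp only [smul_sub]; abel
  rw [dist_eq_norm, e]
  refine (norm_add_le _ _).trans ?_
  rw [norm_smul, norm_smul, Real.norm_of_nonneg hp, Real.norm_of_nonneg hq]

lemma infDist_sq_convex_comb_le (hne : K.Nonempty) (hK : IsClosed K) (hc : Convex ℝ K) {p q : ℝ}
    (hp : 0 ≤ p) (hq : 0 ≤ q) (hpq : p + q = 1) (x y : Vec n) :
    Metric.infDist (p • x + q • y) K ^ 2
      ≤ p * Metric.infDist x K ^ 2 + q * Metric.infDist y K ^ 2 := by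
  have h := pow_le_pow_left₀ Metric.infDist_nonneg
    (infDist_convex_comb_le hne hK hc hp hq hpq x y) 2
  have hq' : q = 1 - p := by linarith
  subst hq'
  nlinarith [mul_nonneg (mul_nonneg hp hq) (sq_nonneg (Metric.infDist x K - Metric.infDist y K))]

lemma meanSqDist_neg (K : Set (Vec n)) (b : ℝ) : meanSqDist K (-b) = meanSqDist K b := by
  have h := integral_comp_isometry_stdGaussian (LinearIsometryEquiv.neg ℝ (E := Vec n))
    (fun h => Metric.infDist (b • h) K ^ 2)
  simp only [LinearIsometryEquiv.coe_neg, smul_neg] at h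
  simpa [meanSqDist, neg_smul] using h

/-- The mean squared distance is even and convex in the scale, hence nondecreasing on `[0, ∞)`. -/
lemma meanSqDist_mono (hne : K.Nonempty) (hK : IsClosed K) (hc : Convex ℝ K) {b b' : ℝ}
    (hb : 0 ≤ b') (hbb : b' ≤ b) : meanSqDist K b' ≤ meanSqDist K b := by
  rcases hb.eq_or_lt with rfl | hb0
  · have h : ∀ h : Vec n, Metric.infDist ((0 : ℝ) • h) K ^ 2
        ≤ (1 / 2) * Metric.infDist (b • h) K ^ 2 + (1 / 2) * Metric.infDist ((-b) • h) K ^ 2 := by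
      intro h
      have := infDist_sq_convex_comb_le hne hK hc (p := 1 / 2) (q := 1 / 2) (by norm_num)
        (by norm_num) (by norm_num) (b • h) ((-b) • h)
      simpa using this
    have hi := integral_mono (integrable_infDist_sq hne 0)
      (((integrable_infDist_sq hne b).const_mul _).add
        ((integrable_infDist_sq hne (-b)).const_mul _)) h
    simp only [Pi.add_apply] at hi
    rw [integral_add ((integrable_infDist_sq hne b).const_mul _)
      ((integrable_infDist_sq hne (-b)).const_mul _), integral_const_mul, integral_const_mul] at hi
    change meanSqDist K 0 ≤ 1 / 2 * meanSqDist K b + 1 / 2 * meanSqDist K (-b) at hi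
    rw [meanSqDist_neg] at hi
    linarith
  · have hbp : 0 < b := hb0.trans_le hbb
    set p := (1 + b' / b) / 2 with hp
    have hr : b' / b ≤ 1 := (div_le_one hbp).2 hbb
    have hr0 : 0 ≤ b' / b := by positivity
    have h : ∀ h : Vec n, Metric.infDist (b' • h) K ^ 2
        ≤ p * Metric.infDist (b • h) K ^ 2 + (1 - p) * Metric.infDist ((-b) • h) K ^ 2 := by
      intro h
      have := infDist_sq_convex_comb_le hne hK hc (p := p) (q := 1 - p) (by positivity)
        (by linarith) (by ring) (b • h) ((-b) • h)
      have e : p • b • h + (1 - p) • (-b) • h = b' • h := by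
        rw [smul_smul, smul_smul, ← add_smul]
        congr 1
        rw [hp]; field_simp; ring
      rwa [e] at this
    have hi := integral_mono (integrable_infDist_sq hne b')
      (((integrable_infDist_sq hne b).const_mul _).add
        ((integrable_infDist_sq hne (-b)).const_mul _)) h
    simp only [Pi.add_apply] at hi
    rw [integral_add ((integrable_infDist_sq hne b).const_mul _)
      ((integrable_infDist_sq hne (-b)).const_mul _), integral_const_mul, integral_const_mul] at hi
    change meanSqDist K b' ≤ p * meanSqDist K b + (1 - p) * meanSqDist K (-b) at hi
    rw [meanSqDist_neg] at hi
    linarith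

/-- Linearising the squared distance at `h` bounds the mean squared distance at scale `1 - η` from
below by the mean squared distance and the mean correlation at scale `1`. -/
lemma meanSqDist_one_sub_ge (hne : K.Nonempty) (hK : IsClosed K) (hc : Convex ℝ K) (η : ℝ) :
    meanSqDist K 1 - 2 * η * (meanSqDist K 1
        + ∫ h, inner ℝ (h - proj h K) (proj h K) ∂(stdGaussian (Vec n)))
      ≤ meanSqDist K (1 - η) := by
  have hi1 := integrable_infDist_sq hne (1 : ℝ)
  have hp := continuous_proj hne hK hc
  have hi2 : Integrable (fun h => inner ℝ (h - proj h K) (proj h K)) (stdGaussian (Vec n)) := by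
    refine ((hi1.const_mul 3).add ((integrable_norm_sq (n := n)).const_mul 2)).mono'
      (by fun_prop) (ae_of_all _ fun h => ?_)
    simp only [one_smul, infDist_eq_norm_sub_proj hne hK, Pi.add_apply]
    have h1 := abs_real_inner_le_norm (h - proj h K) (proj h K)
    have h2 : ‖proj h K‖ ≤ ‖h - proj h K‖ + ‖h‖ := by
      have := norm_sub_le h (h - proj h K)
      rw [sub_sub_cancel] at this
      linarith
    rw [Real.norm_eq_abs]
    nlinarith [norm_nonneg (h - proj h K), norm_nonneg (proj h K), norm_nonneg h,
      sq_nonneg (‖h - proj h K‖ - ‖h‖), sq_nonneg (‖h - proj h K‖ - ‖proj h K‖)]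
  have hpt : ∀ h : Vec n, (1 - 2 * η) * Metric.infDist ((1 : ℝ) • h) K ^ 2
      - 2 * η * inner ℝ (h - proj h K) (proj h K) ≤ Metric.infDist ((1 - η) • h) K ^ 2 := by
    intro h
    have h1 := infDist_sq_add_ge hne hK hc h (-η • h)
    have e : h + -η • h = (1 - η) • h := by rw [sub_smul, one_smul, neg_smul]; abel
    have e2 : inner ℝ (h - proj h K) h
        = Metric.infDist h K ^ 2 + inner ℝ (h - proj h K) (proj h K) := by
      rw [infDist_eq_norm_sub_proj hne hK, ← real_inner_self_eq_norm_sq, ← inner_add_right,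
        sub_add_cancel]
    rw [e, inner_smul_right, e2] at h1
    rw [one_smul]
    linarith
  have hmono := integral_mono ((hi1.const_mul _).sub (hi2.const_mul _))
    (integrable_infDist_sq hne (1 - η)) hpt
  simp only [Pi.sub_apply] at hmono
  rw [integral_sub (hi1.const_mul _) (hi2.const_mul _), integral_const_mul,
    integral_const_mul] at hmono
  change (1 - 2 * η) * meanSqDist K 1 - _ ≤ meanSqDist K (1 - η) at hmono
  linarith

lemma infDist_smul_zero (b : ℝ) (h : Vec n) :
    Metric.infDist (b • h) ({0} : Set (Vec n)) = |b| * ‖h‖ := by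
  rw [Metric.infDist_singleton, dist_zero_right, norm_smul, Real.norm_eq_abs]

lemma meanSqDist_zero_one : meanSqDist ({0} : Set (Vec n)) 1 = n := by
  have h1 : ∀ i : Fin n, ∫ h : Vec n, h i ^ 2 ∂(stdGaussian (Vec n)) = 1 := by
    intro i
    have hv := variance_dual_stdGaussian (E := Vec n) (innerSL ℝ (EuclideanSpace.single i (1 : ℝ)))
    rw [variance_of_integral_eq_zero (by fun_prop) (integral_strongDual_stdGaussian _)] at hv
    simpa [EuclideanSpace.inner_single_left] using hv
  have h2 : ∀ i : Fin n, Integrable (fun h : Vec n => h i ^ 2) (stdGaussian (Vec n)) := by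
    intro i
    refine integrable_norm_sq.mono' (by fun_prop) (ae_of_all _ fun h => ?_)
    rw [Real.norm_eq_abs, abs_of_nonneg (sq_nonneg _), EuclideanSpace.real_norm_sq_eq]
    exact Finset.single_le_sum (f := fun i => h i ^ 2) (fun i _ => sq_nonneg _) (Finset.mem_univ i)
  simp only [meanSqDist, infDist_smul_zero, abs_one, one_mul, EuclideanSpace.real_norm_sq_eq]
  rw [integral_finsetSum _ fun i _ => h2 i]
  simp [h1]

lemma measureReal_norm_sub_sqrt_ge_le {s : ℝ} (hs : 0 ≤ s) :
    (stdGaussian (Vec n)).real {h | s + concentrationOffset ≤ |‖h‖ - √n|}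
      ≤ 2 * Real.exp (-s ^ 2 / 5) := by
  have h := measureReal_infDist_sub_ge_le (K := ({0} : Set (Vec n))) (b := 1)
    (Set.singleton_nonempty _) isClosed_singleton (convex_singleton _) (by simp) hs
  simpa [infDist_smul_zero, meanSqDist_zero_one] using h

end Means

lemma measureReal_abs_inner_ge_le {E : Type*} [NormedAddCommGroup E] [InnerProductSpace ℝ E]
    [FiniteDimensional ℝ E] [MeasurableSpace E] [BorelSpace E] {a : E} (ha : ‖a‖ ≤ 1) {s : ℝ}
    (hs : 0 ≤ s) :
    (stdGaussian E).real {x | s ≤ |inner ℝ a x|} ≤ 2 * Real.exp (-s ^ 2 / 5) := by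
  have hL : LipschitzWith 1 fun x : E => inner ℝ a x := by
    refine LipschitzWith.of_dist_le_mul fun x y => ?_
    rw [Real.dist_eq, dist_eq_norm, ← inner_sub_right, NNReal.coe_one]
    exact (abs_real_inner_le_norm _ _).trans
      (mul_le_mul_of_nonneg_right ha (norm_nonneg _))
  have h := measureReal_abs_sub_mean_ge_le (contDiff_const.inner ℝ contDiff_id) hL hs
  have h0 : ∫ x, inner ℝ a x ∂(stdGaussian E) = 0 := integral_strongDual_stdGaussian (innerSL ℝ a)
  simpa [h0] using h

/-! ### Subdifferentials and support functions -/

section Subdifferential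

variable {n : ℕ} {f : Vec n → ℝ}

lemma convex_subdifferential (f : Vec n → ℝ) (x₀ : Vec n) : Convex ℝ (subdifferential f x₀) := by
  intro s hs t ht a b ha hb hab x
  have h1 := hs x
  have h2 := ht x
  simp only [inner_add_left, inner_smul_left, RCLike.conj_to_real]
  have hb' : b = 1 - a := by linarith
  subst hb'
  nlinarith

lemma isClosed_subdifferential (f : Vec n → ℝ) (x₀ : Vec n) :
    IsClosed (subdifferential f x₀) := by
  have : subdifferential f x₀ = ⋂ x, {s | f x₀ + inner ℝ s (x - x₀) ≤ f x} := by
    ext; simp [subdifferential]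
  rw [this]
  exact isClosed_iInter fun x => isClosed_le (by fun_prop) (by fun_prop)

/-- Subgradients at points near `x₀` are bounded by the values of `f` on a slightly larger ball. -/
lemma norm_le_of_mem_subdifferential {x₀ x s : Vec n} {B : ℝ}
    (hB : ∀ y, ‖y - x₀‖ ≤ 2 → |f y| ≤ B) (hx : ‖x - x₀‖ ≤ 1) (hs : s ∈ subdifferential f x) :
    ‖s‖ ≤ 2 * B := by
  have hb0 := abs_le.1 (hB x (by linarith))
  rcases eq_or_ne s 0 with rfl | hne
  · rw [norm_zero]; linarith [hb0.1, hb0.2]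
  have hn : ‖s‖ ≠ 0 := norm_ne_zero_iff.2 hne
  have h := hs (x + ‖s‖⁻¹ • s)
  rw [add_sub_cancel_left, inner_smul_right, real_inner_self_eq_norm_sq] at h
  have e : ‖s‖⁻¹ * ‖s‖ ^ 2 = ‖s‖ := by field_simp
  rw [e] at h
  have hb1 := abs_le.1 (hB (x + ‖s‖⁻¹ • s) (by
    have e2 : x + ‖s‖⁻¹ • s - x₀ = (x - x₀) + ‖s‖⁻¹ • s := by abel
    rw [e2]
    refine (norm_add_le _ _).trans ?_
    rw [norm_smul, norm_inv, norm_norm, inv_mul_cancel₀ hn]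
    linarith))
  linarith [hb0.1, hb1.2]

lemma exists_abs_le_of_continuous (hf : Continuous f) (x₀ : Vec n) :
    ∃ B, ∀ y, ‖y - x₀‖ ≤ 2 → |f y| ≤ B := by
  obtain ⟨B, hB⟩ := (isCompact_closedBall x₀ 2).exists_bound_of_continuousOn hf.continuousOn
  exact ⟨B, fun y hy => hB y (by rwa [mem_closedBall_iff_norm])⟩

lemma isCompact_subdifferential (hf : Continuous f) (x₀ : Vec n) :
    IsCompact (subdifferential f x₀) := by
  obtain ⟨B, hB⟩ := exists_abs_le_of_continuous hf x₀
  refine (isCompact_closedBall (0 : Vec n) (2 * B)).of_isClosed_subset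
    (isClosed_subdifferential f x₀) fun s hs => ?_
  rw [mem_closedBall_zero_iff]
  exact norm_le_of_mem_subdifferential hB (by simp) hs

/-- A subgradient comes from a hyperplane separating `(x₀, f x₀)` from the strict epigraph. -/
lemma subdifferential_nonempty (hc : ConvexOn ℝ Set.univ f) (hf : Continuous f) (x₀ : Vec n) :
    (subdifferential f x₀).Nonempty := by
  have hopen : IsOpen {p : Vec n × ℝ | f p.1 < p.2} :=
    isOpen_lt (hf.comp continuous_fst) continuous_snd
  have hconv : Convex ℝ {p : Vec n × ℝ | f p.1 < p.2} := by
    have := hc.convex_strict_epigraph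
    simpa using this
  obtain ⟨L, hL⟩ := geometric_hahn_banach_open_point hconv hopen
    (x := (x₀, f x₀)) (by simp)
  set l : StrongDual ℝ (Vec n) := L.comp (ContinuousLinearMap.inl ℝ (Vec n) ℝ)
  set τ : ℝ := L (0, 1)
  have hdec : ∀ (y : Vec n) (t : ℝ), L (y, t) = l y + t * τ := by
    intro y t
    have e : ((y, t) : Vec n × ℝ) = (y, 0) + t • (0, 1) := by simp
    rw [e, map_add, map_smul]
    rfl
  have hτ : τ < 0 := by
    have := hL (x₀, f x₀ + 1) (by simp)
    rw [hdec, hdec] at this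
    linarith
  refine ⟨(InnerProductSpace.toDual ℝ (Vec n)).symm ((-τ)⁻¹ • l), fun x => ?_⟩
  rw [InnerProductSpace.toDual_symm_apply, smul_apply, smul_eq_mul, map_sub]
  refine le_of_forall_pos_le_add fun ε hε => ?_
  have := hL (x, f x + ε) (by simpa using hε)
  rw [hdec, hdec] at this
  have h2 : l x - l x₀ ≤ (f x + ε - f x₀) * (-τ) := by linarith
  have h3 : (-τ)⁻¹ * (l x - l x₀) ≤ f x + ε - f x₀ := by
    rw [inv_mul_le_iff₀ (by linarith)]
    linarith
  linarith

/-- Near `x₀` the increment of `f` is at most linear with a slope in `∂f(x₀)`, up to an error that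
is uniformly small relative to the displacement: the subdifferential is outer semicontinuous. -/
lemma exists_sub_le_inner_add (hc : ConvexOn ℝ Set.univ f) (hf : Continuous f) (x₀ : Vec n)
    {δ : ℝ} (hδ : 0 < δ) :
    ∃ r > 0, ∀ w, ‖w‖ ≤ r → ∃ s ∈ subdifferential f x₀,
      f (x₀ + w) - f x₀ ≤ inner ℝ s w + δ * ‖w‖ := by
  by_contra hcon
  push Not at hcon
  choose w hw hws using fun k : ℕ => hcon (1 / ((k : ℝ) + 1)) (by positivity)
  choose s hs using fun k : ℕ => subdifferential_nonempty hc hf (x₀ + w k)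
  have hw0 : Filter.Tendsto w Filter.atTop (nhds 0) :=
    squeeze_zero_norm hw tendsto_one_div_add_atTop_nhds_zero_nat
  obtain ⟨B, hB⟩ := exists_abs_le_of_continuous hf x₀
  have hsb : ∀ k, s k ∈ Metric.closedBall (0 : Vec n) (2 * B) := by
    intro k
    rw [mem_closedBall_zero_iff]
    refine norm_le_of_mem_subdifferential hB ?_ (hs k)
    rw [add_sub_cancel_left]
    refine (hw k).trans ?_
    rw [div_le_one (by positivity)]
    linarith [Nat.cast_nonneg (α := ℝ) k]
  obtain ⟨a, -, φ, hφ, hlim⟩ := (isCompact_closedBall (0 : Vec n) (2 * B)).tendsto_subseq hsb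
  have hwφ := hw0.comp hφ.tendsto_atTop
  have ha : a ∈ subdifferential f x₀ := by
    intro x
    have h1 : Filter.Tendsto (fun k => f (x₀ + w (φ k)) + inner ℝ (s (φ k)) (x - (x₀ + w (φ k))))
        Filter.atTop (nhds (f x₀ + inner ℝ a (x - x₀))) := by
      have e1 : Filter.Tendsto (fun k => x₀ + w (φ k)) Filter.atTop (nhds x₀) := by
        simpa using hwφ.const_add x₀
      exact ((hf.tendsto x₀).comp e1).add (hlim.inner (e1.const_sub x))
    exact le_of_tendsto' h1 fun k => hs (φ k) x
  have hev : ∀ᶠ k in Filter.atTop, dist (s (φ k)) a < δ := Metric.tendsto_nhds.1 hlim δ hδ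
  obtain ⟨k, hk⟩ := hev.exists
  have h1 := hws (φ k) a ha
  have h2 := hs (φ k) x₀
  have e : x₀ - (x₀ + w (φ k)) = -w (φ k) := by abel
  rw [e, inner_neg_right] at h2
  rw [dist_eq_norm] at hk
  have h3 := real_inner_le_norm (s (φ k) - a) (w (φ k))
  rw [inner_sub_left] at h3
  nlinarith [norm_nonneg (w (φ k))]

end Subdifferential

section SupportFunction

variable {n : ℕ} {K : Set (Vec n)}

/-- The support function `w ↦ sup {⟪s, w⟫ | s ∈ K}` of `K`; finite when `K` is compact and
nonempty. -/
def supportFun (K : Set (Vec n)) (w : Vec n) : ℝ := sSup ((fun s => inner ℝ s w) '' K)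

lemma inner_le_supportFun (hK : IsCompact K) {s : Vec n} (hs : s ∈ K) (w : Vec n) :
    inner ℝ s w ≤ supportFun K w :=
  le_csSup (hK.image (by fun_prop)).bddAbove ⟨s, hs, rfl⟩

lemma supportFun_le (hne : K.Nonempty) {w : Vec n} {c : ℝ} (h : ∀ s ∈ K, inner ℝ s w ≤ c) :
    supportFun K w ≤ c :=
  csSup_le (hne.image _) (by rintro _ ⟨s, hs, rfl⟩; exact h s hs)

lemma continuous_supportFun (hK : IsCompact K) : Continuous (supportFun K) :=
  hK.continuous_sSup (f := fun w s => inner ℝ s w) (by fun_prop)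

end SupportFunction

/-! ### Comparison for the first-order objective -/

section Comparison

variable {m n : ℕ} {K : Set (Vec n)}

lemma continuous_toEuclideanLin (A : Matrix (Fin m) (Fin n) ℝ) :
    Continuous fun w : Vec n => A.toEuclideanLin w :=
  LinearMap.continuous_of_finiteDimensional _

/-- The unit vector in the direction of `z` if `z ≠ 0`, and an arbitrary unit vector otherwise. -/
lemma exists_unit_inner_eq_norm (hm : 0 < m) (z : Vec m) :
    ∃ u : Vec m, ‖u‖ = 1 ∧ inner ℝ u z = ‖z‖ := by
  rcases eq_or_ne z 0 with rfl | hz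
  · exact ⟨EuclideanSpace.single ⟨0, hm⟩ 1, by simp, by simp⟩
  · have hn : ‖z‖ ≠ 0 := norm_ne_zero_iff.2 hz
    refine ⟨‖z‖⁻¹ • z, by rw [norm_smul, norm_inv, norm_norm, inv_mul_cancel₀ hn], ?_⟩
    rw [real_inner_smul_left, real_inner_self_eq_norm_sq]
    field_simp

lemma measure_le_add_of_subset_union {Ω : Type*} [MeasurableSpace Ω] {μ : Measure Ω} {S T U : Set Ω}
    (h : S ⊆ T ∪ U) : μ S ≤ μ T + μ U := (measure_mono h).trans (measure_union_le _ _)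

/-- Comparison from below: with the design matrix replaced by the decoupled Gaussian vectors `g`
and `h`, the objective at `w` is at least `‖v - ‖w‖ g‖ - ‖w‖ dist(h, K)`. -/
lemma measure_exists_objective_lt_le (hm : 0 < m) (hne : K.Nonempty) (hK : IsCompact K)
    (v : Vec m) {W : Set (Vec n)} (hW : W.Nonempty) {R : ℝ}
    (hR : ∀ w ∈ W, ‖w‖ ≤ R) (c : ℝ) {δ τ : ℝ} (hδ : 0 < δ) (hτ : 0 ≤ τ) :
    (Measure.pi fun _ : Fin m => Measure.pi fun _ : Fin n => gaussianReal 0 1)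
        {A | ∃ w ∈ W, ‖v - (Matrix.of A).toEuclideanLin w‖ + supportFun K w < c}
      ≤ stdGaussian (GordonSpace m n) {ξ | τ ≤ |scalarPart ξ|} +
        stdGaussian (GordonSpace m n) {ξ | ∃ w ∈ W, ‖v - ‖w‖ • leftPart ξ‖
          - ‖w‖ * Metric.infDist (rightPart ξ) K ≤ c + R * τ + δ} := by
  have hsc := continuous_supportFun hK
  have : Nonempty W := hW.to_subtype
  have : Nonempty (Metric.sphere (0 : Vec m) 1) := by
    obtain ⟨u, hu, -⟩ := exists_unit_inner_eq_norm hm (0 : Vec m)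
    exact ⟨⟨u, by simpa using hu⟩⟩
  obtain ⟨wd, hwd⟩ := TopologicalSpace.exists_dense_seq W
  obtain ⟨ud, hud⟩ := TopologicalSpace.exists_dense_seq (Metric.sphere (0 : Vec m) 1)
  have hu1 : ∀ j, ‖(ud j : Vec m)‖ = 1 := fun j => by simp
  set C : ℕ → ℕ → ℝ := fun i j =>
    inner ℝ (ud j : Vec m) v + supportFun K (wd i) - c - R * τ - δ
  have hG := measure_exists_forall_le (fun i j => bilinVec (ud j : Vec m) (wd i : Vec n))
    (fun i j => decoupledVec (ud j : Vec m) (wd i : Vec n)) C hδ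
    (fun _ _ _ _ => inner_bilinVec_decoupledVec _ _ _ _)
    (fun _ _ _ => inner_bilinVec_right _ _ _) (fun _ _ _ _ => inner_decoupledVec_le _ _ _ _)
  have hSm : MeasurableSet {A : Fin m → Fin n → ℝ |
      ∃ w ∈ W, ‖v - (Matrix.of A).toEuclideanLin w‖ + supportFun K w < c} := by
    have e : {A : Fin m → Fin n → ℝ |
        ∃ w ∈ W, ‖v - (Matrix.of A).toEuclideanLin w‖ + supportFun K w < c}
        = ⋃ w ∈ W, {A : Fin m → Fin n → ℝ |
          ‖v - (Matrix.of A).toEuclideanLin w‖ + supportFun K w < c} := by ext; simp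
    rw [e]
    refine (isOpen_biUnion fun w _ => isOpen_lt ?_ continuous_const).measurableSet
    simp only [Matrix.toLpLin_apply]
    have : Continuous fun A : Fin m → Fin n → ℝ => (Matrix.of A).mulVec w.ofLp :=
      Continuous.matrix_mulVec (continuous_id : Continuous fun A : Fin m → Fin n → ℝ => A)
        continuous_const
    fun_prop
  rw [← map_matrixPart, Measure.map_apply measurable_matrixPart hSm]
  refine (measure_le_add_of_subset_union (T := {ξ | τ ≤ |scalarPart ξ|})
    (U := {ξ | ∃ i, ∀ j, C i j + δ ≤ inner ℝ (bilinVec (ud j : Vec m) (wd i : Vec n)) ξ}) ?_).trans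
    (add_le_add le_rfl (hG.trans (measure_mono ?_)))
  · intro ξ hξ
    simp only [Set.mem_preimage, Set.mem_ofPred_eq, Set.mem_union] at hξ ⊢
    rw [or_iff_not_imp_left, not_le]
    intro hγ
    obtain ⟨w, hw, hlt⟩ := hξ
    have hAc := continuous_toEuclideanLin (Matrix.of (matrixPart ξ))
    have hopen : IsOpen {w : W | ‖v - (Matrix.of (matrixPart ξ)).toEuclideanLin (w : Vec n)‖
        + supportFun K w < c} := isOpen_lt (by fun_prop) continuous_const
    obtain ⟨i, hi⟩ := hwd.exists_mem_open hopen ⟨⟨w, hw⟩, hlt⟩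
    refine ⟨i, fun j => ?_⟩
    simp only [Set.mem_ofPred_eq] at hi
    rw [inner_bilinVec_apply, hu1, one_mul]
    have h1 := real_inner_le_norm (ud j : Vec m)
      (v - (Matrix.of (matrixPart ξ)).toEuclideanLin (wd i : Vec n))
    rw [hu1, one_mul, inner_sub_right] at h1
    have h2 : -(R * τ) ≤ ‖(wd i : Vec n)‖ * scalarPart ξ := by
      have h3 := hR _ (wd i).2
      have h4 := abs_le.1 hγ.le
      nlinarith [norm_nonneg (wd i : Vec n)]
    simp only [C]
    linarith
  · rintro ξ ⟨i, hi⟩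
    refine ⟨wd i, (wd i).2, ?_⟩
    have hall : ∀ u : Metric.sphere (0 : Vec m) 1,
        inner ℝ (u : Vec m) v + supportFun K (wd i) - c - R * τ - δ
          ≤ ‖(wd i : Vec n)‖ * inner ℝ (u : Vec m) (leftPart ξ)
            + inner ℝ (wd i : Vec n) (rightPart ξ) := by
      intro u
      refine hud.induction_on (p := fun u : Metric.sphere (0 : Vec m) 1 =>
        inner ℝ (u : Vec m) v + supportFun K (wd i) - c - R * τ - δ
          ≤ ‖(wd i : Vec n)‖ * inner ℝ (u : Vec m) (leftPart ξ)
            + inner ℝ (wd i : Vec n) (rightPart ξ)) u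
        (isClosed_le (by fun_prop) (by fun_prop)) fun j => ?_
      have := hi j
      rw [inner_decoupledVec_apply, hu1, one_mul] at this
      exact this
    obtain ⟨u, hu, huz⟩ := exists_unit_inner_eq_norm hm (v - ‖(wd i : Vec n)‖ • leftPart ξ)
    have h1 := hall ⟨u, by simpa using hu⟩
    simp only at h1
    rw [inner_sub_right, inner_smul_right] at huz
    have h2 := inner_le_supportFun hK (proj_mem (rightPart ξ) hne hK.isClosed) (wd i : Vec n)
    have h3 := real_inner_le_norm (wd i : Vec n) (rightPart ξ - proj (rightPart ξ) K)
    rw [inner_sub_right, ← infDist_eq_norm_sub_proj hne hK.isClosed,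
      real_inner_comm (proj (rightPart ξ) K) (wd i : Vec n)] at h3
    linarith

/-- Strong duality for the objective over a ball: the minimum is attained against a single dual
pair `(u, s)`. -/
lemma exists_dual_pair (hne : K.Nonempty) (hK : IsCompact K) (hc : Convex ℝ K)
    (A : Matrix (Fin m) (Fin n) ℝ) (v : Vec m) {α c : ℝ} (hα : 0 ≤ α)
    (h : ∀ w : Vec n, ‖w‖ ≤ α → c ≤ ‖v - A.toEuclideanLin w‖ + supportFun K w) :
    ∃ u : Vec m, ‖u‖ ≤ 1 ∧ ∃ s ∈ K, ∀ w : Vec n, ‖w‖ ≤ α →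
      c ≤ inner ℝ u (v - A.toEuclideanLin w) + inner ℝ s w := by
  have hAc := continuous_toEuclideanLin A
  set F : Vec n → Vec m × Vec n → ℝ := fun w y =>
    inner ℝ y.1 (v - A.toEuclideanLin w) + inner ℝ y.2 w
  have hconv1 : ∀ y, ConvexOn ℝ (Metric.closedBall (0 : Vec n) α) fun w => F w y := by
    intro y
    refine ⟨convex_closedBall _ _, fun a _ b _ p q _ _ hpq => le_of_eq ?_⟩
    have hq' : q = 1 - p := by linarith
    subst hq'
    simp only [F, map_add, map_smul, inner_sub_right, inner_add_right, inner_smul_right,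
      smul_eq_mul]
    ring
  have hconc1 : ∀ w, ConcaveOn ℝ (Metric.closedBall (0 : Vec m) 1 ×ˢ K) fun y => F w y := by
    intro w
    refine ⟨(convex_closedBall _ _).prod hc, fun a _ b _ p q _ _ hpq => le_of_eq ?_⟩
    simp only [F, Prod.fst_add, Prod.snd_add, Prod.smul_fst, Prod.smul_snd, inner_add_left,
      real_inner_smul_left, smul_eq_mul]
    ring
  obtain ⟨w₀, hw₀, ⟨u₀, s₀⟩, ⟨hu₀, hs₀⟩, hsad⟩ := Sion.exists_isSaddlePointOn
    (X := Metric.closedBall (0 : Vec n) α) (Y := Metric.closedBall (0 : Vec m) 1 ×ˢ K) (f := F)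
    ⟨0, by simpa using hα⟩ (convex_closedBall _ _) (isCompact_closedBall _ _)
    (fun y _ => (Continuous.lowerSemicontinuous (by fun_prop)).lowerSemicontinuousOn _)
    (fun y _ => (hconv1 y).quasiconvexOn)
    ((convex_closedBall _ _).prod hc)
    (Set.Nonempty.prod ⟨0, by simp⟩ hne) ((isCompact_closedBall _ _).prod hK)
    (fun w _ => (Continuous.upperSemicontinuous (by fun_prop)).upperSemicontinuousOn _)
    (fun w _ => (hconc1 w).quasiconcaveOn)
  refine ⟨u₀, by simpa using hu₀, s₀, hs₀, fun w hw => ?_⟩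
  set z := v - A.toEuclideanLin w₀ with hz
  have hu : ∃ u : Vec m, ‖u‖ ≤ 1 ∧ inner ℝ u z = ‖z‖ := by
    rcases Nat.eq_zero_or_pos m with hm | hm
    · subst hm
      exact ⟨0, by simp, by rw [Subsingleton.elim z 0]; simp⟩
    · obtain ⟨u, h1, h2⟩ := exists_unit_inner_eq_norm hm z
      exact ⟨u, h1.le, h2⟩
  obtain ⟨u, hu1, huz⟩ := hu
  have h1 := h w₀ (by simpa using hw₀)
  have h2 : supportFun K w₀ ≤ F w (u₀, s₀) - ‖z‖ := by
    refine supportFun_le hne fun s hs => ?_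
    have := hsad w (by simpa using hw) (u, s) ⟨by simpa using hu1, hs⟩
    have e : F w₀ (u, s) = ‖z‖ + inner ℝ s w₀ := by rw [← huz]
    linarith
  have h3 : c ≤ F w (u₀, s₀) := by linarith
  exact h3

/-- Comparison from above, through the dual problem: with the design matrix replaced by the
decoupled Gaussian vectors `g` and `h`, the dual objective at a vector of norm `β` is at most
`β ‖v + α g‖ - α dist(β h, K)`. -/
lemma measure_forall_le_objective_le (hn : 0 < n) (hne : K.Nonempty) (hK : IsCompact K)
    (hc : Convex ℝ K) (v : Vec m) {α : ℝ} (hα : 0 ≤ α) (c : ℝ) {δ τ : ℝ} (hδ : 0 < δ) :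
    (Measure.pi fun _ : Fin m => Measure.pi fun _ : Fin n => gaussianReal 0 1)
        {A | ∀ w, ‖w‖ ≤ α → c ≤ ‖v - (Matrix.of A).toEuclideanLin w‖ + supportFun K w}
      ≤ stdGaussian (GordonSpace m n) {ξ | τ ≤ |scalarPart ξ|} +
        stdGaussian (GordonSpace m n) {ξ | ∃ β, 0 ≤ β ∧ β ≤ 1 ∧ c - α * τ - 2 * δ
          ≤ β * ‖v + α • leftPart ξ‖ - α * Metric.infDist (β • rightPart ξ) K} := by
  have : Nonempty (Metric.closedBall (0 : Vec m) 1 ×ˢ K : Set (Vec m × Vec n)) :=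
    (Set.Nonempty.prod ⟨0, by simp⟩ hne).to_subtype
  have : Nonempty (Metric.sphere (0 : Vec n) α) := by
    obtain ⟨u, hu, -⟩ := exists_unit_inner_eq_norm hn (0 : Vec n)
    exact ⟨⟨α • u, by simp [norm_smul, hu, abs_of_nonneg hα]⟩⟩
  obtain ⟨yd, hyd⟩ := TopologicalSpace.exists_dense_seq
    (Metric.closedBall (0 : Vec m) 1 ×ˢ K : Set (Vec m × Vec n))
  obtain ⟨wd, hwd⟩ := TopologicalSpace.exists_dense_seq (Metric.sphere (0 : Vec n) α)
  have hu1 : ∀ i, ‖(yd i : Vec m × Vec n).1‖ ≤ 1 := fun i => by simpa using (yd i).2.1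
  have hw1 : ∀ j, ‖(wd j : Vec n)‖ = α := fun j => by simp
  set C : ℕ → ℕ → ℝ := fun i j => c - α * τ - 2 * δ - inner ℝ (yd i : Vec m × Vec n).1 v
    - inner ℝ (yd i : Vec m × Vec n).2 (wd j : Vec n)
  have hG := measure_exists_forall_le
    (fun i j => bilinVec (yd i : Vec m × Vec n).1 (-(wd j : Vec n)))
    (fun i j => decoupledVec (yd i : Vec m × Vec n).1 (-(wd j : Vec n))) C hδ
    (fun _ _ _ _ => inner_bilinVec_decoupledVec _ _ _ _)
    (fun _ _ _ => inner_bilinVec_left _ _ _) (fun _ _ _ _ => inner_decoupledVec_le _ _ _ _)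
  have hSm : MeasurableSet {A : Fin m → Fin n → ℝ |
      ∀ w, ‖w‖ ≤ α → c ≤ ‖v - (Matrix.of A).toEuclideanLin w‖ + supportFun K w} := by
    have e : {A : Fin m → Fin n → ℝ |
        ∀ w, ‖w‖ ≤ α → c ≤ ‖v - (Matrix.of A).toEuclideanLin w‖ + supportFun K w}
        = ⋂ w, ⋂ (_ : ‖w‖ ≤ α), {A : Fin m → Fin n → ℝ |
          c ≤ ‖v - (Matrix.of A).toEuclideanLin w‖ + supportFun K w} := by ext; simp
    rw [e]
    refine (isClosed_iInter fun w => isClosed_iInter fun _ =>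
      isClosed_le continuous_const ?_).measurableSet
    simp only [Matrix.toLpLin_apply]
    have : Continuous fun A : Fin m → Fin n → ℝ => (Matrix.of A).mulVec w.ofLp :=
      Continuous.matrix_mulVec (continuous_id : Continuous fun A : Fin m → Fin n → ℝ => A)
        continuous_const
    fun_prop
  rw [← map_matrixPart, Measure.map_apply measurable_matrixPart hSm]
  refine (measure_le_add_of_subset_union (T := {ξ | τ ≤ |scalarPart ξ|})
    (U := {ξ | ∃ i, ∀ j, C i j + δ ≤ inner ℝ
      (bilinVec (yd i : Vec m × Vec n).1 (-(wd j : Vec n))) ξ}) ?_).trans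
    (add_le_add le_rfl (hG.trans (measure_mono ?_)))
  · intro ξ hξ
    simp only [Set.mem_preimage, Set.mem_ofPred_eq, Set.mem_union] at hξ ⊢
    rw [or_iff_not_imp_left, not_le]
    intro hγ
    set A := Matrix.of (matrixPart ξ)
    obtain ⟨u, hu, s, hs, hdual⟩ := exists_dual_pair hne hK hc A v hα hξ
    obtain ⟨M, hM⟩ := (isCompact_closedBall (0 : Vec n) α).exists_bound_of_continuousOn
      (f := fun w => v - A.toEuclideanLin w)
      ((continuous_const.sub (continuous_toEuclideanLin A)).continuousOn)
    -- the dual pair may be moved into the dense sequence at a cost below `δ`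
    have hopen : IsOpen {y : (Metric.closedBall (0 : Vec m) 1 ×ˢ K : Set (Vec m × Vec n)) |
        ‖(y : Vec m × Vec n).1 - u‖ * M + ‖(y : Vec m × Vec n).2 - s‖ * α < δ} :=
      isOpen_lt (by fun_prop) continuous_const
    obtain ⟨i, hi⟩ := hyd.exists_mem_open hopen
      ⟨⟨(u, s), by simpa using hu, hs⟩, by simpa using hδ⟩
    simp only [Set.mem_ofPred_eq] at hi
    refine ⟨i, fun j => ?_⟩
    rw [inner_bilinVec_apply, norm_neg, hw1, map_neg, inner_neg_right]
    set u' := (yd i : Vec m × Vec n).1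
    set s' := (yd i : Vec m × Vec n).2
    set w : Vec n := (wd j : Vec n)
    have h1 := hdual w (hw1 j).le
    have h2 := hM w (by rw [mem_closedBall_zero_iff]; exact (hw1 j).le)
    have h3 := (abs_le.1 ((abs_real_inner_le_norm (u' - u) (v - A.toEuclideanLin w)).trans
      (mul_le_mul_of_nonneg_left h2 (norm_nonneg _)))).1
    have h4 := (abs_le.1 (abs_real_inner_le_norm (s' - s) w)).1
    rw [hw1 j] at h4
    rw [inner_sub_left, inner_sub_right u' v] at h3
    rw [inner_sub_left] at h4
    have h5 : -(α * τ) ≤ ‖u'‖ * α * scalarPart ξ := by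
      have h6 := abs_le.1 hγ.le
      have h7 : ‖u'‖ * α ≤ α := mul_le_of_le_one_left hα (hu1 i)
      have h8 : 0 ≤ ‖u'‖ * α := by positivity
      have h9 : 0 ≤ τ := (abs_nonneg _).trans hγ.le
      nlinarith
    simp only [C]
    change c - α * τ - 2 * δ - inner ℝ u' v - inner ℝ s' w + δ
      ≤ -inner ℝ u' (A.toEuclideanLin w) + ‖u'‖ * α * scalarPart ξ
    linarith
  · rintro ξ ⟨i, hi⟩
    set u := (yd i : Vec m × Vec n).1
    set s := (yd i : Vec m × Vec n).2
    refine ⟨‖u‖, norm_nonneg _, hu1 i, ?_⟩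
    have hall : ∀ w : Metric.sphere (0 : Vec n) α,
        c - α * τ - 2 * δ - inner ℝ u v - inner ℝ s (w : Vec n)
          ≤ α * inner ℝ u (leftPart ξ) - ‖u‖ * inner ℝ (w : Vec n) (rightPart ξ) := by
      intro w
      refine hwd.induction_on (p := fun w : Metric.sphere (0 : Vec n) α =>
        c - α * τ - 2 * δ - inner ℝ u v - inner ℝ s (w : Vec n)
          ≤ α * inner ℝ u (leftPart ξ) - ‖u‖ * inner ℝ (w : Vec n) (rightPart ξ)) w
        (isClosed_le (by fun_prop) (by fun_prop)) fun j => ?_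
      have := hi j
      rw [inner_decoupledVec_apply, norm_neg, hw1, inner_neg_left] at this
      simp only [C] at this
      linarith
    obtain ⟨e, he, hez⟩ := exists_unit_inner_eq_norm hn (s - ‖u‖ • rightPart ξ)
    have h1 := hall ⟨-(α • e), by simp [norm_smul, he, abs_of_nonneg hα]⟩
    simp only [inner_neg_right, inner_neg_left, inner_smul_right, real_inner_smul_left] at h1
    rw [inner_sub_right, inner_smul_right] at hez
    have h2 : Metric.infDist (‖u‖ • rightPart ξ) K ≤ ‖s - ‖u‖ • rightPart ξ‖ := by
      have := Metric.infDist_le_dist_of_mem (x := ‖u‖ • rightPart ξ) (yd i).2.2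
      rwa [dist_comm, dist_eq_norm] at this
    have h3 := real_inner_le_norm u (v + α • leftPart ξ)
    rw [inner_add_right, inner_smul_right] at h3
    rw [real_inner_comm e s] at h1
    have h4 := mul_le_mul_of_nonneg_left h2 hα
    rw [← hez] at h4
    linarith

end Comparison

/-! ### The typical event for the decoupled vectors -/

section RealEstimates

lemma abs_sub_le_of_abs_sq_sub_le {S T x : ℝ} (hS : 0 ≤ S) (hT : 0 < T)
    (h : |S ^ 2 - T ^ 2| ≤ x * T) : |S - T| ≤ x := by
  have e : |S ^ 2 - T ^ 2| = |S - T| * (S + T) := by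
    rw [sq_sub_sq, abs_mul, abs_of_nonneg (by linarith : (0 : ℝ) ≤ S + T), mul_comm]
  rw [e] at h
  have h2 : |S - T| * T ≤ |S - T| * (S + T) :=
    mul_le_mul_of_nonneg_left (by linarith) (abs_nonneg _)
  exact le_of_mul_le_mul_right (h2.trans h) hT

/-- Nearly orthogonal vectors of norm close to `a` behave like orthogonal vectors of norm `a`. -/
lemma abs_norm_add_smul_sub_le {m : ℕ} {v g : Vec m} {a t : ℝ} (ha : 0 < a) (ht0 : 0 ≤ t)
    (ht1 : t ≤ 1) (hv : |‖v‖ - a| ≤ t * a) (hg : |‖g‖ - a| ≤ t * a)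
    (hvg : |inner ℝ v g| ≤ t * a * ‖v‖) (x : ℝ) :
    |‖v + x • g‖ - a * √(1 + x ^ 2)| ≤ 5 * t * (1 + |x|) * a := by
  have hq : 0 < √(1 + x ^ 2) := by positivity
  have hq2 := Real.sq_sqrt (show 0 ≤ 1 + x ^ 2 by positivity)
  have hx2 := sq_abs x
  have hx0 := abs_nonneg x
  have hqx : √(1 + x ^ 2) ≤ 1 + |x| := Real.sqrt_le_iff.2 ⟨by positivity, by nlinarith⟩
  have hta : 0 ≤ t * a := by positivity
  have hva := abs_le.1 hv
  have hga := abs_le.1 hg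
  have hta1 : t * a ≤ a := mul_le_of_le_one_left ha.le ht1
  have hsq : ∀ y : ℝ, |y - a| ≤ t * a → |y ^ 2 - a ^ 2| ≤ 3 * (t * a) * a := by
    intro y hy
    have e : y ^ 2 - a ^ 2 = (y - a) * (y + a) := by ring
    rw [e, abs_mul]
    have h1 := abs_le.1 hy
    have h2 : |y + a| ≤ 3 * a := by rw [abs_le]; constructor <;> linarith
    calc _ ≤ (t * a) * (3 * a) := mul_le_mul hy h2 (abs_nonneg _) hta
      _ = _ := by ring
  have h1 := hsq _ hv
  have h2 := hsq _ hg
  have h3 : |inner ℝ v g| ≤ 2 * (t * a) * a := by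
    refine hvg.trans ?_
    have : ‖v‖ ≤ 2 * a := by linarith [hva.2]
    nlinarith
  have e : ‖v + x • g‖ ^ 2 - (a * √(1 + x ^ 2)) ^ 2
      = (‖v‖ ^ 2 - a ^ 2) + 2 * x * inner ℝ v g + x ^ 2 * (‖g‖ ^ 2 - a ^ 2) := by
    rw [norm_add_sq_real, inner_smul_right, norm_smul, mul_pow, mul_pow, hq2, Real.norm_eq_abs,
      sq_abs]
    ring
  have hb : |‖v + x • g‖ ^ 2 - (a * √(1 + x ^ 2)) ^ 2| ≤ 5 * (t * a) * a * (1 + x ^ 2) := by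
    rw [e]
    refine (abs_add_three _ _ _).trans ?_
    have h4 : |2 * x * inner ℝ v g| ≤ 2 * |x| * (2 * (t * a) * a) := by
      rw [abs_mul, abs_mul, abs_two]
      exact mul_le_mul_of_nonneg_left h3 (by positivity)
    have h5 : |x ^ 2 * (‖g‖ ^ 2 - a ^ 2)| ≤ x ^ 2 * (3 * (t * a) * a) := by
      rw [abs_mul, abs_of_nonneg (sq_nonneg x)]
      exact mul_le_mul_of_nonneg_left h2 (sq_nonneg x)
    have h6 : 0 ≤ t * a * a := by positivity
    nlinarith [mul_nonneg h6 (sq_nonneg (|x| - 1))]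
  have hc := abs_sub_le_of_abs_sq_sub_le (norm_nonneg (v + x • g)) (mul_pos ha hq)
    (x := 5 * (t * a) * √(1 + x ^ 2)) (hb.trans (le_of_eq (by
      rw [show 5 * (t * a) * √(1 + x ^ 2) * (a * √(1 + x ^ 2))
        = 5 * (t * a) * a * √(1 + x ^ 2) ^ 2 by ring, hq2])))
  refine hc.trans ?_
  nlinarith

/-- A concave function on `[0, 1]` is controlled by its values at `1`, `1 - η` and `1 - 2 η`. -/
lemma concaveOn_le_of_three_points {G : ℝ → ℝ} (hG : ConcaveOn ℝ (Set.Icc 0 1) G) {η x y : ℝ}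
    (hη : 0 < η) (hη2 : η ≤ 1 / 2) (hx0 : 0 ≤ x) (hy0 : 0 ≤ y) (hx : G (1 - η) - G 1 ≤ x)
    (hy : G (1 - η) - G (1 - 2 * η) ≤ y) {β : ℝ} (hβ0 : 0 ≤ β) (hβ1 : β ≤ 1) :
    G β ≤ G (1 - η) + x / η + y := by
  have hβ : β ∈ Set.Icc (0 : ℝ) 1 := ⟨hβ0, hβ1⟩
  rcases le_total β (1 - η) with h | h
  · have hb : 0 < 1 - β := by linarith
    set p := η / (1 - β) with hp
    have hp0 : 0 < p := by positivity
    have hp1 : p ≤ 1 := (div_le_one hb).2 (by linarith)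
    have hc := hG.2 hβ (Set.right_mem_Icc.2 zero_le_one) hp0.le (sub_nonneg.2 hp1)
      (by ring : p + (1 - p) = 1)
    simp only [smul_eq_mul] at hc
    have e0 : p * (1 - β) = η := div_mul_cancel₀ _ hb.ne'
    have e : p * β + (1 - p) * 1 = 1 - η := by linarith
    rw [e] at hc
    have hpη : η ≤ p := by rw [hp, le_div_iff₀ hb]; nlinarith
    have h1 : (1 - p) * (G (1 - η) - G 1) ≤ x := by
      refine (mul_le_mul_of_nonneg_left hx (sub_nonneg.2 hp1)).trans ?_
      nlinarith
    have h2 : x ≤ p * (x / η) := by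
      rw [← mul_div_assoc, le_div_iff₀ hη]; nlinarith
    have h3 : p * G β ≤ p * (G (1 - η) + x / η) := by nlinarith
    linarith [le_of_mul_le_mul_left h3 hp0]
  · have hb : 0 < β - (1 - 2 * η) := by linarith
    set p := η / (β - (1 - 2 * η)) with hp
    have hp0 : 0 < p := by positivity
    have hp1 : p ≤ 1 := (div_le_one hb).2 (by linarith)
    have hp2 : 1 / 2 ≤ p := by rw [hp, div_le_div_iff₀ two_pos hb]; linarith
    have hc := hG.2 hβ (show 1 - 2 * η ∈ Set.Icc (0 : ℝ) 1 from ⟨by linarith, by linarith⟩) hp0.le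
      (sub_nonneg.2 hp1) (by ring : p + (1 - p) = 1)
    simp only [smul_eq_mul] at hc
    have e0 : p * (β - (1 - 2 * η)) = η := div_mul_cancel₀ _ hb.ne'
    have e : p * β + (1 - p) * (1 - 2 * η) = 1 - η := by linarith
    rw [e] at hc
    have h1 : (1 - p) * (G (1 - η) - G (1 - 2 * η)) ≤ (1 - p) * y :=
      mul_le_mul_of_nonneg_left hy (sub_nonneg.2 hp1)
    have h3 : p * G β ≤ p * (G (1 - η) + y) := by nlinarith
    have := le_of_mul_le_mul_left h3 hp0
    have : 0 ≤ x / η := by positivity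
    linarith

/-- Quantitative strict minimality of `α` for `r ↦ √(1 + r²) - r α / √(1 + α²)`. -/
lemma sqrt_one_add_sq_sub_ge {α r q : ℝ} (hα : 0 ≤ α) (hr : 0 ≤ r) (hrα : r ≤ 2 * α)
    (hq : 1 ≤ q) (hq2 : q ^ 2 = 1 + α ^ 2) :
    1 / q + (r - α) ^ 2 / (4 * q ^ 3) ≤ √(1 + r ^ 2) - r * (α / q) := by
  have hq0 : 0 < q := by linarith
  set s := √(1 + r ^ 2) with hs
  have hs0 : 0 < s := by positivity
  have hs2 : s ^ 2 = 1 + r ^ 2 := Real.sq_sqrt (by positivity)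
  have hs2q : s ≤ 2 * q := by
    by_contra h; push Not at h; nlinarith
  have hsq : (s * q) ^ 2 - (1 + r * α) ^ 2 = (r - α) ^ 2 := by rw [mul_pow, hs2, hq2]; ring
  have hrα0 : 0 ≤ r * α := by positivity
  have hle : 1 + r * α ≤ s * q := by
    by_contra h; push Not at h
    nlinarith [sq_nonneg (r - α), mul_pos hs0 hq0]
  have h1 : (r - α) ^ 2 ≤ (s * q - (1 + r * α)) * (4 * q ^ 2) := by
    rw [← hsq]
    have : (s * q) ^ 2 - (1 + r * α) ^ 2 = (s * q - (1 + r * α)) * (s * q + (1 + r * α)) := by ring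
    rw [this]
    refine mul_le_mul_of_nonneg_left ?_ (by linarith)
    nlinarith
  have e : 1 / q + (r - α) ^ 2 / (4 * q ^ 3) = (4 * q ^ 2 + (r - α) ^ 2) / (4 * q ^ 3) := by
    field_simp
  have e2 : s - r * (α / q) = (s * q - r * α) * (4 * q ^ 2) / (4 * q ^ 3) := by
    field_simp
  rw [e, e2]
  refine div_le_div_of_nonneg_right ?_ (by positivity)
  linarith

end RealEstimates

section GoodEvent

variable {m n : ℕ} {K : Set (Vec n)}

/-- The event on which the decoupled Gaussian vectors behave like their means, up to a relative
error `t`: the norm of `g`, its correlation with `v`, and the distances of `h`, `(1 - η) h` and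
`(1 - 2 η) h` to `K`. -/
structure IsTypical (K : Set (Vec n)) (v : Vec m) (η t : ℝ) (ξ : GordonSpace m n) : Prop where
  norm_left : |‖leftPart ξ‖ - √m| ≤ t * √m
  inner_left : |inner ℝ v (leftPart ξ)| ≤ t * √m * ‖v‖
  dist_one : |Metric.infDist ((1 : ℝ) • rightPart ξ) K - √(meanSqDist K 1)| ≤ t * √m
  dist_sub : |Metric.infDist ((1 - η) • rightPart ξ) K - √(meanSqDist K (1 - η))| ≤ t * √m
  dist_sub_two : |Metric.infDist ((1 - 2 * η) • rightPart ξ) K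
    - √(meanSqDist K (1 - 2 * η))| ≤ t * √m

lemma measure_le_ofReal_of_real_le {Ω : Type*} [MeasurableSpace Ω] {μ : Measure Ω}
    [IsFiniteMeasure μ] {S : Set Ω} {x : ℝ} (h : μ.real S ≤ x) : μ S ≤ ENNReal.ofReal x := by
  rw [← ofReal_measureReal]
  exact ENNReal.ofReal_le_ofReal h

lemma exp_neg_sq_div_le {T s : ℝ} (hs : T / 2 ≤ s) (hT : 0 ≤ T) :
    2 * Real.exp (-s ^ 2 / 5) ≤ 2 * Real.exp (-T ^ 2 / 20) := by
  have : -s ^ 2 / 5 ≤ -T ^ 2 / 20 := by nlinarith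
  linarith [Real.exp_le_exp.2 this]

lemma measure_norm_sub_sqrt_gt_le {t : ℝ} (ht : 2 * concentrationOffset ≤ t * √m) :
    stdGaussian (Vec m) {v | t * √m < |‖v‖ - √m|}
      ≤ ENNReal.ofReal (2 * Real.exp (-(t * √m) ^ 2 / 20)) := by
  have hoff : 0 ≤ concentrationOffset := by unfold concentrationOffset; positivity
  have hs : t * √m / 2 ≤ t * √m - concentrationOffset := by linarith
  refine measure_le_ofReal_of_real_le (((measureReal_mono fun v hv => ?_).trans
    (measureReal_norm_sub_sqrt_ge_le (n := m) (s := t * √m - concentrationOffset)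
      (by linarith))).trans (exp_neg_sq_div_le hs (by linarith)))
  have : t * √m < |‖v‖ - √m| := hv
  simp only [Set.mem_ofPred_eq]
  linarith

lemma measure_infDist_sub_gt_le (hne : K.Nonempty) (hK : IsClosed K) (hc : Convex ℝ K) {b T : ℝ}
    (hb : |b| ≤ 1) (hT : 2 * concentrationOffset ≤ T) :
    stdGaussian (Vec n) {h | T < |Metric.infDist (b • h) K - √(meanSqDist K b)|}
      ≤ ENNReal.ofReal (2 * Real.exp (-T ^ 2 / 20)) := by
  have hoff : 0 ≤ concentrationOffset := by unfold concentrationOffset; positivity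
  have hs : T / 2 ≤ T - concentrationOffset := by linarith
  refine measure_le_ofReal_of_real_le (((measureReal_mono fun v hv => ?_).trans
    (measureReal_infDist_sub_ge_le hne hK hc hb (s := T - concentrationOffset)
      (by linarith))).trans (exp_neg_sq_div_le hs (by linarith)))
  have : T < |Metric.infDist (b • v) K - √(meanSqDist K b)| := hv
  simp only [Set.mem_ofPred_eq]
  linarith

lemma measure_scalarPart_ge_le {T : ℝ} (hT : 0 ≤ T) :
    stdGaussian (GordonSpace m n) {ξ | T ≤ |scalarPart ξ|}
      ≤ ENNReal.ofReal (2 * Real.exp (-T ^ 2 / 20)) := by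
  refine measure_le_ofReal_of_real_le ((le_of_eq ?_).trans
    ((measureReal_abs_inner_ge_le (E := GordonSpace m n)
    (a := EuclideanSpace.single (Sum.inr (Sum.inr (Sum.inr ()))) 1) (by simp) hT).trans
      (exp_neg_sq_div_le (by linarith) hT)))
  congr 1
  ext ξ
  simp [scalarPart, EuclideanSpace.inner_single_left]

/-- Each of the five conditions fails with at most the tail probability at deviation `t √m`. -/
lemma measure_not_isTypical_le (hne : K.Nonempty) (hK : IsClosed K) (hc : Convex ℝ K) (v : Vec m)
    {η t : ℝ} (hη : 0 ≤ η) (hη2 : η ≤ 1 / 2) (ht : 2 * concentrationOffset ≤ t * √m) :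
    stdGaussian (GordonSpace m n) {ξ | ¬ IsTypical K v η t ξ}
      ≤ 5 * ENNReal.ofReal (2 * Real.exp (-(t * √m) ^ 2 / 20)) := by
  set p := ENNReal.ofReal (2 * Real.exp (-(t * √m) ^ 2 / 20))
  have hoff : 0 ≤ concentrationOffset := by unfold concentrationOffset; positivity
  have hT : 0 ≤ t * √m := by linarith
  have hleft : ∀ S : Set (Vec m), stdGaussian (GordonSpace m n) (leftPart ⁻¹' S)
      ≤ stdGaussian (Vec m) S := fun S => by
    conv_rhs => rw [← map_leftPart (m := m) (n := n)]
    exact Measure.le_map_apply measurable_leftPart.aemeasurable S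
  have hright : ∀ S : Set (Vec n), stdGaussian (GordonSpace m n) (rightPart ⁻¹' S)
      ≤ stdGaussian (Vec n) S := fun S => by
    conv_rhs => rw [← map_rightPart (m := m) (n := n)]
    exact Measure.le_map_apply measurable_rightPart.aemeasurable S
  have h1 := (hleft _).trans (measure_norm_sub_sqrt_gt_le ht)
  have h2 : stdGaussian (GordonSpace m n)
      (leftPart ⁻¹' {g | t * √m * ‖v‖ < |inner ℝ v g|}) ≤ p := by
    refine (hleft _).trans (measure_le_ofReal_of_real_le ?_)
    have hn : ‖‖v‖⁻¹ • v‖ ≤ 1 := by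
      rw [norm_smul, norm_inv, norm_norm]
      exact inv_mul_le_one
    refine ((measureReal_mono fun g hg => ?_).trans (measureReal_abs_inner_ge_le hn hT)).trans
      (exp_neg_sq_div_le (by linarith) hT)
    have hg' : t * √m * ‖v‖ < |inner ℝ v g| := hg
    have hv : v ≠ 0 := by rintro rfl; simp at hg'
    have hv0 : 0 < ‖v‖ := norm_pos_iff.2 hv
    simp only [Set.mem_ofPred_eq]
    rw [real_inner_smul_left, abs_mul, abs_of_nonneg (by positivity), inv_mul_eq_div,
      le_div_iff₀ hv0]
    exact hg'.le
  have h3 := (hright _).trans (measure_infDist_sub_gt_le hne hK hc (b := 1) (by simp) ht)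
  have h4 := (hright _).trans (measure_infDist_sub_gt_le hne hK hc (b := 1 - η)
    (by rw [abs_le]; constructor <;> linarith) ht)
  have h5 := (hright _).trans (measure_infDist_sub_gt_le hne hK hc (b := 1 - 2 * η)
    (by rw [abs_le]; constructor <;> linarith) ht)
  have hsub : {ξ : GordonSpace m n | ¬ IsTypical K v η t ξ} ⊆
      leftPart ⁻¹' {v | t * √m < |‖v‖ - √m|} ∪
      (leftPart ⁻¹' {g | t * √m * ‖v‖ < |inner ℝ v g|} ∪
      (rightPart ⁻¹' {h | t * √m < |Metric.infDist ((1 : ℝ) • h) K - √(meanSqDist K 1)|} ∪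
      (rightPart ⁻¹' {h | t * √m < |Metric.infDist ((1 - η) • h) K - √(meanSqDist K (1 - η))|} ∪
      rightPart ⁻¹' {h | t * √m < |Metric.infDist ((1 - 2 * η) • h) K
        - √(meanSqDist K (1 - 2 * η))|}))) := by
    intro ξ hξ
    by_contra hcon
    simp only [Set.mem_union, Set.mem_preimage, Set.mem_ofPred_eq, not_or, not_lt] at hcon
    exact hξ ⟨hcon.1, hcon.2.1, hcon.2.2.1, hcon.2.2.2.1, hcon.2.2.2.2⟩
  calc _ ≤ p + (p + (p + (p + p))) :=
        (measure_mono hsub).trans ((measure_union_le _ _).trans (add_le_add h1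
          ((measure_union_le _ _).trans (add_le_add h2 ((measure_union_le _ _).trans
            (add_le_add h3 ((measure_union_le _ _).trans (add_le_add h4 h5))))))))
    _ = 5 * p := by ring

end GoodEvent

/-! ### The decoupled objectives on the typical event -/

section TypicalEstimates

variable {m n : ℕ} {K : Set (Vec n)}

lemma concaveOn_scaled_objective (hne : K.Nonempty) (hK : IsClosed K) (hc : Convex ℝ K)
    (h : Vec n) (B : ℝ) {α : ℝ} (hα : 0 ≤ α) :
    ConcaveOn ℝ (Set.Icc 0 1) fun β : ℝ => β * B - α * Metric.infDist (β • h) K := by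
  refine ⟨convex_Icc _ _, fun x _ y _ p q hp hq hpq => ?_⟩
  have h1 := infDist_convex_comb_le hne hK hc hp hq hpq (x • h) (y • h)
  rw [smul_smul, smul_smul, ← add_smul] at h1
  simp only [smul_eq_mul]
  nlinarith [mul_le_mul_of_nonneg_left h1 hα]

/-- Shrinking the dual variable by the factor `1 - η` lowers the root mean square distance by at
most `η M / √D`; this is where the bound on `D + C` enters. -/
lemma sqrt_meanSqDist_one_sub_ge (hne : K.Nonempty) (hK : IsClosed K) (hc : Convex ℝ K)
    {M e η : ℝ} (hM : 0 < M) (he : 0 < e) (hη : 0 < η) (hηe : η ≤ 2 * e ^ 2)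
    (hD : e * M ≤ meanSqDist K 1)
    (hDC : meanSqDist K 1 + ∫ h, inner ℝ (h - proj h K) (proj h K) ∂(stdGaussian (Vec n))
      ≤ (1 - e) * M) :
    √(meanSqDist K 1) - η * M / √(meanSqDist K 1) ≤ √(meanSqDist K (1 - η)) := by
  have h1 := meanSqDist_one_sub_ge hne hK hc η
  set D := meanSqDist K 1
  have hD0 : 0 < D := (mul_pos he hM).trans_le hD
  have hs := Real.sqrt_pos.2 hD0
  have hs2 := Real.sq_sqrt hD0.le
  refine Real.le_sqrt_of_sq_le ?_
  have e1 : (√D - η * M / √D) ^ 2 = D - 2 * η * M + η * M * (η * M / D) := by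
    rw [sub_sq, div_pow, hs2]
    field_simp
  have h2 : η * M / D ≤ 2 * e := by
    rw [div_le_iff₀ hD0]
    nlinarith
  have h3 : η * M * (η * M / D) ≤ η * M * (2 * e) := mul_le_mul_of_nonneg_left h2 (by positivity)
  rw [e1]
  nlinarith

/-- On a typical point the decoupled dual objective exceeds its mean value `√m / √(1 + α²)` by at
most a small multiple of `√m`, uniformly in the norm `β` of the dual vector. -/
lemma IsTypical.dual_objective_le {v : Vec m} {η t : ℝ} {ξ : GordonSpace m n}
    (hξ : IsTypical K v η t ξ) (hm : 0 < m) (hne : K.Nonempty) (hK : IsClosed K)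
    (hc : Convex ℝ K) {e α q : ℝ} (he : 0 < e) (hη : 0 < η) (hη2 : η ≤ 1 / 2)
    (hηe : η ≤ 2 * e ^ 2) (hD : e * m ≤ meanSqDist K 1)
    (hDC : meanSqDist K 1 + ∫ h, inner ℝ (h - proj h K) (proj h K) ∂(stdGaussian (Vec n))
      ≤ (1 - e) * m)
    (hα : 0 < α) (hq : 1 ≤ q) (hq2 : q ^ 2 = 1 + α ^ 2)
    (hDα : √(meanSqDist K 1) = √m * (α / q)) (ht0 : 0 ≤ t) (ht1 : t ≤ 1)
    (hv : |‖v‖ - √m| ≤ t * √m) {β : ℝ} (hβ0 : 0 ≤ β) (hβ1 : β ≤ 1) :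
    β * ‖v + α • leftPart ξ‖ - α * Metric.infDist (β • rightPart ξ) K
      ≤ √m * (1 / q + (η * q + (3 + 2 / η) * (6 * t * (1 + α)))) := by
  have hM : (0 : ℝ) < m := by exact_mod_cast hm
  have ha : 0 < √(m : ℝ) := Real.sqrt_pos.2 hM
  have ha2 := Real.sq_sqrt hM.le
  have hq0 : 0 < q := by linarith
  have hqs : √(1 + α ^ 2) = q := by rw [← hq2, Real.sqrt_sq hq0.le]
  have hlow := sqrt_meanSqDist_one_sub_ge hne hK hc hM he hη hηe hD hDC
  have hmono := Real.sqrt_le_sqrt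
    (meanSqDist_mono hne hK hc (by linarith : (0 : ℝ) ≤ 1 - 2 * η)
      (by linarith : 1 - 2 * η ≤ 1 - η))
  have hnorm := abs_norm_add_smul_sub_le ha ht0 ht1 hv hξ.norm_left hξ.inner_left α
  rw [hqs, abs_of_pos hα] at hnorm
  set a := √(m : ℝ)
  set B := ‖v + α • leftPart ξ‖
  set G : ℝ → ℝ := fun β => β * B - α * Metric.infDist (β • rightPart ξ) K with hG
  set E := 6 * t * (1 + α) * a with hE
  have hE0 : 0 ≤ E := by positivity
  -- the deviation of `G` from its mean at a single scale
  have hdev : ∀ b d : ℝ, 0 ≤ b → b ≤ 1 → |Metric.infDist (b • rightPart ξ) K - d| ≤ t * a →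
      |G b - (b * (a * q) - α * d)| ≤ E := by
    intro b d hb0 hb1 hd
    have e1 : G b - (b * (a * q) - α * d)
        = b * (B - a * q) - α * (Metric.infDist (b • rightPart ξ) K - d) := by
      simp only [hG]; ring
    rw [e1]
    refine (abs_sub _ _).trans ?_
    rw [abs_mul, abs_mul, abs_of_nonneg hb0, abs_of_pos hα]
    have h1 : b * |B - a * q| ≤ 1 * (5 * t * (1 + α) * a) :=
      mul_le_mul hb1 hnorm (abs_nonneg _) zero_le_one
    have h2 := mul_le_mul_of_nonneg_left hd hα.le
    have : 0 ≤ t * a := by positivity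
    rw [hE]
    nlinarith
  have g1 := abs_le.1 (hdev 1 _ zero_le_one le_rfl hξ.dist_one)
  have g2 := abs_le.1 (hdev (1 - η) _ (by linarith) (by linarith) hξ.dist_sub)
  have g3 := abs_le.1 (hdev (1 - 2 * η) _ (by linarith) (by linarith) hξ.dist_sub_two)
  set d1 := √(meanSqDist K (1 - η))
  set d2 := √(meanSqDist K (1 - 2 * η))
  rw [hDα] at g1 hlow
  have hα2 : α * (α / q) = q - 1 / q := by
    field_simp; linarith
  have hmean : 1 * (a * q) - α * (a * (α / q)) = a * (1 / q) := by
    have : α * (a * (α / q)) = a * (α * (α / q)) := by ring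
    rw [this, hα2]; ring
  have hMa : η * (m : ℝ) / (a * (α / q)) = η * a * q / α := by
    rw [← ha2]; field_simp
  rw [hMa] at hlow
  have hmean2 : (1 - η) * (a * q) - α * d1 ≤ a * (1 / q) := by
    have h1 := mul_le_mul_of_nonneg_left hlow hα.le
    have h2 : α * (a * (α / q) - η * a * q / α) = a * (α * (α / q)) - η * a * q := by
      field_simp
    rw [h2, hα2] at h1
    linarith
  have hmono' := mul_le_mul_of_nonneg_left hmono hα.le
  have hfin := concaveOn_le_of_three_points
    (concaveOn_scaled_objective hne hK hc (rightPart ξ) B hα.le) hη hη2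
    (x := 2 * E) (y := η * (a * q) + 2 * E) (by positivity) (by positivity)
    (by change G (1 - η) - G 1 ≤ _; linarith)
    (by change G (1 - η) - G (1 - 2 * η) ≤ _; linarith) hβ0 hβ1
  change G β ≤ G (1 - η) + 2 * E / η + (η * (a * q) + 2 * E) at hfin
  change G β ≤ _
  have e2 : a * (1 / q + (η * q + (3 + 2 / η) * (6 * t * (1 + α))))
      = a * (1 / q) + η * (a * q) + 3 * E + 2 * E / η := by
    rw [hE]; ring
  rw [e2]
  linarith

/-- On a typical point the decoupled objective at a vector of norm `r` is at least its mean value,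
which exceeds `√m / √(1 + α²)` by a multiple of `√m (r - α)²`, up to a small multiple of `√m`. -/
lemma IsTypical.le_objective {v : Vec m} {η t : ℝ} {ξ : GordonSpace m n}
    (hξ : IsTypical K v η t ξ) (hm : 0 < m) {α q : ℝ} (hα : 0 < α) (hq : 1 ≤ q)
    (hq2 : q ^ 2 = 1 + α ^ 2) (hDα : √(meanSqDist K 1) = √m * (α / q)) (ht0 : 0 ≤ t) (ht1 : t ≤ 1)
    (hv : |‖v‖ - √m| ≤ t * √m) {r : ℝ} (hr0 : 0 ≤ r) (hr : r ≤ 2 * α) :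
    √m * (1 / q + (r - α) ^ 2 / (4 * q ^ 3) - 6 * t * (1 + r))
      ≤ ‖v - r • leftPart ξ‖ - r * Metric.infDist (rightPart ξ) K := by
  have ha : 0 < √(m : ℝ) := Real.sqrt_pos.2 (by exact_mod_cast hm)
  have hnorm := abs_norm_add_smul_sub_le ha ht0 ht1 hv hξ.norm_left hξ.inner_left (-r)
  rw [abs_neg, abs_of_nonneg hr0, neg_sq, neg_smul, ← sub_eq_add_neg] at hnorm
  have hgap := sqrt_one_add_sq_sub_ge hα.le hr0 hr hq hq2
  have hd := hξ.dist_one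
  rw [one_smul, hDα] at hd
  set a := √(m : ℝ)
  have h1 := (abs_le.1 hnorm).1
  have h2 := mul_le_mul_of_nonneg_left (abs_le.1 hd).2 hr0
  have h3 := mul_le_mul_of_nonneg_left hgap ha.le
  have : 0 ≤ t * a := by positivity
  nlinarith

end TypicalEstimates

/-! ### Localization and the rescaled objective -/

section Localization

variable {m n : ℕ}

/-- If a convex function is below `c` somewhere inside the sphere of radius `rp`, and at least `c`
on that sphere and on the ball of radius `rm`, then it has a minimizer, and every minimizer lies
strictly between the two radii. -/
lemma exists_minimizer_and_norm_mem {obj : Vec n → ℝ} (hconv : ConvexOn ℝ Set.univ obj)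
    (hcont : Continuous obj) {rm rp c : ℝ} {w₀ : Vec n} (hw₀ : ‖w₀‖ ≤ rp) (hc : obj w₀ < c)
    (hrm : ∀ w, ‖w‖ ≤ rm → c ≤ obj w) (hrp : ∀ w, ‖w‖ = rp → c ≤ obj w) :
    (∃ w, ∀ w', obj w ≤ obj w') ∧
      ∀ w, (∀ w', obj w ≤ obj w') → rm < ‖w‖ ∧ ‖w‖ < rp := by
  have hout : ∀ w, rp ≤ ‖w‖ → obj w₀ < obj w := by
    intro w hw
    by_contra hcon
    push Not at hcon
    -- the segment from `w₀` to `w` crosses the sphere of radius `rp`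
    have hcl : Continuous fun s : ℝ => ‖(1 - s) • w₀ + s • w‖ := by fun_prop
    obtain ⟨s, hs, hsn⟩ := intermediate_value_Icc (zero_le_one' ℝ) hcl.continuousOn
      (show rp ∈ _ by simpa using ⟨hw₀, hw⟩)
    have h1 := hconv.2 (Set.mem_univ w₀) (Set.mem_univ w) (sub_nonneg.2 hs.2) hs.1
      (by ring : 1 - s + s = 1)
    simp only [smul_eq_mul] at h1
    have h2 := hrp _ hsn
    nlinarith [mul_le_mul_of_nonneg_left hcon hs.1]
  obtain ⟨x, hx, hmin⟩ := (isCompact_closedBall (0 : Vec n) rp).exists_isMinOn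
    ⟨w₀, by simpa using hw₀⟩ hcont.continuousOn
  refine ⟨⟨x, fun w' => ?_⟩, fun w hw => ⟨?_, ?_⟩⟩
  · rcases le_total ‖w'‖ rp with h | h
    · exact hmin (by simpa using h)
    · exact (hmin (show w₀ ∈ Metric.closedBall (0 : Vec n) rp by simpa using hw₀)).trans
        (hout w' h).le
  · by_contra h
    exact absurd (hw w₀) (not_le.2 (hc.trans_le (hrm w (not_lt.1 h))))
  · by_contra h
    exact absurd (hw w₀) (not_le.2 (hout w (not_lt.1 h)))

/-- The increment of the `ℓ₂`-LASSO objective from `x₀` to `x₀ + σ w`, divided by `σ`, up to an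
additive constant. -/
def scaledObjective (f : Vec n → ℝ) (x₀ : Vec n) (lam σ : ℝ) (A : Matrix (Fin m) (Fin n) ℝ)
    (v : Vec m) (w : Vec n) : ℝ :=
  ‖v - A.toEuclideanLin w‖ + lam / σ * (f (x₀ + σ • w) - f x₀)

variable {f : Vec n → ℝ} {x₀ : Vec n} {lam σ : ℝ}

lemma objective_eq_scaledObjective (hσ : 0 < σ) (A : Matrix (Fin m) (Fin n) ℝ) (v : Vec m)
    (w : Vec n) :
    ‖observation A v x₀ σ - A.toEuclideanLin (x₀ + σ • w)‖ + lam * f (x₀ + σ • w)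
      = σ * scaledObjective f x₀ lam σ A v w + lam * f x₀ := by
  have e : observation A v x₀ σ - A.toEuclideanLin (x₀ + σ • w)
      = σ • (v - A.toEuclideanLin w) := by
    rw [observation, map_add, map_smul, smul_sub]; abel
  rw [e, norm_smul, Real.norm_of_nonneg hσ.le, scaledObjective]
  field_simp
  ring

/-- Solutions `x₀ + σ w` of the `ℓ₂`-LASSO correspond to minimizers `w` of the rescaled
objective. -/
lemma isSolution_iff (hσ : 0 < σ) (A : Matrix (Fin m) (Fin n) ℝ) (v : Vec m) (w : Vec n) :
    IsSolution f lam A (observation A v x₀ σ) (x₀ + σ • w) ↔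
      ∀ w', scaledObjective f x₀ lam σ A v w ≤ scaledObjective f x₀ lam σ A v w' := by
  constructor
  · intro h w'
    have := h (x₀ + σ • w')
    rw [objective_eq_scaledObjective hσ, objective_eq_scaledObjective hσ] at this
    exact le_of_mul_le_mul_left (by linarith) hσ
  · intro h x'
    have e : x' = x₀ + σ • (σ⁻¹ • (x' - x₀)) := by
      rw [smul_smul, mul_inv_cancel₀ hσ.ne', one_smul]; abel
    rw [e, objective_eq_scaledObjective hσ, objective_eq_scaledObjective hσ]
    have := mul_le_mul_of_nonneg_left (h (σ⁻¹ • (x' - x₀))) hσ.le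
    linarith

lemma continuous_scaledObjective (hf : Continuous f) (A : Matrix (Fin m) (Fin n) ℝ) (v : Vec m) :
    Continuous (scaledObjective f x₀ lam σ A v) := by
  have := continuous_toEuclideanLin A
  unfold scaledObjective
  fun_prop

lemma convexOn_scaledObjective (hf : ConvexOn ℝ Set.univ f) (hlam : 0 ≤ lam) (hσ : 0 < σ)
    (A : Matrix (Fin m) (Fin n) ℝ) (v : Vec m) :
    ConvexOn ℝ Set.univ (scaledObjective f x₀ lam σ A v) := by
  refine ⟨convex_univ, fun a _ b _ p q hp hq hpq => ?_⟩
  have hq' : q = 1 - p := by linarith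
  have e1 : v - A.toEuclideanLin (p • a + q • b)
      = p • (v - A.toEuclideanLin a) + q • (v - A.toEuclideanLin b) := by
    rw [map_add, map_smul, map_smul, hq']; module
  have e2 : x₀ + σ • (p • a + q • b) = p • (x₀ + σ • a) + q • (x₀ + σ • b) := by
    rw [hq']; module
  have h1 : ‖v - A.toEuclideanLin (p • a + q • b)‖
      ≤ p * ‖v - A.toEuclideanLin a‖ + q * ‖v - A.toEuclideanLin b‖ := by
    rw [e1]
    refine (norm_add_le _ _).trans ?_
    rw [norm_smul, norm_smul, Real.norm_of_nonneg hp, Real.norm_of_nonneg hq]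
  have h2 := hf.2 (Set.mem_univ (x₀ + σ • a)) (Set.mem_univ (x₀ + σ • b)) hp hq hpq
  rw [← e2] at h2
  simp only [smul_eq_mul] at h2
  have hr : 0 ≤ lam / σ := by positivity
  have h3 := mul_le_mul_of_nonneg_left h2 hr
  simp only [scaledObjective, smul_eq_mul]
  have e3 : f x₀ = p * f x₀ + q * f x₀ := by rw [← add_mul, hpq, one_mul]
  nlinarith

lemma isCompact_smul_subdifferential (hf : Continuous f) (x₀ : Vec n) (lam : ℝ) :
    IsCompact (lam • subdifferential f x₀) := (isCompact_subdifferential hf x₀).smul lam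

/-- The first-order approximation of `f` at `x₀`, whose increment is the support function of the
subdifferential, bounds the rescaled objective from below for every `σ`. -/
lemma le_scaledObjective (hc : ConvexOn ℝ Set.univ f) (hf : Continuous f) (hlam : 0 ≤ lam)
    (hσ : 0 < σ) (A : Matrix (Fin m) (Fin n) ℝ) (v : Vec m) (w : Vec n) :
    ‖v - A.toEuclideanLin w‖ + supportFun (lam • subdifferential f x₀) w
      ≤ scaledObjective f x₀ lam σ A v w := by
  refine add_le_add le_rfl (supportFun_le ((subdifferential_nonempty hc hf x₀).smul_set) ?_)
  rintro _ ⟨s, hs, rfl⟩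
  have h := hs (x₀ + σ • w)
  rw [add_sub_cancel_left, inner_smul_right] at h
  simp only [real_inner_smul_left]
  have h2 : inner ℝ s w ≤ (f (x₀ + σ • w) - f x₀) / σ := by
    rw [le_div_iff₀ hσ]; linarith
  calc lam * inner ℝ s w ≤ lam * ((f (x₀ + σ • w) - f x₀) / σ) :=
        mul_le_mul_of_nonneg_left h2 hlam
    _ = _ := by ring

/-- On bounded sets the first-order approximation is accurate once `σ` is small, at a threshold
independent of `A` and `v`. -/
lemma exists_scaledObjective_le (hc : ConvexOn ℝ Set.univ f) (hf : Continuous f) (x₀ : Vec n)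
    (hlam : 0 ≤ lam) {δ : ℝ} (hδ : 0 < δ) :
    ∃ r > 0, ∀ σ : ℝ, 0 < σ → ∀ (A : Matrix (Fin m) (Fin n) ℝ) (v : Vec m) (w : Vec n),
      σ * ‖w‖ ≤ r → scaledObjective f x₀ lam σ A v w
        ≤ ‖v - A.toEuclideanLin w‖ + supportFun (lam • subdifferential f x₀) w
          + lam * δ * ‖w‖ := by
  obtain ⟨r, hr, h⟩ := exists_sub_le_inner_add hc hf x₀ hδ
  refine ⟨r, hr, fun σ hσ A v w hw => ?_⟩
  obtain ⟨s, hs, hle⟩ := h (σ • w) (by rwa [norm_smul, Real.norm_of_nonneg hσ.le])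
  rw [norm_smul, Real.norm_of_nonneg hσ.le, inner_smul_right] at hle
  have h1 := inner_le_supportFun (isCompact_smul_subdifferential hf x₀ lam)
    (Set.smul_mem_smul_set hs : lam • s ∈ lam • subdifferential f x₀) w
  rw [real_inner_smul_left] at h1
  have h2 := mul_le_mul_of_nonneg_left hle (by positivity : 0 ≤ lam / σ)
  have e : lam / σ * (σ * inner ℝ s w + δ * (σ * ‖w‖)) = lam * inner ℝ s w + lam * δ * ‖w‖ := by
    field_simp
  rw [e] at h2
  simp only [scaledObjective]
  linarith

end Localization

section Radii

/-- The facts about the predicted error `α = √(D / (M - D))` used below. -/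
lemma predicted_error_facts {e D M : ℝ} (he : 0 < e) (hM : 0 < M) (hD : e * M ≤ D)
    (hD2 : D ≤ (1 - e) * M) {α q : ℝ} (hα : α = √(D / (M - D))) (hq : q = √(1 + α ^ 2)) :
    0 < α ∧ α ^ 2 = D / (M - D) ∧ e ≤ α ^ 2 ∧ 1 ≤ q ∧ q ^ 2 = 1 + α ^ 2 ∧ α ≤ 1 / e ∧ q ≤ 1 / e ∧
      √D = √M * (α / q) := by
  have heM : 0 < e * M := mul_pos he hM
  have hD0 : 0 < D := heM.trans_le hD
  have hMD : 0 < M - D := by nlinarith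
  have hα0 : 0 < α := by rw [hα]; positivity
  have hα2 : α ^ 2 = D / (M - D) := by rw [hα]; exact Real.sq_sqrt (by positivity)
  have hq2 : q ^ 2 = 1 + α ^ 2 := by rw [hq]; exact Real.sq_sqrt (by positivity)
  have hq1 : 1 ≤ q := by
    rw [hq]; exact Real.one_le_sqrt.2 (by nlinarith [sq_nonneg α])
  have hqM : q ^ 2 = M / (M - D) := by rw [hq2, hα2]; field_simp; ring
  have hqe : q ^ 2 ≤ 1 / e := by
    rw [hqM, div_le_div_iff₀ hMD he]; nlinarith
  have hqe' : q ≤ 1 / e := by nlinarith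
  have hαq : α ≤ q := by nlinarith
  refine ⟨hα0, hα2, ?_, hq1, hq2, hαq.trans hqe', hqe', ?_⟩
  · rw [hα2, le_div_iff₀ hMD]; nlinarith
  · have hq0 : 0 < q := by linarith
    rw [Real.sqrt_eq_iff_eq_sq hD0.le (by positivity), mul_pow, div_pow, Real.sq_sqrt hM.le, hqM,
      hα2]
    field_simp

lemma sq_sub_ge_of_outside {α x r : ℝ} (hα : 0 < α) (hx0 : 0 < x) (hx1 : x ≤ 1 / 2)
    (hr : r ≤ α * √(1 - x) ∨ r = α * √(1 + x)) :
    α ^ 2 * x ^ 2 / 9 ≤ (r - α) ^ 2 := by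
  have e : α ^ 2 * x ^ 2 / 9 = (α * (x / 3)) ^ 2 := by ring
  rw [e]
  rcases hr with hr | hr
  · have h1 : √(1 - x) ≤ 1 - x / 3 := Real.sqrt_le_iff.2 ⟨by linarith, by nlinarith⟩
    have h2 : α * √(1 - x) ≤ α * (1 - x / 3) := mul_le_mul_of_nonneg_left h1 hα.le
    rw [← sq_abs (r - α)]
    refine pow_le_pow_left₀ (by positivity) ?_ 2
    rw [abs_of_nonpos (by nlinarith)]
    linarith
  · have h1 : 1 + x / 3 ≤ √(1 + x) := Real.le_sqrt_of_sq_le (by nlinarith)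
    have h2 : α * (1 + x / 3) ≤ α * √(1 + x) := mul_le_mul_of_nonneg_left h1 hα.le
    refine pow_le_pow_left₀ (by positivity) ?_ 2
    rw [hr]; linarith

end Radii

/-! ### Probability bounds for a fixed noise vector -/

section FixedNoise

variable {m n : ℕ} {K : Set (Vec n)} {v : Vec m} {α q t : ℝ}

/-- An upper bound for the probability that the first-order objective exceeds its predicted
minimum `√m / q` by `√m s` throughout the ball of radius `α`. -/
lemma measure_forall_le_objective_le_exp (hm : 0 < m) (hn : 0 < n) (hne : K.Nonempty)
    (hK : IsCompact K) (hc : Convex ℝ K) {e η s : ℝ} (he : 0 < e) (hη : 0 < η) (hη2 : η ≤ 1 / 2)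
    (hηe : η ≤ 2 * e ^ 2) (hD : e * m ≤ meanSqDist K 1)
    (hDC : meanSqDist K 1 + ∫ h, inner ℝ (h - proj h K) (proj h K) ∂(stdGaussian (Vec n))
      ≤ (1 - e) * m)
    (hα : 0 < α) (hq : 1 ≤ q) (hq2 : q ^ 2 = 1 + α ^ 2)
    (hDα : √(meanSqDist K 1) = √m * (α / q)) (ht0 : 0 < t) (ht1 : t ≤ 1)
    (ht : 2 * concentrationOffset ≤ t * √m) (hv : |‖v‖ - √m| ≤ t * √m)
    (hs : η * q + (3 + 2 / η) * (6 * t * (1 + α)) + t * (1 + α) < s) :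
    (Measure.pi fun _ : Fin m => Measure.pi fun _ : Fin n => gaussianReal 0 1)
        {A | ∀ w, ‖w‖ ≤ α →
          √m * (1 / q + s) ≤ ‖v - (Matrix.of A).toEuclideanLin w‖ + supportFun K w}
      ≤ 6 * ENNReal.ofReal (2 * Real.exp (-(t * √m) ^ 2 / 20)) := by
  have ha : 0 < √(m : ℝ) := Real.sqrt_pos.2 (by exact_mod_cast hm)
  have hta : 0 < t * √(m : ℝ) := mul_pos ht0 ha
  have h1 := measure_forall_le_objective_le (m := m) hn hne hK hc v hα.le (√m * (1 / q + s))
    (τ := t * √m) (half_pos hta)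
  refine h1.trans ?_
  have h2 : (6 : ENNReal) = 1 + 5 := by norm_num
  rw [h2, add_mul, one_mul]
  refine add_le_add (measure_scalarPart_ge_le hta.le) ((measure_mono ?_).trans
    (measure_not_isTypical_le hne hK.isClosed hc v hη.le hη2 ht))
  rintro ξ ⟨β, hβ0, hβ1, hle⟩ hξ
  have h3 := hle.trans (hξ.dual_objective_le hm hne hK.isClosed hc he hη hη2 hηe hD hDC hα hq hq2
    hDα ht0.le ht1 hv hβ0 hβ1)
  have h4 := mul_lt_mul_of_pos_left hs ha
  nlinarith

/-- An upper bound for the probability that the first-order objective falls below `√m (1/q + κ)`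
by `√m s` at a point whose norm is well separated from `α`. -/
lemma measure_exists_objective_lt_le_exp (hm : 0 < m) (hne : K.Nonempty) (hK : IsCompact K)
    (hc : Convex ℝ K) {κ s : ℝ} {W : Set (Vec n)} (hW : W.Nonempty)
    (hW2 : ∀ w ∈ W, ‖w‖ ≤ 2 * α) (hWκ : ∀ w ∈ W, κ ≤ (‖w‖ - α) ^ 2 / (4 * q ^ 3))
    (hα : 0 < α) (hq : 1 ≤ q) (hq2 : q ^ 2 = 1 + α ^ 2)
    (hDα : √(meanSqDist K 1) = √m * (α / q)) (ht0 : 0 < t) (ht1 : t ≤ 1)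
    (ht : 2 * concentrationOffset ≤ t * √m) (hv : |‖v‖ - √m| ≤ t * √m)
    (hs : 6 * t * (1 + 2 * α) + t * (1 + 2 * α) < s) :
    (Measure.pi fun _ : Fin m => Measure.pi fun _ : Fin n => gaussianReal 0 1)
        {A | ∃ w ∈ W,
          ‖v - (Matrix.of A).toEuclideanLin w‖ + supportFun K w < √m * (1 / q + κ - s)}
      ≤ 6 * ENNReal.ofReal (2 * Real.exp (-(t * √m) ^ 2 / 20)) := by
  have ha : 0 < √(m : ℝ) := Real.sqrt_pos.2 (by exact_mod_cast hm)
  have hta : 0 < t * √(m : ℝ) := mul_pos ht0 ha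
  refine (measure_exists_objective_lt_le hm hne hK v hW hW2 (√m * (1 / q + κ - s))
    hta hta.le).trans ?_
  have h2 : (6 : ENNReal) = 1 + 5 := by norm_num
  rw [h2, add_mul, one_mul]
  -- only the distance of `h` itself enters here, so `η = 0` is enough
  refine add_le_add (measure_scalarPart_ge_le hta.le) ((measure_mono ?_).trans
    (measure_not_isTypical_le (η := 0) hne hK.isClosed hc v le_rfl (by norm_num) ht))
  rintro ξ ⟨w, hw, hle⟩ hξ
  have h3 := (hξ.le_objective hm hα hq hq2 hDα ht0.le ht1 hv (norm_nonneg w) (hW2 w hw)).trans hle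
  have h4 := mul_lt_mul_of_pos_left hs ha
  have h5 := mul_le_mul_of_nonneg_left (hWκ w hw) ha.le
  have h6 := mul_le_mul_of_nonneg_left (hW2 w hw) hta.le
  nlinarith

end FixedNoise

section Model

variable {m n : ℕ}

instance : IsProbabilityMeasure (modelLaw m n) := by unfold modelLaw; infer_instance

/-- A bound on sections over typical noise, together with the concentration of the noise norm,
bounds the probability of an event under the joint law. -/
lemma modelLaw_le_of_sections {B : Set ((Fin m → Fin n → ℝ) × Vec m)} (hB : MeasurableSet B)
    {t : ℝ} {p : ENNReal}
    (h : ∀ v : Vec m, |‖v‖ - √m| ≤ t * √m →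
      (Measure.pi fun _ : Fin m => Measure.pi fun _ : Fin n => gaussianReal 0 1)
        ((fun A => (A, v)) ⁻¹' B) ≤ p) :
    modelLaw m n (B ∩ {ω | |‖ω.2‖ - √m| ≤ t * √m}) ≤ p := by
  have hV : MeasurableSet {ω : (Fin m → Fin n → ℝ) × Vec m | |‖ω.2‖ - √m| ≤ t * √m} :=
    (isClosed_le (by fun_prop) continuous_const).measurableSet
  rw [modelLaw, Measure.prod_apply_symm (hB.inter hV)]
  calc _ ≤ ∫⁻ _, p ∂(stdGaussian (Vec m)) := lintegral_mono fun v => ?_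
    _ = p := by simp
  by_cases hv : |‖v‖ - √m| ≤ t * √m
  · exact (measure_mono (Set.preimage_mono Set.inter_subset_left)).trans (h v hv)
  · have e : (fun A => (A, v)) ⁻¹'
        (B ∩ {ω : (Fin m → Fin n → ℝ) × Vec m | |‖ω.2‖ - √m| ≤ t * √m}) = ∅ := by
      ext A; simp [hv]
    rw [e]; simp

lemma continuous_objective_model (K : Set (Vec n)) (w : Vec n) :
    Continuous fun ω : (Fin m → Fin n → ℝ) × Vec m =>
      ‖ω.2 - (Matrix.of ω.1).toEuclideanLin w‖ + supportFun K w := by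
  simp only [Matrix.toLpLin_apply]
  have : Continuous fun ω : (Fin m → Fin n → ℝ) × Vec m => (Matrix.of ω.1).mulVec w.ofLp :=
    Continuous.matrix_mulVec (A := fun ω : (Fin m → Fin n → ℝ) × Vec m => Matrix.of ω.1)
      continuous_fst continuous_const
  fun_prop

end Model

/-! ### The localization event -/

section Assembly

variable {m n : ℕ}

/-- The error vectors excluded by the estimate: those of norm at most `α √(1 - x)` and those of
norm exactly `α √(1 + x)`. By convexity of the objective, larger vectors need no separate
treatment. -/
def excludedErrors (n : ℕ) (α x : ℝ) : Set (Vec n) :=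
  {w | ‖w‖ ≤ α * √(1 - x) ∨ ‖w‖ = α * √(1 + x)}

/-- The objective is at least `c₂` at every excluded error and below `c₁` somewhere in the ball of
radius `α`. -/
def localizationEvent (m : ℕ) (K : Set (Vec n)) (α x c₁ c₂ : ℝ) :
    Set ((Fin m → Fin n → ℝ) × Vec m) :=
  {ω | (∃ w, ‖w‖ ≤ α ∧ ‖ω.2 - (Matrix.of ω.1).toEuclideanLin w‖ + supportFun K w < c₁) ∧
    ∀ w ∈ excludedErrors n α x, c₂ ≤ ‖ω.2 - (Matrix.of ω.1).toEuclideanLin w‖ + supportFun K w}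

lemma zero_mem_excludedErrors {α x : ℝ} (hα : 0 ≤ α) : (0 : Vec n) ∈ excludedErrors n α x :=
  Or.inl (by rw [norm_zero]; positivity)

lemma norm_le_of_mem_excludedErrors {α x : ℝ} (hα : 0 < α) (hx0 : 0 < x) (hx1 : x ≤ 1 / 2)
    {w : Vec n} (hw : w ∈ excludedErrors n α x) : ‖w‖ ≤ 2 * α := by
  have h1 : √(1 + x) ≤ 2 := Real.sqrt_le_iff.2 ⟨by norm_num, by linarith⟩
  have h2 : √(1 - x) ≤ 2 := Real.sqrt_le_iff.2 ⟨by norm_num, by linarith⟩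
  rw [mul_comm]
  rcases hw with hw | hw
  · exact hw.trans (mul_le_mul_of_nonneg_left h2 hα.le)
  · exact hw.le.trans (mul_le_mul_of_nonneg_left h1 hα.le)

lemma sq_sub_div_ge_of_mem_excludedErrors {α x q : ℝ} (hα : 0 < α) (hx0 : 0 < x) (hx1 : x ≤ 1 / 2)
    (hq : 1 ≤ q) {w : Vec n} (hw : w ∈ excludedErrors n α x) :
    α ^ 2 * x ^ 2 / 9 / (4 * q ^ 3) ≤ (‖w‖ - α) ^ 2 / (4 * q ^ 3) := by
  have := sq_sub_ge_of_outside hα hx0 hx1 hw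
  gcongr

lemma isOpen_exists_objective_lt (K W : Set (Vec n)) (c : ℝ) :
    IsOpen {ω : (Fin m → Fin n → ℝ) × Vec m |
      ∃ w ∈ W, ‖ω.2 - (Matrix.of ω.1).toEuclideanLin w‖ + supportFun K w < c} := by
  have e : {ω : (Fin m → Fin n → ℝ) × Vec m |
      ∃ w ∈ W, ‖ω.2 - (Matrix.of ω.1).toEuclideanLin w‖ + supportFun K w < c}
      = ⋃ w ∈ W, {ω : (Fin m → Fin n → ℝ) × Vec m |
        ‖ω.2 - (Matrix.of ω.1).toEuclideanLin w‖ + supportFun K w < c} := by ext; simp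
  rw [e]
  exact isOpen_biUnion fun w _ => isOpen_lt (continuous_objective_model K w) continuous_const

lemma localizationEvent_eq (K : Set (Vec n)) (α x c₁ c₂ : ℝ) :
    localizationEvent m K α x c₁ c₂
      = {ω | ∃ w ∈ Metric.closedBall (0 : Vec n) α,
          ‖ω.2 - (Matrix.of ω.1).toEuclideanLin w‖ + supportFun K w < c₁} \
        {ω | ∃ w ∈ excludedErrors n α x,
          ‖ω.2 - (Matrix.of ω.1).toEuclideanLin w‖ + supportFun K w < c₂} := by
  ext ω
  simp [localizationEvent]

lemma measurableSet_localizationEvent (K : Set (Vec n)) (α x c₁ c₂ : ℝ) :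
    MeasurableSet (localizationEvent m K α x c₁ c₂) := by
  rw [localizationEvent_eq]
  exact (isOpen_exists_objective_lt _ _ _).measurableSet.diff
    (isOpen_exists_objective_lt _ _ _).measurableSet

/-- A bound for the failure probability of the localization event, from the bounds for a fixed
noise vector of typical norm. -/
lemma modelLaw_compl_localizationEvent_le (K : Set (Vec n)) {α x c₁ c₂ t : ℝ}
    (ht : 2 * concentrationOffset ≤ t * √m) {p : ENNReal}
    (h₁ : ∀ v : Vec m, |‖v‖ - √m| ≤ t * √m →
      (Measure.pi fun _ : Fin m => Measure.pi fun _ : Fin n => gaussianReal 0 1)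
        {A | ∀ w, ‖w‖ ≤ α → c₁ ≤ ‖v - (Matrix.of A).toEuclideanLin w‖ + supportFun K w} ≤ p)
    (h₂ : ∀ v : Vec m, |‖v‖ - √m| ≤ t * √m →
      (Measure.pi fun _ : Fin m => Measure.pi fun _ : Fin n => gaussianReal 0 1)
        {A | ∃ w ∈ excludedErrors n α x,
          ‖v - (Matrix.of A).toEuclideanLin w‖ + supportFun K w < c₂} ≤ p) :
    modelLaw m n (localizationEvent m K α x c₁ c₂)ᶜ
      ≤ (p + p) + ENNReal.ofReal (2 * Real.exp (-(t * √m) ^ 2 / 20)) := by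
  have hV : MeasurableSet {v : Vec m | t * √m < |‖v‖ - √m|} :=
    (isOpen_lt continuous_const (by fun_prop)).measurableSet
  refine (measure_le_add_of_subset_union
    (T := (localizationEvent m K α x c₁ c₂)ᶜ ∩ {ω | |‖ω.2‖ - √m| ≤ t * √m})
    (U := Set.univ ×ˢ {v : Vec m | t * √m < |‖v‖ - √m|}) fun ω hω => ?_).trans
    (add_le_add (modelLaw_le_of_sections (measurableSet_localizationEvent K α x c₁ c₂).compl
      fun v hv => (measure_le_add_of_subset_union ?_).trans (add_le_add (h₁ v hv) (h₂ v hv))) ?_)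
  · rcases le_or_gt |‖ω.2‖ - √m| (t * √m) with h | h
    · exact Or.inl ⟨hω, h⟩
    · exact Or.inr ⟨Set.mem_univ _, h⟩
  · intro A hA
    simp only [localizationEvent, Set.mem_preimage, Set.mem_compl_iff, Set.mem_ofPred_eq,
      Set.mem_union] at hA ⊢
    by_contra! hcon
    exact hA hcon
  · rw [modelLaw, Measure.prod_prod]
    simpa using measure_norm_sub_sqrt_gt_le ht

/-- On the localization event, for small noise every solution of the `ℓ₂`-LASSO has normalized
squared error within relative distance `x` of `α²`. -/
lemma solution_of_mem_localizationEvent {f : Vec n → ℝ} {x₀ : Vec n} {lam σ : ℝ}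
    (hc : ConvexOn ℝ Set.univ f) (hf : Continuous f) (hlam : 0 ≤ lam) (hσ : 0 < σ)
    {α x c₁ c₂ : ℝ} (hα : 0 < α) (hx0 : 0 < x) (hx1 : x ≤ 1)
    {ω : (Fin m → Fin n → ℝ) × Vec m}
    (hω : ω ∈ localizationEvent m (lam • subdifferential f x₀) α x c₁ c₂)
    (happrox : ∀ w : Vec n, ‖w‖ ≤ α → scaledObjective f x₀ lam σ (Matrix.of ω.1) ω.2 w
      ≤ ‖ω.2 - (Matrix.of ω.1).toEuclideanLin w‖ + supportFun (lam • subdifferential f x₀) w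
        + (c₂ - c₁)) :
    (∃ z, IsSolution f lam (Matrix.of ω.1) (observation (Matrix.of ω.1) ω.2 x₀ σ) z) ∧
      ∀ z, IsSolution f lam (Matrix.of ω.1) (observation (Matrix.of ω.1) ω.2 x₀ σ) z →
        |‖z - x₀‖ ^ 2 / σ ^ 2 / α ^ 2 - 1| < x := by
  obtain ⟨⟨w₀, hw₀, hlt⟩, hout⟩ := hω
  have hs1 : 1 ≤ √(1 + x) := Real.one_le_sqrt.2 (by linarith)
  have hle := fun w => le_scaledObjective (x₀ := x₀) hc hf hlam hσ (Matrix.of ω.1) ω.2 w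
  obtain ⟨⟨w, hw⟩, hall⟩ := exists_minimizer_and_norm_mem (rm := α * √(1 - x))
    (rp := α * √(1 + x)) (c := c₂) (w₀ := w₀)
    (convexOn_scaledObjective (x₀ := x₀) hc hlam hσ (Matrix.of ω.1) ω.2)
    (continuous_scaledObjective hf _ _) (hw₀.trans (le_mul_of_one_le_right hα.le hs1))
    (by have := happrox w₀ hw₀; linarith)
    (fun w hw => (hout w (Or.inl hw)).trans (hle w))
    (fun w hw => (hout w (Or.inr hw)).trans (hle w))
  refine ⟨⟨x₀ + σ • w, (isSolution_iff hσ _ _ _).2 hw⟩, fun z hz => ?_⟩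
  have e : z = x₀ + σ • (σ⁻¹ • (z - x₀)) := by
    rw [smul_smul, mul_inv_cancel₀ hσ.ne', one_smul]; abel
  rw [e, isSolution_iff hσ] at hz
  obtain ⟨h1, h2⟩ := hall _ hz
  have e2 : ‖z - x₀‖ ^ 2 / σ ^ 2 = ‖σ⁻¹ • (z - x₀)‖ ^ 2 := by
    rw [norm_smul, norm_inv, Real.norm_of_nonneg hσ.le]; field_simp
  rw [e2]
  have h3 := pow_lt_pow_left₀ h1 (by positivity) two_ne_zero
  have h4 := pow_lt_pow_left₀ h2 (norm_nonneg _) two_ne_zero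
  rw [mul_pow, Real.sq_sqrt (by linarith)] at h3 h4
  have hα2 : 0 < α ^ 2 := by positivity
  rw [abs_lt]
  constructor
  · have h5 : 1 - x < ‖σ⁻¹ • (z - x₀)‖ ^ 2 / α ^ 2 := by rw [lt_div_iff₀ hα2]; linarith
    linarith
  · rw [sub_lt_iff_lt_add, div_lt_iff₀ hα2]; linarith

/-- The constants: the gap `κ` between the first-order objective at excluded errors and its minimum,
in units of `√m`; the shrinkage `η` of the dual variable; and the relative deviation `t`. They
depend only on the two tolerances, and all error terms stay below a third of the gap. -/
lemma exists_constants {e x : ℝ} (he : 0 < e) (hx : 0 < x) :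
    ∃ κ η t : ℝ, 0 < κ ∧ 0 < η ∧ η ≤ 1 / 2 ∧ η ≤ 2 * e ^ 2 ∧ 0 < t ∧ t ≤ 1 ∧
      ∀ α q : ℝ, 0 < α → e ≤ α ^ 2 → α ≤ 1 / e → 1 ≤ q → q ≤ 1 / e →
        κ ≤ α ^ 2 * x ^ 2 / 9 / (4 * q ^ 3) ∧
        η * q + (3 + 2 / η) * (6 * t * (1 + α)) + t * (1 + α) < κ / 3 ∧
        6 * t * (1 + 2 * α) + t * (1 + 2 * α) < κ / 3 := by
  set Q : ℝ := 1 / e with hQ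
  have hQ0 : 0 < Q := by positivity
  set κ : ℝ := e * x ^ 2 / 9 / (4 * Q ^ 3) with hκ
  have hκ0 : 0 < κ := by positivity
  set η : ℝ := min (min (2 * e ^ 2) (1 / 2)) (κ / (12 * Q)) with hη
  have hη0 : 0 < η := by positivity
  set t : ℝ := min 1 (κ / (12 * ((1 + Q) * (19 + 12 / η)))) with ht
  have ht0 : 0 < t := by positivity
  refine ⟨κ, η, t, hκ0, hη0, (min_le_left _ _).trans (min_le_right _ _),
    (min_le_left _ _).trans (min_le_left _ _), ht0, min_le_left _ _, ?_⟩
  intro α q hα hα2 hαQ hq hqQ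
  have h1 : η * q ≤ κ / 12 := by
    have h : η ≤ κ / (12 * Q) := min_le_right _ _
    rw [le_div_iff₀ (by positivity)] at h
    nlinarith
  have h2 : t * ((1 + Q) * (19 + 12 / η)) ≤ κ / 12 := by
    have h : t ≤ κ / (12 * ((1 + Q) * (19 + 12 / η))) := min_le_right _ _
    rw [le_div_iff₀ (by positivity)] at h
    linarith
  have h3 : t * ((1 + α) * (19 + 12 / η)) ≤ κ / 12 := by
    refine le_trans ?_ h2
    gcongr
  have h4 : 0 < 12 / η := by positivity
  refine ⟨?_, ?_, ?_⟩
  · rw [hκ]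
    gcongr
  · have h5 : (3 + 2 / η) * (6 * t * (1 + α)) + t * (1 + α) = t * ((1 + α) * (19 + 12 / η)) := by
      ring
    linarith
  · have h6 : t * (19 * (1 + α)) ≤ t * ((1 + α) * (19 + 12 / η)) := by
      refine mul_le_mul_of_nonneg_left ?_ ht0.le
      nlinarith [mul_pos h4 (by linarith : 0 < 1 + α)]
    nlinarith [mul_pos ht0 hα]

/-- Beyond some dimension the concentration offset is negligible against `t √m` and the number of
exceptional events is absorbed by the exponential rate. -/
lemma exists_forall_ge_dimension {t : ℝ} (ht : 0 < t) :
    ∃ m₀ : ℕ, ∀ m : ℕ, m₀ ≤ m →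
      0 < m ∧ 2 * concentrationOffset ≤ t * √m ∧ 26 ≤ Real.exp (t ^ 2 / 40 * m) := by
  have h1 : Filter.Tendsto (fun m : ℕ => t * √(m : ℝ)) Filter.atTop Filter.atTop :=
    (Real.tendsto_sqrt_atTop.comp tendsto_natCast_atTop_atTop).const_mul_atTop ht
  have h2 : Filter.Tendsto (fun m : ℕ => Real.exp (t ^ 2 / 40 * m)) Filter.atTop Filter.atTop :=
    Real.tendsto_exp_atTop.comp
      (tendsto_natCast_atTop_atTop.const_mul_atTop (by positivity : 0 < t ^ 2 / 40))
  exact Filter.eventually_atTop.1 ((Filter.eventually_gt_atTop 0).and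
    ((h1.eventually_ge_atTop _).and (h2.eventually_ge_atTop _)))

lemma subdifferential_eq_univ_of_dim_zero (f : Vec 0 → ℝ) (x₀ : Vec 0) :
    subdifferential f x₀ = Set.univ := by
  ext s
  simp only [subdifferential, Set.mem_ofPred_eq, Set.mem_univ, iff_true]
  intro x
  rw [Subsingleton.elim x x₀]
  simp

/-- The failure probability counts `6 + 6 + 1` two-sided tail events. -/
lemma one_sub_le_measureReal_of_compl_le {Ω : Type*} [MeasurableSpace Ω] {μ : Measure Ω}
    [IsProbabilityMeasure μ] {E : Set Ω} (hE : MeasurableSet E) {P : ℝ} (hP : 0 ≤ P)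
    (h : μ Eᶜ ≤ (6 * ENNReal.ofReal (2 * P) + 6 * ENNReal.ofReal (2 * P))
      + ENNReal.ofReal (2 * P)) :
    1 - 26 * P ≤ μ.real E := by
  have h2 : μ.real Eᶜ ≤ 26 * P := by
    refine ENNReal.toReal_le_of_le_ofReal (by positivity) (h.trans (le_of_eq ?_))
    have e6 : (6 : ENNReal) = ENNReal.ofReal 6 := by norm_num
    rw [e6, ← ENNReal.ofReal_mul (by norm_num), ← ENNReal.ofReal_add (by positivity)
      (by positivity), ← ENNReal.ofReal_add (by positivity) (by positivity)]
    congr 1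
    ring
  rw [probReal_compl_eq_one_sub hE] at h2
  linarith

/-- For large `m`, a constant multiple of the concentration rate is absorbed into the exponent. -/
lemma mul_exp_le_exp_neg_mul_min {t : ℝ} (hexp : 26 ≤ Real.exp (t ^ 2 / 40 * m)) :
    26 * Real.exp (-(t * √m) ^ 2 / 20)
      ≤ Real.exp (-(t ^ 2 / 40) * min (m : ℝ) ((m : ℝ) ^ 2 / n)) := by
  have hP26 : 26 * Real.exp (-(t * √m) ^ 2 / 20) ≤ Real.exp (-(t ^ 2 / 40) * m) := by
    have e1 : Real.exp (-(t * √m) ^ 2 / 20)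
        = Real.exp (-(t ^ 2 / 40) * m) * Real.exp (-(t ^ 2 / 40) * m) := by
      rw [← Real.exp_add, mul_pow, Real.sq_sqrt (Nat.cast_nonneg m)]
      congr 1
      ring
    have e2 : Real.exp (-(t ^ 2 / 40) * m) = (Real.exp (t ^ 2 / 40 * m))⁻¹ := by
      rw [← Real.exp_neg, neg_mul]
    have h1 : 26 * Real.exp (-(t ^ 2 / 40) * m) ≤ 1 := by
      rw [e2, ← div_eq_mul_inv]
      exact (div_le_one (Real.exp_pos _)).2 hexp
    rw [e1, ← mul_assoc]
    exact mul_le_of_le_one_left (Real.exp_pos _).le h1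
  refine hP26.trans (Real.exp_le_exp.2 (mul_le_mul_of_nonpos_left (min_le_left _ _) ?_))
  have : 0 ≤ t ^ 2 := sq_nonneg t
  linarith

end Assembly

end

end EllTwoLasso

theorem mainTheorem2 :
    ∀ εL : ℝ, 0 < εL → ∀ ε : ℝ, 0 < ε →
      ∃ C : ℝ, 0 < C ∧ ∃ m₀ : ℕ,
        ∀ (m n : ℕ) (f : EllTwoLasso.Vec n → ℝ) (x₀ : EllTwoLasso.Vec n) (lam : ℝ),
          m₀ ≤ m →
          ConvexOn ℝ Set.univ f → Continuous f →
          (0 : EllTwoLasso.Vec n) ∉ EllTwoLasso.subdifferential f x₀ →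
          0 ≤ lam →
          max (EllTwoLasso.gaussDist f x₀ lam)
              (EllTwoLasso.gaussDist f x₀ lam + EllTwoLasso.gaussCorr f x₀ lam)
            ≤ (1 - εL) * m →
          εL * m ≤ EllTwoLasso.gaussDist f x₀ lam →
          ∃ σ₀ : ℝ, 0 < σ₀ ∧ ∀ σ : ℝ, 0 < σ → σ ≤ σ₀ →
            ∃ E : Set ((Fin m → Fin n → ℝ) × EllTwoLasso.Vec m), MeasurableSet E ∧
              1 - Real.exp (-C * min (m : ℝ) ((m : ℝ) ^ 2 / n)) ≤
                (EllTwoLasso.modelLaw m n).real E ∧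
              ∀ ω ∈ E,
                (∃ x, EllTwoLasso.IsSolution f lam (Matrix.of ω.1)
                  (EllTwoLasso.observation (Matrix.of ω.1) ω.2 x₀ σ) x) ∧
                ∀ x, EllTwoLasso.IsSolution f lam (Matrix.of ω.1)
                    (EllTwoLasso.observation (Matrix.of ω.1) ω.2 x₀ σ) x →
                  |‖x - x₀‖ ^ 2 / σ ^ 2 *
                      (((m : ℝ) - EllTwoLasso.gaussDist f x₀ lam) /
                        EllTwoLasso.gaussDist f x₀ lam) - 1| < ε := by
  intro e he ε hε
  set x : ℝ := min ε (1 / 2) with hx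
  have hx0 : 0 < x := by positivity
  have hxε : x ≤ ε := min_le_left _ _
  have hx2 : x ≤ 1 / 2 := min_le_right _ _
  obtain ⟨κ, η, t, hκ, hη, hη2, hηe, ht0, ht1, hconst⟩ := EllTwoLasso.exists_constants he hx0
  obtain ⟨m₀, hm₀⟩ := EllTwoLasso.exists_forall_ge_dimension ht0
  refine ⟨t ^ 2 / 40, by positivity, m₀, ?_⟩
  intro m n f x₀ lam hm hc hf h0 hlam hmax hlow
  obtain ⟨hm0, hoff, hexp⟩ := hm₀ m hm
  -- in dimension `0` every vector is a subgradient
  have hn : 0 < n := by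
    rcases Nat.eq_zero_or_pos n with rfl | h
    · exact absurd (by rw [EllTwoLasso.subdifferential_eq_univ_of_dim_zero]; trivial) h0
    · exact h
  have hM : (0 : ℝ) < m := by exact_mod_cast hm0
  have ha : 0 < √(m : ℝ) := Real.sqrt_pos.2 hM
  set K := lam • EllTwoLasso.subdifferential f x₀ with hK
  have hKne : K.Nonempty := (EllTwoLasso.subdifferential_nonempty hc hf x₀).smul_set
  have hKc : IsCompact K := EllTwoLasso.isCompact_smul_subdifferential hf x₀ lam
  have hKconv : Convex ℝ K := (EllTwoLasso.convex_subdifferential f x₀).smul lam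
  have hDeq : EllTwoLasso.gaussDist f x₀ lam = EllTwoLasso.meanSqDist K 1 := by
    simp only [EllTwoLasso.gaussDist, EllTwoLasso.meanSqDist, one_smul, hK]
  have hD1 := (le_max_left _ _).trans hmax
  have hDC := (le_max_right _ _).trans hmax
  simp only [EllTwoLasso.gaussCorr, ← hK] at hDC
  rw [hDeq] at hlow hD1 hDC
  simp only [hDeq]
  set D := EllTwoLasso.meanSqDist K 1 with hDdef
  obtain ⟨hα, hα2, heα, hq, hq2, hαe, hqe, hDα⟩ :=
    EllTwoLasso.predicted_error_facts he hM hlow hD1 rfl rfl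
  set α := √(D / (m - D)) with hαdef
  set q := √(1 + α ^ 2) with hqdef
  obtain ⟨hκq, hs₁, hs₂⟩ := hconst α q hα heα hαe hq hqe
  -- the localization levels lie a third and two thirds up the gap `κ`
  set c₁ := √(m : ℝ) * (1 / q + κ / 3) with hc₁
  set c₂ := √(m : ℝ) * (1 / q + κ - κ / 3) with hc₂
  have hgap : c₂ - c₁ = √(m : ℝ) * (κ / 3) := by rw [hc₁, hc₂]; ring
  have hgap0 : 0 < c₂ - c₁ := by rw [hgap]; positivity
  -- the first-order error at the dip is at most the distance between the levels; the factor
  -- `1 + lam` keeps the slope finite at `lam = 0`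
  obtain ⟨r, hr, happrox⟩ := EllTwoLasso.exists_scaledObjective_le (m := m) hc hf x₀ hlam
    (δ := (c₂ - c₁) / ((1 + lam) * α)) (by positivity)
  refine ⟨r / α, by positivity, fun σ hσ hσr => ?_⟩
  refine ⟨EllTwoLasso.localizationEvent m K α x c₁ c₂,
    EllTwoLasso.measurableSet_localizationEvent _ _ _ _ _, ?_, fun ω hω => ?_⟩
  · have hfail := EllTwoLasso.modelLaw_compl_localizationEvent_le K (x := x) (α := α) (c₁ := c₁)
      (c₂ := c₂) hoff
      (fun v hv => EllTwoLasso.measure_forall_le_objective_le_exp hm0 hn hKne hKc hKconv he hη hη2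
        hηe hlow hDC hα hq hq2 hDα ht0 ht1 hoff hv hs₁)
      (fun v hv => EllTwoLasso.measure_exists_objective_lt_le_exp hm0 hKne hKc hKconv
        ⟨0, EllTwoLasso.zero_mem_excludedErrors hα.le⟩
        (fun w hw => EllTwoLasso.norm_le_of_mem_excludedErrors hα hx0 hx2 hw)
        (fun w hw => hκq.trans
          (EllTwoLasso.sq_sub_div_ge_of_mem_excludedErrors hα hx0 hx2 hq hw)) hα hq hq2
        hDα ht0 ht1 hoff hv hs₂)
    exact (sub_le_sub_left (EllTwoLasso.mul_exp_le_exp_neg_mul_min hexp) 1).trans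
      (EllTwoLasso.one_sub_le_measureReal_of_compl_le
        (EllTwoLasso.measurableSet_localizationEvent _ _ _ _ _) (Real.exp_pos _).le hfail)
  · obtain ⟨hex, hall⟩ := EllTwoLasso.solution_of_mem_localizationEvent hc hf hlam hσ hα hx0
      (by linarith) hω fun w hw => by
        refine (happrox σ hσ (Matrix.of ω.1) ω.2 w ?_).trans (add_le_add le_rfl ?_)
        · calc σ * ‖w‖ ≤ r / α * α := mul_le_mul hσr hw (norm_nonneg _) (by positivity)
            _ = r := div_mul_cancel₀ _ hα.ne'
        · calc lam * ((c₂ - c₁) / ((1 + lam) * α)) * ‖w‖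
              ≤ (1 + lam) * ((c₂ - c₁) / ((1 + lam) * α)) * α := by
                gcongr; linarith
            _ = c₂ - c₁ := by field_simp
    refine ⟨hex, fun z hz => ?_⟩
    have h := (hall z hz).trans_le hxε
    rwa [div_eq_mul_inv _ (α ^ 2), hα2, inv_div] at h
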